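/- Notation. Let $n,k,d\in\mathbb N$. Write $\mathbb S^n$, $\mathbb S^n_+$, $\mathbb S^n_{++}$ for the symmetric, positive semidefinite and positive definite real $n\times n$ matrices, $\mathbb M^n=\mathbb R^{n\times n}$, $A\cdot B=\operatorname{tr}(A^{\mathrm T}B)$ and $\mathbb X=\mathbb S^n\times\mathbb R^{n\times k}\times\mathbb M^n$. For a compact set $K$, $\mathcal M(K,V)$ denotes the $V$-valued Radon measures on $K$, with the weak-star topology given by duality with continuous functions on $K$. Fix $\Lambda=(\Lambda_1,\Lambda_2)$ with $\Lambda_1\in\mathbb S^k_+$, $\Lambda_2\in\mathbb S^n_{++}$, and let $$J_\Lambda(X,Y,Z)=\sup\Big\{X\cdot A+Y\cdot B+Z\cdot C\;:\;(A,B,C)\in\mathbb X,\ A+\tfrac12B\Lambda_1^2B^{\mathrm T}+\tfrac12C\Lambda_2^2C^{\mathrm T}\preceq0\Big\}\in[0,\infty].$$ For $\mu=(\mathsf G,\mathsf q,\mathsf R)\in\mathcal M(K,\mathbb X)$ the action is $\mathcal J_{\Lambda,K}(\mu)=\int_KJ_\Lambda\big(\tfrac{d\mu}{d\lambda}\big)\,d\lambda$,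 for any finite positive measure $\lambda$ with $|\mu|\ll\lambda$ (it does not depend on $\lambda$). Let $\mathsf D^*$ be a first-order linear differential operator in $x\in\mathbb R^d$ with constant coefficients, mapping $\mathbb S^n$-valued to $\mathbb R^{n\times k}$-valued functions, with $\mathsf D^*(I)=0$. Let $\Omega\subset\mathbb R^d$ be compact and $Q=[0,1]\times\Omega$. For $\mathsf G_0,\mathsf G_1\in\mathcal M(\Omega,\mathbb S^n_+)$ let $\mathcal{CE}([0,1];\mathsf G_0,\mathsf G_1)$ be the set of $\mu=(\mathsf G,\mathsf q,\mathsf R)\in\mathcal M(Q,\mathbb X)$ such that for all $C^1$ functions $\Phi$ with values in $\mathbb S^n$ $$\int_Q\partial_t\Phi\cdot d\mathsf G+\mathsf D^*\Phi\cdot d\mathsf q+\Phi\cdot d\mathsf R=\int_\Omega\Phi(1,\cdot)\cdot d\mathsf G_1-\int_\Omega\Phi(0,\cdot)\cdot d\mathsf G_0 ,$$ let $\mathcal{CE}_\infty([0,1];\mathsf G_0,\mathsf G_1)$ be the subset of those $\mu$ with $\mathcal J_{\Lambda,Q}(\mu)<\infty$, and let $\mathrm{WB}_\Lambda(\mathsf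 G_0,\mathsf G_1)\ge 0$ be defined by $\mathrm{WB}_\Lambda^2(\mathsf G_0,\mathsf G_1)=\inf\{\mathcal J_{\Lambda,Q}(\mu):\mu\in\mathcal{CE}([0,1];\mathsf G_0,\mathsf G_1)\}$. Proposition. Assume that (A.1) $\Omega$ is compact and star-shaped with respect to each point of a set with nonempty interior; (A.2) $k=k_1+k_2$ and $\mathsf D^*\Phi=(\mathsf D_0^*\Phi,\mathsf D_1^*\Phi)$, where $\mathsf D_0^*:\mathbb S^n\to\mathbb R^{n\times k_1}$ is linear (order zero) and $\mathsf D_1^*$ is homogeneous of order one with values in $\mathbb R^{n\times k_2}$-valued functions. Let $\mathsf G_0,\mathsf G_1\in\mathcal M(\Omega,\mathbb S^n_+)$ and $\mu=(\mathsf G,\mathsf q,\mathsf R)\in\mathcal{CE}_\infty([0,1];\mathsf G_0,\mathsf G_1)$. Then there exist sequences $\mathsf G_0^N,\mathsf G_1^N\in\mathcal M(\Omega,\mathbb S^n_+)$ and $\mu^N=(\mathsf G^N,\mathsf q^N,\mathsf R^N)\in\mathcal{CE}_\infty([0,1];\mathsf G_0^N,\mathsf G_1^N)$, $N\in\mathbb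 N$, such that: 1. For every $N$, the measures $\mathsf G_0^N,\mathsf G_1^N$ on $\Omega$ and $\mathsf G^N,\mathsf q^N,\mathsf R^N$ on $Q$ have $C^\infty$ densities (smooth up to the boundary) with respect to the Lebesgue measure, and the density $G^N$ of $\mathsf G^N$ is uniformly elliptic: $G^N\succeq c_NI$ on $Q$ for some $c_N>0$. 2. $\mu^N$ converges weak-star to $\mu$, and $\lim_{N\to\infty}\mathcal J_{\Lambda,Q}(\mu^N)=\mathcal J_{\Lambda,Q}(\mu)$. 3. $\mathsf G_0^N$ and $\mathsf G_1^N$ converge weak-star to $\mathsf G_0$ and $\mathsf G_1$, respectively. If moreover (A.3) $\mathsf G_0$ and $\mathsf G_1$ are absolutely continuous with respect to the Lebesgue measure, then the sequences can be chosen such that also $\lim_{N\to\infty}\mathrm{WB}_\Lambda(\mathsf G_0,\mathsf G_0^N)=0$ and $\lim_{N\to\infty}\mathrm{WB}_\Lambda(\mathsf G_1,\mathsf G_1^N)=0$. -/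

import Mathlib

open MeasureTheory Filter Topology
open scoped ENNReal ContDiff

namespace MatrixOT

noncomputable section

/-- The physical space `ℝ^d` with its Euclidean norm. -/
abbrev Space (d : ℕ) : Type := EuclideanSpace ℝ (Fin d)

/-- The time-space domain `Q = [0,1] × Ω`. -/
def timeSpace {d : ℕ} (Ω : Set (Space d)) : Set (ℝ × Space d) := Set.Icc 0 1 ×ˢ Ω

/-- The Frobenius inner product `A · B = tr (Aᵀ B)`. -/
def frob {p m : ℕ} (A B : Matrix (Fin p) (Fin m) ℝ) : ℝ := (A.transpose * B).trace

/-! ### Matrix-valued measures -/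

/-- Matrix-valued finite Borel measures, identified with the matrix of their entries. A measure on a
compact subset `K` of `X` is a measure on `X` that is concentrated on `K`, see `IsOn`. -/
abbrev MatrixMeasure (X : Type*) [MeasurableSpace X] (p m : ℕ) : Type _ :=
  Matrix (Fin p) (Fin m) (SignedMeasure X)

section Measures

variable {X : Type*} [MeasurableSpace X] {n p m k : ℕ}

/-- The matrix `μ(E)`. -/
def MatrixMeasure.value (μ : MatrixMeasure X p m) (E : Set X) : Matrix (Fin p) (Fin m) ℝ :=
  Matrix.of fun i j => μ i j E

/-- `μ` is concentrated on `K`. -/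
def MatrixMeasure.IsOn (μ : MatrixMeasure X p m) (K : Set X) : Prop :=
  ∀ E, MeasurableSet E → Disjoint E K → μ.value E = 0

/-- The duality pairing `⟨μ, Φ⟩ = ∫ Φ · dμ`. -/
def MatrixMeasure.pairing (μ : MatrixMeasure X p m) (Φ : X → Matrix (Fin p) (Fin m) ℝ) : ℝ :=
  ∑ i, ∑ j, ∫ᵛ x, Φ x i j ∂<•(μ i j)

/-- Weak-star convergence in `𝓜(K, ℝ^{p × m}) = C(K, ℝ^{p × m})^*`. -/
def WeakStarTendsto [TopologicalSpace X] (K : Set X)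
    (μs : ℕ → MatrixMeasure X p m) (μ : MatrixMeasure X p m) : Prop :=
  ∀ Φ : X → Matrix (Fin p) (Fin m) ℝ, ContinuousOn Φ K →
    Tendsto (fun N => (μs N).pairing Φ) atTop (𝓝 (μ.pairing Φ))

/-- `𝓜(K, 𝕊ⁿ₊)`: measures on `K` with values in the positive semidefinite matrices. -/
def psdMeasures (K : Set X) (n : ℕ) : Set (MatrixMeasure X n n) :=
  {G | G.IsOn K ∧ ∀ E, MeasurableSet E → (G.value E).PosSemidef}

/-- `μ` has the density `g` with respect to the measure `ν` (`g` will be `ν`-integrable). -/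
def MatrixMeasure.HasDensity (μ : MatrixMeasure X p m) (ν : Measure X)
    (g : X → Matrix (Fin p) (Fin m) ℝ) : Prop :=
  ∀ i j, Integrable (fun x => g x i j) ν ∧ μ i j = ν.withDensityᵥ (fun x => g x i j)

/-- `|μ| ≪ ν`. -/
def MatrixMeasure.AbsCont (μ : MatrixMeasure X p m) (ν : Measure X) : Prop :=
  ∀ i j, (μ i j).totalVariation ≪ ν

/-- The sum of the total variations of the entries, a finite measure equivalent to `|μ|`. -/
def MatrixMeasure.refMeasure (μ : MatrixMeasure X p m) : Measure X :=
  ∑ i, ∑ j, (μ i j).totalVariation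

/-- The Radon-Nikodym density `dμ/dν` (meaningful for `|μ| ≪ ν`). -/
def MatrixMeasure.density (μ : MatrixMeasure X p m) (ν : Measure X) (x : X) :
    Matrix (Fin p) (Fin m) ℝ :=
  Matrix.of fun i j => (μ i j).rnDeriv ν x

/-- Triplets `μ = (G, q, R)` of matrix-valued measures of sizes `n × n`, `n × k`, `n × n`. -/
structure Triplet (X : Type*) [MeasurableSpace X] (n k : ℕ) where
  G : MatrixMeasure X n n
  q : MatrixMeasure X n k
  R : MatrixMeasure X n n

/-- `𝓜(K, 𝕏)` with `𝕏 = 𝕊ⁿ × ℝ^{n × k} × 𝕄ⁿ`. -/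
def tripletMeasures (K : Set X) (n k : ℕ) : Set (Triplet X n k) :=
  {μ | μ.G.IsOn K ∧ μ.q.IsOn K ∧ μ.R.IsOn K ∧
    ∀ E, MeasurableSet E → (μ.G.value E).IsSymm}

/-- Weak-star convergence in `𝓜(K, 𝕏)`. -/
def TripletWeakStarTendsto [TopologicalSpace X] (K : Set X)
    (μs : ℕ → Triplet X n k) (μ : Triplet X n k) : Prop :=
  WeakStarTendsto K (fun N => (μs N).G) μ.G ∧
  WeakStarTendsto K (fun N => (μs N).q) μ.q ∧
  WeakStarTendsto K (fun N => (μs N).R) μ.R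

/-! ### The action functional -/

/-- The closed convex set `𝓞_Λ` of all `(A, B, C)` with `A` symmetric and
`A + ½ B Λ₁² Bᵀ + ½ C Λ₂² Cᵀ ⪯ 0`. -/
def admissible (Λ₁ : Matrix (Fin k) (Fin k) ℝ) (Λ₂ : Matrix (Fin n) (Fin n) ℝ) :
    Set (Matrix (Fin n) (Fin n) ℝ × Matrix (Fin n) (Fin k) ℝ × Matrix (Fin n) (Fin n) ℝ) :=
  {P | P.1.IsSymm ∧
    (-(P.1 + (1 / 2 : ℝ) • (P.2.1 * Λ₁ ^ 2 * P.2.1.transpose)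
      + (1 / 2 : ℝ) • (P.2.2 * Λ₂ ^ 2 * P.2.2.transpose))).PosSemidef}

/-- `J_Λ`, the support function of `𝓞_Λ`. Since `(0,0,0) ∈ 𝓞_Λ`, the supremum of
`X · A + Y · B + Z · C` lies in `[0, ∞]`, so that the truncation at `0` changes nothing. -/
def costDensity (Λ₁ : Matrix (Fin k) (Fin k) ℝ) (Λ₂ : Matrix (Fin n) (Fin n) ℝ)
    (X : Matrix (Fin n) (Fin n) ℝ) (Y : Matrix (Fin n) (Fin k) ℝ)
    (Z : Matrix (Fin n) (Fin n) ℝ) : ℝ≥0∞ :=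
  ⨆ P ∈ admissible Λ₁ Λ₂, ENNReal.ofReal (frob X P.1 + frob Y P.2.1 + frob Z P.2.2)

/-- A finite reference measure that dominates all three components of `μ`. -/
def Triplet.refMeasure (μ : Triplet X n k) : Measure X :=
  μ.G.refMeasure + μ.q.refMeasure + μ.R.refMeasure

/-- The action `𝓙_{Λ,K}(μ) = ∫_K J_Λ (dμ/dλ) dλ`. As `J_Λ` is positively homogeneous of degree one,
it does not depend on the choice of the dominating measure `λ`. -/
def action (Λ₁ : Matrix (Fin k) (Fin k) ℝ) (Λ₂ : Matrix (Fin n) (Fin n) ℝ) (K : Set X)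
    (μ : Triplet X n k) : ℝ≥0∞ :=
  ∫⁻ x in K, costDensity Λ₁ Λ₂ (μ.G.density μ.refMeasure x) (μ.q.density μ.refMeasure x)
    (μ.R.density μ.refMeasure x) ∂μ.refMeasure

end Measures

/-! ### The continuity equation -/

section ContinuityEquation

variable {d n k : ℕ}

/-- A first-order constant-coefficient linear differential operator
`D^* Φ = D₀^* Φ + ∑ₗ Aₗ (∂ₗ Φ)` from `𝕊ⁿ`-valued to `ℝ^{n × k}`-valued functions, with
`D^* I = 0`. Only the values of the coefficient maps on symmetric matrices matter. -/
structure DiffOp (d n k : ℕ) where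
  zeroth : Matrix (Fin n) (Fin n) ℝ →ₗ[ℝ] Matrix (Fin n) (Fin k) ℝ
  first : Fin d → (Matrix (Fin n) (Fin n) ℝ →ₗ[ℝ] Matrix (Fin n) (Fin k) ℝ)
  zeroth_one : zeroth 1 = 0

/-- The entrywise partial derivative `∂ₗ Φ`. -/
def spaceDeriv (l : Fin d) (Φ : Space d → Matrix (Fin n) (Fin n) ℝ) (x : Space d) :
    Matrix (Fin n) (Fin n) ℝ :=
  Matrix.of fun i j => lineDeriv ℝ (fun y => Φ y i j) x (EuclideanSpace.single l 1)

/-- `D^* Φ`. -/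
def DiffOp.apply (D : DiffOp d n k) (Φ : Space d → Matrix (Fin n) (Fin n) ℝ) (x : Space d) :
    Matrix (Fin n) (Fin k) ℝ :=
  D.zeroth (Φ x) + ∑ l, D.first l (spaceDeriv l Φ x)

/-- The columns split as `k = k₁ + k₂` so that `D^* = (D₀^*, D₁^*)`: the first `k₁` columns of
`D^* Φ` are of order zero in `Φ`, and the last `k₂` are homogeneous of order one. -/
def DiffOp.Splits (D : DiffOp d n k) : Prop :=
  ∃ k₁ k₂ : ℕ, k = k₁ + k₂ ∧ ∀ A : Matrix (Fin n) (Fin n) ℝ, A.IsSymm → ∀ (i : Fin n) (j : Fin k),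
    (k₁ ≤ (j : ℕ) → D.zeroth A i j = 0) ∧ ((j : ℕ) < k₁ → ∀ l, D.first l A i j = 0)

/-- The entrywise time derivative `∂ₜ Φ`. -/
def timeDeriv (Φ : ℝ × Space d → Matrix (Fin n) (Fin n) ℝ) (z : ℝ × Space d) :
    Matrix (Fin n) (Fin n) ℝ :=
  Matrix.of fun i j => deriv (fun s => Φ (s, z.2) i j) z.1

/-- Every entry of `Φ` is of class `C^r` on the whole space. -/
def EntrywiseContDiff {V : Type*} [NormedAddCommGroup V] [NormedSpace ℝ V] {p m : ℕ}
    (r : WithTop ℕ∞) (Φ : V → Matrix (Fin p) (Fin m) ℝ) : Prop :=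
  ∀ i j, ContDiff ℝ r (fun z => Φ z i j)

/-- `𝓒𝓔([0,1]; G₀, G₁)`: the triplets on `Q = [0,1] × Ω` that satisfy
`∂ₜ G + D q = R^sym + δ₀ ⊗ G₀ - δ₁ ⊗ G₁`, in weak form. -/
def continuityEq (D : DiffOp d n k) (Ω : Set (Space d)) (G₀ G₁ : MatrixMeasure (Space d) n n) :
    Set (Triplet (ℝ × Space d) n k) :=
  {μ | μ ∈ tripletMeasures (timeSpace Ω) n k ∧
    ∀ Φ : ℝ × Space d → Matrix (Fin n) (Fin n) ℝ, EntrywiseContDiff 1 Φ → (∀ z, (Φ z).IsSymm) →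
      μ.G.pairing (timeDeriv Φ) + μ.q.pairing (fun z => D.apply (fun y => Φ (z.1, y)) z.2)
        + μ.R.pairing Φ
      = G₁.pairing (fun x => Φ (1, x)) - G₀.pairing (fun x => Φ (0, x))}

/-- `𝓒𝓔_∞([0,1]; G₀, G₁)`: the curves of finite action. -/
def finiteEnergyCurves (Λ₁ : Matrix (Fin k) (Fin k) ℝ) (Λ₂ : Matrix (Fin n) (Fin n) ℝ)
    (D : DiffOp d n k) (Ω : Set (Space d)) (G₀ G₁ : MatrixMeasure (Space d) n n) :
    Set (Triplet (ℝ × Space d) n k) :=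
  {μ | μ ∈ continuityEq D Ω G₀ G₁ ∧ action Λ₁ Λ₂ (timeSpace Ω) μ < ⊤}

/-- The weighted Wasserstein-Bures distance: `WB_Λ²` is the infimum of the action over all curves
that connect `G₀` and `G₁`. -/
def wbDist (Λ₁ : Matrix (Fin k) (Fin k) ℝ) (Λ₂ : Matrix (Fin n) (Fin n) ℝ)
    (D : DiffOp d n k) (Ω : Set (Space d)) (G₀ G₁ : MatrixMeasure (Space d) n n) : ℝ≥0∞ :=
  (⨅ μ ∈ continuityEq D Ω G₀ G₁, action Λ₁ Λ₂ (timeSpace Ω) μ) ^ (1 / 2 : ℝ)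

/-- `Ω` is star-shaped with respect to a set of points with nonempty interior. -/
def IsStarShapedWrtBall (Ω : Set (Space d)) : Prop :=
  (interior {y | y ∈ Ω ∧ StarConvex ℝ y Ω}).Nonempty

/-- `μ` on `K` has a `C^∞` density, smooth up to the boundary of `K`, with respect to the Lebesgue
measure on `K`. -/
def HasSmoothDensity {V : Type*} [NormedAddCommGroup V] [NormedSpace ℝ V] [MeasureSpace V]
    {p m : ℕ} (μ : MatrixMeasure V p m) (K : Set V) (g : V → Matrix (Fin p) (Fin m) ℝ) : Prop :=
  EntrywiseContDiff ∞ g ∧ μ.HasDensity (volume.restrict K) g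

/-- `g` is uniformly elliptic on `K`: `g ⪰ c I` on `K` for some `c > 0`. -/
def UniformlyElliptic {V : Type*} (K : Set V) (g : V → Matrix (Fin n) (Fin n) ℝ) : Prop :=
  ∃ c : ℝ, 0 < c ∧ ∀ z ∈ K, (g z - c • (1 : Matrix (Fin n) (Fin n) ℝ)).PosSemidef

end ContinuityEquation

end

end MatrixOT

namespace MatrixOT

noncomputable section

open Matrix

set_option linter.unusedSectionVars false

/-! ### Linear algebra of the Frobenius product -/

section Cost

variable {n k p m : ℕ}

/-! Let x₀ be the centre of a ball of radius r ≤ 1/2 all of whose points are star centres of Ω. The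
contraction of ratio 1 - e towards (1/2, x₀), followed by any translation of size less than e r,
maps Q into itself. Pushing μ forward under it and convolving with a smooth kernel supported in the
ball of radius e r therefore gives smooth densities that lose no mass outside Q. The approximation
is this regularization, suitably corrected, as e → 0.

Continuity equation. Testing with Φ composed with the contraction puts a factor 1 - e in front of
every derivative of Φ, so G and q are multiplied by 1 - e. The order-zero part of D^* gains no such
factor; the remainder e D₀^*Φ · q is moved into the reaction, which becomes R plus e times the
adjoint of D₀^* applied to q (`CurveData.Z'`). The endpoint terms now sit near the times e/2 and 1 -
e/2, smeared by the time kernel ψ. They are absorbed by adding to G the smeared endpoint measures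
times cutoffs χ₀(t), χ₁(t) whose derivatives are, up to sign, these kernels. Finally a multiple of
the identity that does not depend on time (`CurveData.lift`) is added to G and to both endpoints; it
leaves the equation intact and makes G elliptic. This is `CurveData.triplet_mem_continuityEq`.

Upper bound for the action. The cost J is subadditive, positively homogeneous and decreasing in its
first argument. Hence additional positive semidefinite terms in G are free, and by Jensen's
inequality (`costDensity_smearMatrix_le`) smearing does not increase the action. The factor 1 - e on
(G, q) costs at most (1 - e)⁻¹. It remains to pay for the extra reaction. The cost controls the flux
through |Y|² ≤ C (tr X) J, and a reaction Z against a I costs at most C |Z|²/a. With κ (tr X) I in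
the first component the extra reaction thus costs C (e²/κ) J (`exists_costDensity_perturbation_le`).
For κ = r e^{3/2} this is of order √e J. Such a term is available inside `lift`: as ψ ≤ 1/(e r), κ
times the smeared trace is at most √e times the smeared time marginal of the trace, whose L¹ norm is
bounded.

Lower bound for the action. J is a supremum of countably many linear functions, which are glued by
continuous weights (`exists_continuous_weights`). The action is then approximated from below by
pairings with continuous functions, and these pass to the weak-star limit.

Endpoints in WB. If the endpoints have densities, their regularizations converge in L¹. An explicit
curve without flux shows that WB² is at most a constant times the L¹ distance of the densities
(`exists_wbDist_le`). -/

theorem frob_eq_sum (A B : Matrix (Fin p) (Fin m) ℝ) : frob A B = ∑ i, ∑ j, A i j * B i j := by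
  simp only [frob, Matrix.trace, Matrix.diag, Matrix.mul_apply, Matrix.transpose_apply]
  exact Finset.sum_comm

theorem frob_add_left (A A' B : Matrix (Fin p) (Fin m) ℝ) :
    frob (A + A') B = frob A B + frob A' B := by
  simp [frob, Matrix.add_mul]

theorem frob_smul_left (c : ℝ) (A B : Matrix (Fin p) (Fin m) ℝ) :
    frob (c • A) B = c * frob A B := by
  simp [frob]

theorem frob_smul_right (c : ℝ) (A B : Matrix (Fin p) (Fin m) ℝ) :
    frob A (c • B) = c * frob A B := by
  simp [frob]

theorem frob_zero_left (B : Matrix (Fin p) (Fin m) ℝ) : frob 0 B = 0 := by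
  simp [frob]

theorem frob_zero_right (B : Matrix (Fin p) (Fin m) ℝ) : frob B 0 = 0 := by
  simp [frob]

theorem frob_neg_right (A B : Matrix (Fin p) (Fin m) ℝ) : frob A (-B) = -frob A B := by
  simp [frob]

theorem posSemidef_iff_isSymm {A : Matrix (Fin n) (Fin n) ℝ} :
    A.PosSemidef ↔ A.IsSymm ∧ ∀ v : Fin n → ℝ, 0 ≤ v ⬝ᵥ A *ᵥ v := by
  rw [Matrix.posSemidef_iff_dotProduct_mulVec]
  simp [Matrix.IsHermitian, Matrix.IsSymm, Matrix.conjTranspose_eq_transpose_of_trivial]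

theorem dotProduct_mulVec_self_eq_sum (A : Matrix (Fin n) (Fin n) ℝ) (v : Fin n → ℝ) :
    v ⬝ᵥ A *ᵥ v = ∑ i, ∑ j, A i j * (v i * v j) := by
  simp only [dotProduct, Matrix.mulVec, Finset.mul_sum]
  exact Finset.sum_congr rfl fun i _ => Finset.sum_congr rfl fun j _ => by ring

/-- By the Schur product theorem the entrywise product is positive semidefinite, and the sum of its
entries is its quadratic form at the all-ones vector. -/
theorem frob_nonneg_of_posSemidef {A B : Matrix (Fin n) (Fin n) ℝ} (hA : A.PosSemidef)
    (hB : B.PosSemidef) : 0 ≤ frob A B := by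
  have h := (posSemidef_iff_isSymm.1 (hA.hadamard hB)).2 (fun _ => 1)
  rw [dotProduct_mulVec_self_eq_sum] at h
  simpa [frob_eq_sum] using h

theorem frob_one_left (A : Matrix (Fin n) (Fin n) ℝ) : frob 1 A = A.trace := by
  simp [frob]

theorem trace_mul_transpose_self (A : Matrix (Fin p) (Fin m) ℝ) :
    (A * A.transpose).trace = ∑ i, ∑ j, A i j ^ 2 := by
  simp only [Matrix.trace, Matrix.diag, Matrix.mul_apply, Matrix.transpose_apply]
  exact Finset.sum_congr rfl fun i _ => Finset.sum_congr rfl fun j _ => by ring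

theorem sum_sq_mul_le (A : Matrix (Fin p) (Fin m) ℝ) (B : Matrix (Fin m) (Fin k) ℝ) :
    ∑ i, ∑ j, (A * B) i j ^ 2 ≤ (∑ i, ∑ j, A i j ^ 2) * ∑ i, ∑ j, B i j ^ 2 := by
  rw [Finset.sum_mul]
  refine Finset.sum_le_sum fun i _ => ?_
  rw [Finset.sum_comm (f := fun a b => B a b ^ 2), Finset.mul_sum]
  refine Finset.sum_le_sum fun j _ => ?_
  rw [Matrix.mul_apply]
  exact Finset.sum_mul_sq_le_sq_mul_sq _ _ _

theorem mul_sq_mul_transpose {Λ : Matrix (Fin k) (Fin k) ℝ} (hΛ : Λ.IsSymm)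
    (B : Matrix (Fin n) (Fin k) ℝ) : B * Λ ^ 2 * B.transpose = (B * Λ) * (B * Λ).transpose := by
  rw [Matrix.transpose_mul, hΛ.eq, sq]
  simp only [Matrix.mul_assoc]

theorem posSemidef_mul_sq_mul_transpose {Λ : Matrix (Fin k) (Fin k) ℝ} (hΛ : Λ.IsSymm)
    (B : Matrix (Fin n) (Fin k) ℝ) : (B * Λ ^ 2 * B.transpose).PosSemidef := by
  rw [mul_sq_mul_transpose hΛ]
  have := Matrix.posSemidef_self_mul_conjTranspose (B * Λ)
  rwa [Matrix.conjTranspose_eq_transpose_of_trivial] at this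

theorem PosSemidef.isSymm {A : Matrix (Fin n) (Fin n) ℝ} (hA : A.PosSemidef) : A.IsSymm :=
  (posSemidef_iff_isSymm.1 hA).1

/-! ### The cost density -/

variable {Λ₁ : Matrix (Fin k) (Fin k) ℝ} {Λ₂ : Matrix (Fin n) (Fin n) ℝ}

theorem zero_mem_admissible : (0, 0, 0) ∈ admissible Λ₁ Λ₂ := by
  simp [admissible, Matrix.PosSemidef.zero, Matrix.IsSymm]

theorem le_costDensity {X : Matrix (Fin n) (Fin n) ℝ} {Y : Matrix (Fin n) (Fin k) ℝ}
    {Z : Matrix (Fin n) (Fin n) ℝ}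
    {P : Matrix (Fin n) (Fin n) ℝ × Matrix (Fin n) (Fin k) ℝ × Matrix (Fin n) (Fin n) ℝ}
    (hP : P ∈ admissible Λ₁ Λ₂) :
    ENNReal.ofReal (frob X P.1 + frob Y P.2.1 + frob Z P.2.2) ≤ costDensity Λ₁ Λ₂ X Y Z :=
  le_iSup₂ (f := fun P (_ : P ∈ admissible Λ₁ Λ₂) =>
    ENNReal.ofReal (frob X P.1 + frob Y P.2.1 + frob Z P.2.2)) P hP

theorem costDensity_add_le (X X' : Matrix (Fin n) (Fin n) ℝ) (Y Y' : Matrix (Fin n) (Fin k) ℝ)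
    (Z Z' : Matrix (Fin n) (Fin n) ℝ) :
    costDensity Λ₁ Λ₂ (X + X') (Y + Y') (Z + Z') ≤
      costDensity Λ₁ Λ₂ X Y Z + costDensity Λ₁ Λ₂ X' Y' Z' := by
  refine iSup₂_le fun P hP => ?_
  rw [frob_add_left, frob_add_left, frob_add_left]
  calc _ = ENNReal.ofReal ((frob X P.1 + frob Y P.2.1 + frob Z P.2.2) +
        (frob X' P.1 + frob Y' P.2.1 + frob Z' P.2.2)) := by congr 1; ring
    _ ≤ _ := ENNReal.ofReal_add_le
    _ ≤ _ := add_le_add (le_costDensity hP) (le_costDensity hP)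

/-- Both quadratic terms of the constraint are positive semidefinite, so dropping one or both of
them preserves the inequality. -/
theorem neg_fst_posSemidef (h₁ : Λ₁.IsSymm) (h₂ : Λ₂.IsSymm)
    {P : Matrix (Fin n) (Fin n) ℝ × Matrix (Fin n) (Fin k) ℝ × Matrix (Fin n) (Fin n) ℝ}
    (hP : P ∈ admissible Λ₁ Λ₂) :
    (-(P.1 + (1 / 2 : ℝ) • (P.2.2 * Λ₂ ^ 2 * P.2.2.transpose))).PosSemidef ∧
      (-P.1).PosSemidef := by
  have hB := (posSemidef_mul_sq_mul_transpose h₁ P.2.1).smul (a := (1 / 2 : ℝ)) (by norm_num)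
  have hC := (posSemidef_mul_sq_mul_transpose h₂ P.2.2).smul (a := (1 / 2 : ℝ)) (by norm_num)
  have h := hP.2.add hB
  have e : -(P.1 + (1 / 2 : ℝ) • (P.2.1 * Λ₁ ^ 2 * P.2.1.transpose)
      + (1 / 2 : ℝ) • (P.2.2 * Λ₂ ^ 2 * P.2.2.transpose)) +
      (1 / 2 : ℝ) • (P.2.1 * Λ₁ ^ 2 * P.2.1.transpose) =
      -(P.1 + (1 / 2 : ℝ) • (P.2.2 * Λ₂ ^ 2 * P.2.2.transpose)) := by abel
  rw [e] at h
  refine ⟨h, ?_⟩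
  have h' := h.add hC
  have e' : -(P.1 + (1 / 2 : ℝ) • (P.2.2 * Λ₂ ^ 2 * P.2.2.transpose)) +
      (1 / 2 : ℝ) • (P.2.2 * Λ₂ ^ 2 * P.2.2.transpose) = -P.1 := by abel
  rwa [e'] at h'

theorem costDensity_posSemidef (h₁ : Λ₁.IsSymm) (h₂ : Λ₂.IsSymm) {X : Matrix (Fin n) (Fin n) ℝ}
    (hX : X.PosSemidef) : costDensity Λ₁ Λ₂ X 0 0 = 0 := by
  refine le_antisymm (iSup₂_le fun P hP => ?_) zero_le
  have h := frob_nonneg_of_posSemidef hX (neg_fst_posSemidef h₁ h₂ hP).2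
  rw [frob_neg_right] at h
  rw [frob_zero_left, frob_zero_left, ENNReal.ofReal_of_nonpos (by linarith)]

/-- Subadditivity, combined with the fact that a positive semidefinite matrix alone has cost zero.
This is what makes the endpoint and elliptic terms added to G free of cost. -/
theorem costDensity_mono (h₁ : Λ₁.IsSymm) (h₂ : Λ₂.IsSymm) {X X' : Matrix (Fin n) (Fin n) ℝ}
    (hX : (X' - X).PosSemidef) (Y : Matrix (Fin n) (Fin k) ℝ) (Z : Matrix (Fin n) (Fin n) ℝ) :
    costDensity Λ₁ Λ₂ X' Y Z ≤ costDensity Λ₁ Λ₂ X Y Z := by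
  have h := costDensity_add_le (Λ₁ := Λ₁) (Λ₂ := Λ₂) X (X' - X) Y 0 Z 0
  rw [costDensity_posSemidef h₁ h₂ hX] at h
  simpa using h

theorem costDensity_smul {c : ℝ} (hc : 0 ≤ c) (X : Matrix (Fin n) (Fin n) ℝ)
    (Y : Matrix (Fin n) (Fin k) ℝ) (Z : Matrix (Fin n) (Fin n) ℝ) :
    costDensity Λ₁ Λ₂ (c • X) (c • Y) (c • Z) = ENNReal.ofReal c * costDensity Λ₁ Λ₂ X Y Z := by
  simp only [costDensity, ENNReal.mul_iSup, frob_smul_left, ← ENNReal.ofReal_mul hc, mul_add]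

/-- The admissible set is stable under (A, B, C) ↦ (c² A, c² B, c C) for c ≤ 1, and testing (X, Y,
Z) with the image gives c times the value of (c X, c Y, Z) at (A, B, C). -/
theorem costDensity_scale_le (h₁ : Λ₁.IsSymm) {c : ℝ} (hc : 0 < c) (hc1 : c ≤ 1)
    (X : Matrix (Fin n) (Fin n) ℝ) (Y : Matrix (Fin n) (Fin k) ℝ) (Z : Matrix (Fin n) (Fin n) ℝ) :
    costDensity Λ₁ Λ₂ (c • X) (c • Y) Z ≤ ENNReal.ofReal c⁻¹ * costDensity Λ₁ Λ₂ X Y Z := by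
  refine iSup₂_le fun P hP => ?_
  -- The slack in the constraint: the B-term scales like c⁴, whereas c² would be allowed.
  have hB := (posSemidef_mul_sq_mul_transpose h₁ P.2.1).smul
    (a := (1 / 2 : ℝ) * (c ^ 2 * (1 - c ^ 2)))
    (mul_nonneg (by norm_num) (mul_nonneg (by positivity) (by nlinarith)))
  have hQ : (c ^ 2 • P.1, c ^ 2 • P.2.1, c • P.2.2) ∈ admissible Λ₁ Λ₂ := by
    refine ⟨hP.1.smul _, ?_⟩
    have h := (hP.2.smul (a := c ^ 2) (by positivity)).add hB
    convert h using 1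
    ext i j
    simp only [Matrix.transpose_smul, Matrix.smul_mul, Matrix.mul_smul, Matrix.neg_apply,
      Matrix.add_apply, Matrix.smul_apply, smul_eq_mul]
    ring
  have h := le_costDensity (X := X) (Y := Y) (Z := Z) hQ
  calc _ = ENNReal.ofReal c⁻¹ * ENNReal.ofReal
        (frob X (c ^ 2 • P.1) + frob Y (c ^ 2 • P.2.1) + frob Z (c • P.2.2)) := by
        rw [← ENNReal.ofReal_mul (by positivity)]
        simp only [frob_smul_left, frob_smul_right]
        congr 1
        field_simp
    _ ≤ _ := by gcongr

/-- Serves to test a finite cost along unbounded families of admissible triplets. -/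
theorem nonneg_of_forall_mul_le {a b : ℝ} (h : ∀ s : ℝ, 0 ≤ s → s * a ≤ b) : a ≤ 0 := by
  by_contra! ha
  have h0 := h 0 le_rfl
  have := h ((b + 1) / a) (by rw [zero_mul] at h0; positivity)
  rw [div_mul_cancel₀ _ ha.ne'] at this
  linarith

theorem le_toReal_costDensity {X : Matrix (Fin n) (Fin n) ℝ} {Y : Matrix (Fin n) (Fin k) ℝ}
    {Z : Matrix (Fin n) (Fin n) ℝ} (hJ : costDensity Λ₁ Λ₂ X Y Z < ⊤)
    {P : Matrix (Fin n) (Fin n) ℝ × Matrix (Fin n) (Fin k) ℝ × Matrix (Fin n) (Fin n) ℝ}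
    (hP : P ∈ admissible Λ₁ Λ₂) :
    frob X P.1 + frob Y P.2.1 + frob Z P.2.2 ≤ (costDensity Λ₁ Λ₂ X Y Z).toReal :=
  (ENNReal.ofReal_le_iff_le_toReal hJ.ne).1 (le_costDensity hP)

/-- The triplets (-s v vᵀ, 0, 0) with s ≥ 0 form a ray in the admissible set; a finite supremum
cannot increase along it. -/
theorem posSemidef_of_costDensity_lt_top {X : Matrix (Fin n) (Fin n) ℝ}
    {Y : Matrix (Fin n) (Fin k) ℝ} {Z : Matrix (Fin n) (Fin n) ℝ} (hX : X.IsSymm)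
    (hJ : costDensity Λ₁ Λ₂ X Y Z < ⊤) : X.PosSemidef := by
  refine posSemidef_iff_isSymm.2 ⟨hX, fun v => ?_⟩
  suffices -(v ⬝ᵥ X *ᵥ v) ≤ 0 by linarith
  refine nonneg_of_forall_mul_le (b := (costDensity Λ₁ Λ₂ X Y Z).toReal) fun s hs => ?_
  have hv : (Matrix.vecMulVec v v).PosSemidef := by
    simpa using Matrix.posSemidef_vecMulVec_self_star v
  have hP : (-(s • Matrix.vecMulVec v v), 0, 0) ∈ admissible Λ₁ Λ₂ := by
    refine ⟨?_, ?_⟩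
    · exact ((PosSemidef.isSymm hv).smul s).neg
    · simpa using hv.smul hs
  have h := le_toReal_costDensity hJ hP
  simp only [frob_zero_right, add_zero, frob_neg_right, frob_smul_right] at h
  have e : frob X (Matrix.vecMulVec v v) = v ⬝ᵥ X *ᵥ v := by
    rw [dotProduct_mulVec_self_eq_sum, frob_eq_sum]
    simp [Matrix.vecMulVec_apply]
  rw [e] at h
  linarith

/-- Control of the flux by the cost. -/
theorem sum_sq_le_costDensity (h₁ : Λ₁.IsSymm) {L : ℝ} (hL : 0 < L)
    (hL' : ∑ i, ∑ j, Λ₁ i j ^ 2 ≤ L) {X : Matrix (Fin n) (Fin n) ℝ}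
    {Y : Matrix (Fin n) (Fin k) ℝ} {Z : Matrix (Fin n) (Fin n) ℝ} (hX : X.IsSymm)
    (hJ : costDensity Λ₁ Λ₂ X Y Z < ⊤) :
    ∑ i, ∑ j, Y i j ^ 2 ≤ 2 * L * X.trace * (costDensity Λ₁ Λ₂ X Y Z).toReal := by
  set y := ∑ i, ∑ j, Y i j ^ 2 with hy
  set J := (costDensity Λ₁ Λ₂ X Y Z).toReal with hJdef
  have hy0 : 0 ≤ y := by positivity
  have hXp := posSemidef_of_costDensity_lt_top hX hJ
  have hT := hXp.trace_nonneg
  have key : ∀ s : ℝ, 0 ≤ s → s * y - s ^ 2 / 2 * L * y * X.trace ≤ J := by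
    intro s _
    -- The test in the direction of Y itself. The multiple of the identity dominates ½ s² Y Λ₁² Yᵀ
    -- because the squared Frobenius norm of Y Λ₁ is at most L y.
    have hP : (-((s ^ 2 / 2 * L * y) • (1 : Matrix (Fin n) (Fin n) ℝ)), s • Y, 0) ∈
        admissible Λ₁ Λ₂ := by
      refine ⟨(Matrix.isSymm_one.smul _).neg, ?_⟩
      have e : -(-((s ^ 2 / 2 * L * y) • (1 : Matrix (Fin n) (Fin n) ℝ)) +
          (1 / 2 : ℝ) • (s • Y * Λ₁ ^ 2 * (s • Y).transpose) +
          (1 / 2 : ℝ) • ((0 : Matrix (Fin n) (Fin n) ℝ) * Λ₂ ^ 2 *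
            (0 : Matrix (Fin n) (Fin n) ℝ).transpose)) =
          (s ^ 2 / 2) • ((L * y) • (1 : Matrix (Fin n) (Fin n) ℝ) -
            (Y * Λ₁) * (Y * Λ₁).transpose) := by
        rw [← mul_sq_mul_transpose h₁]
        ext i j
        simp only [Matrix.transpose_smul, Matrix.smul_mul, Matrix.mul_smul, Matrix.neg_apply,
          Matrix.add_apply, Matrix.smul_apply, smul_eq_mul, Matrix.zero_mul, Matrix.zero_apply,
          Matrix.sub_apply]
        ring
      rw [e]
      refine Matrix.PosSemidef.smul ?_ (by positivity)
      refine posSemidef_iff_isSymm.2 ⟨?_, fun v => ?_⟩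
      · exact (Matrix.isSymm_one.smul _).sub (by rw [Matrix.IsSymm, Matrix.transpose_mul, Matrix.transpose_transpose])
      · rw [Matrix.sub_mulVec, dotProduct_sub, Matrix.smul_mulVec, Matrix.one_mulVec,
          dotProduct_smul, ← Matrix.mulVec_mulVec, Matrix.dotProduct_mulVec,
          ← Matrix.mulVec_transpose, smul_eq_mul]
        set M := (Y * Λ₁).transpose
        have hM : ∑ i, ∑ j, M i j ^ 2 ≤ L * y := by
          have := sum_sq_mul_le Y Λ₁
          rw [Finset.sum_comm]
          simp only [M, Matrix.transpose_apply]
          nlinarith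
        have h1 : (M *ᵥ v) ⬝ᵥ (M *ᵥ v) ≤ (∑ i, ∑ j, M i j ^ 2) * (v ⬝ᵥ v) := by
          simp only [dotProduct, Matrix.mulVec]
          rw [Finset.sum_mul]
          refine Finset.sum_le_sum fun i _ => ?_
          have := Finset.sum_mul_sq_le_sq_mul_sq Finset.univ (fun j => M i j) v
          simpa [sq] using this
        have h2 : 0 ≤ v ⬝ᵥ v := by
          simp only [dotProduct]; exact Finset.sum_nonneg fun i _ => mul_self_nonneg _
        have h3 : (∑ i, ∑ j, M i j ^ 2) * (v ⬝ᵥ v) ≤ L * y * (v ⬝ᵥ v) := by gcongr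
        linarith
    have h := le_toReal_costDensity hJ hP
    have e1 : frob X 1 = X.trace := by simp [frob]
    have e2 : frob Y Y = y := by rw [frob_eq_sum]; simp [hy, sq]
    simp only [frob_zero_right, add_zero, frob_neg_right, frob_smul_right, e1, e2] at h
    linarith
  rcases hT.eq_or_lt with h0 | h0
  -- For vanishing trace the quadratic term is absent and s y stays bounded for all s ≥ 0.
  · have : y ≤ 0 := nonneg_of_forall_mul_le (b := J) fun s hs => by
      have := key s hs
      rw [← h0] at this
      linarith
    rw [← h0]; linarith
  -- The maximizer of s ↦ s y - s² L y (tr X) / 2.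
  · have := key (1 / (L * X.trace)) (by positivity)
    have e : 1 / (L * X.trace) * y - (1 / (L * X.trace)) ^ 2 / 2 * L * y * X.trace =
        y / (2 * L * X.trace) := by
      field_simp
      ring
    rw [e, div_le_iff₀ (by positivity)] at this
    linarith

/-- Quantitative bound of the reaction cost on the elliptic part. -/
theorem exists_costDensity_le (h₁ : Λ₁.IsSymm) (h₂ : Λ₂.PosDef) :
    ∃ C : ℝ, 0 ≤ C ∧ ∀ (X Z : Matrix (Fin n) (Fin n) ℝ) (a b : ℝ), 0 ≤ a → 0 ≤ b →
      (X - a • (1 : Matrix (Fin n) (Fin n) ℝ)).PosSemidef → (∀ i j, Z i j ^ 2 ≤ a * b) →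
      costDensity Λ₁ Λ₂ X 0 Z ≤ ENNReal.ofReal (C * b) := by
  have h₂s : Λ₂.IsSymm := PosSemidef.isSymm h₂.posSemidef
  -- The summand 1 only guarantees L > 0.
  set L := 1 + ∑ i, ∑ j, (Λ₂⁻¹) i j ^ 2 with hLdef
  have hL : 0 < L := by positivity
  refine ⟨n * n * (L / 2), by positivity, fun X Z a b ha hb hX hZ => iSup₂_le fun P hP => ?_⟩
  refine ENNReal.ofReal_le_ofReal ?_
  rw [frob_zero_left, add_zero]
  obtain ⟨hAC, hA⟩ := neg_fst_posSemidef h₁ h₂s hP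
  have e1 : frob X P.1 ≤ a * P.1.trace := by
    have h := frob_nonneg_of_posSemidef hX hA
    rw [frob_neg_right, sub_eq_add_neg, ← neg_smul, frob_add_left, frob_smul_left,
      frob_one_left] at h
    linarith
  have e2 : P.1.trace ≤ -(1 / 2 * ∑ i, ∑ j, (P.2.2 * Λ₂) i j ^ 2) := by
    have h := hAC.trace_nonneg
    rw [mul_sq_mul_transpose h₂s, Matrix.trace_neg, Matrix.trace_add, Matrix.trace_smul,
      trace_mul_transpose_self, smul_eq_mul] at h
    linarith
  have e3 : ∑ i, ∑ j, P.2.2 i j ^ 2 ≤ (∑ i, ∑ j, (P.2.2 * Λ₂) i j ^ 2) * L := by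
    have h := sum_sq_mul_le (P.2.2 * Λ₂) Λ₂⁻¹
    rw [Matrix.mul_assoc, Matrix.mul_nonsing_inv _ ((Matrix.isUnit_iff_isUnit_det _).1 h₂.isUnit),
      Matrix.mul_one] at h
    refine h.trans ?_
    gcongr
    linarith
  -- Young's inequality, proved by comparing squares so that a = 0 is allowed. The weight a / (2 L)
  -- is the largest one that the negative term coming from X · A can absorb, see `e5` and `e6`.
  have e4 : frob Z P.2.2 ≤ n * n * (L / 2) * b + a / (2 * L) * ∑ i, ∑ j, P.2.2 i j ^ 2 := by
    have : ∀ i j, Z i j * P.2.2 i j ≤ L / 2 * b + a / (2 * L) * P.2.2 i j ^ 2 := by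
      intro i j
      refine le_of_abs_le (abs_le_of_sq_le_sq ?_ (by positivity))
      have h := mul_le_mul_of_nonneg_right (hZ i j) (sq_nonneg (P.2.2 i j))
      have e : (L / 2 * b + a / (2 * L) * P.2.2 i j ^ 2) ^ 2 =
          (L / 2 * b - a / (2 * L) * P.2.2 i j ^ 2) ^ 2 + a * b * P.2.2 i j ^ 2 := by
        field_simp
        ring
      rw [mul_pow, e]
      nlinarith [sq_nonneg (L / 2 * b - a / (2 * L) * P.2.2 i j ^ 2)]
    rw [frob_eq_sum]
    calc _ ≤ ∑ i, ∑ j, (L / 2 * b + a / (2 * L) * P.2.2 i j ^ 2) :=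
          Finset.sum_le_sum fun i _ => Finset.sum_le_sum fun j _ => this i j
      _ = _ := by
          simp only [Finset.sum_add_distrib, Finset.sum_const, Finset.card_univ,
            Fintype.card_fin, nsmul_eq_mul, ← Finset.mul_sum]
          ring
  have e5 : a / (2 * L) * ∑ i, ∑ j, P.2.2 i j ^ 2 ≤
      a / 2 * ∑ i, ∑ j, (P.2.2 * Λ₂) i j ^ 2 := by
    calc _ ≤ a / (2 * L) * ((∑ i, ∑ j, (P.2.2 * Λ₂) i j ^ 2) * L) := by gcongr
      _ = _ := by field_simp
  have e6 : a * P.1.trace ≤ -(a / 2 * ∑ i, ∑ j, (P.2.2 * Λ₂) i j ^ 2) := by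
    have := mul_le_mul_of_nonneg_left e2 ha
    linarith
  linarith

/-- The cost of a contracted triplet whose reaction part is perturbed by a linear image of the
flux, when a multiple of the trace is added to the first component. -/
theorem exists_costDensity_perturbation_le (h₁ : Λ₁.IsSymm) (h₂ : Λ₂.PosDef)
    (T : Matrix (Fin n) (Fin k) ℝ → Matrix (Fin n) (Fin n) ℝ)
    (hT : ∃ K : ℝ, 0 ≤ K ∧ ∀ Y i j, T Y i j ^ 2 ≤ K * ∑ i, ∑ j, Y i j ^ 2) :
    ∃ C : ℝ, 0 ≤ C ∧ ∀ (X : Matrix (Fin n) (Fin n) ℝ) (Y : Matrix (Fin n) (Fin k) ℝ)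
      (Z : Matrix (Fin n) (Fin n) ℝ) (c κ e : ℝ), X.IsSymm → costDensity Λ₁ Λ₂ X Y Z < ⊤ →
      0 < c → c ≤ 1 → 0 < κ →
      costDensity Λ₁ Λ₂ (c • X + (κ * X.trace) • (1 : Matrix (Fin n) (Fin n) ℝ)) (c • Y)
        (Z + e • T Y) ≤ ENNReal.ofReal (c⁻¹ + C * (e ^ 2 / κ)) * costDensity Λ₁ Λ₂ X Y Z := by
  obtain ⟨C, hC, hCle⟩ := exists_costDensity_le (k := k) h₁ h₂
  obtain ⟨K, hK, hTK⟩ := hT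
  set L := 1 + ∑ i, ∑ j, Λ₁ i j ^ 2 with hLdef
  have hL : 0 < L := by positivity
  refine ⟨C * (K * (2 * L)), by positivity, fun X Y Z c κ e hX hJ hc hc1 hκ => ?_⟩
  have hXp := posSemidef_of_costDensity_lt_top hX hJ
  have htr := hXp.trace_nonneg
  have hY := sum_sq_le_costDensity h₁ hL (by linarith) hX hJ
  set J := (costDensity Λ₁ Λ₂ X Y Z).toReal with hJd
  have hJ0 : 0 ≤ J := ENNReal.toReal_nonneg
  -- Here a = κ tr X, and b is chosen so that a b is the bound for e² |T Y|² given by the control of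
  -- Y by the cost.
  have hstep := hCle ((κ * X.trace) • (1 : Matrix (Fin n) (Fin n) ℝ)) (e • T Y) (κ * X.trace)
    (K * (2 * L) * (e ^ 2 / κ) * J) (by positivity) (by positivity)
    (by rw [sub_self]; exact Matrix.PosSemidef.zero) (fun i j => by
      have h := hTK Y i j
      rw [Matrix.smul_apply, smul_eq_mul, mul_pow]
      calc e ^ 2 * T Y i j ^ 2 ≤ e ^ 2 * (K * (2 * L * X.trace * J)) := by
            gcongr
            exact h.trans (by gcongr)
        _ = _ := by field_simp)
  have hadd := costDensity_add_le (Λ₁ := Λ₁) (Λ₂ := Λ₂) (c • X)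
    ((κ * X.trace) • (1 : Matrix (Fin n) (Fin n) ℝ)) (c • Y) 0 Z (e • T Y)
  rw [add_zero] at hadd
  refine hadd.trans ?_
  rw [ENNReal.ofReal_add (by positivity) (by positivity), add_mul]
  refine add_le_add (costDensity_scale_le h₁ hc hc1 X Y Z) (hstep.trans ?_)
  rw [← ENNReal.ofReal_toReal hJ.ne, ← ENNReal.ofReal_mul (by positivity)]
  refine ENNReal.ofReal_le_ofReal (le_of_eq ?_)
  rw [← hJd]
  ring

/-- The cost density is the supremum of a sequence of affine functions. -/
theorem exists_seq_costDensity_eq_iSup (Λ₁ : Matrix (Fin k) (Fin k) ℝ)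
    (Λ₂ : Matrix (Fin n) (Fin n) ℝ) :
    ∃ P : ℕ → Matrix (Fin n) (Fin n) ℝ × Matrix (Fin n) (Fin k) ℝ × Matrix (Fin n) (Fin n) ℝ,
      (∀ i, P i ∈ admissible Λ₁ Λ₂) ∧ P 0 = (0, 0, 0) ∧ ∀ X Y Z, costDensity Λ₁ Λ₂ X Y Z =
        ⨆ i, ENNReal.ofReal (frob X (P i).1 + frob Y (P i).2.1 + frob Z (P i).2.2) := by
  have : SecondCountableTopology (Matrix (Fin n) (Fin n) ℝ) :=
    inferInstanceAs (SecondCountableTopology (Fin n → Fin n → ℝ))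
  have : SecondCountableTopology (Matrix (Fin n) (Fin k) ℝ) :=
    inferInstanceAs (SecondCountableTopology (Fin n → Fin k → ℝ))
  have : Nonempty (admissible Λ₁ Λ₂) := ⟨⟨_, zero_mem_admissible⟩⟩
  let Q := TopologicalSpace.denseSeq (admissible Λ₁ Λ₂)
  -- Index 0 is reserved for the zero triplet, so that the partial suprema are nonnegative; the
  -- other indices run through a dense sequence.
  refine ⟨fun i => Nat.casesOn i (0, 0, 0) fun i => (Q i : _), ?_, rfl, fun X Y Z => ?_⟩
  · rintro (_ | i)
    · exact zero_mem_admissible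
    · exact (Q i).2
  · refine le_antisymm (iSup₂_le fun P hP => ?_) (iSup_le ?_)
    · have hd := TopologicalSpace.denseRange_denseSeq (admissible Λ₁ Λ₂)
      have hc : Continuous fun P : admissible Λ₁ Λ₂ =>
          ENNReal.ofReal (frob X P.1.1 + frob Y P.1.2.1 + frob Z P.1.2.2) := by
        refine ENNReal.continuous_ofReal.comp ?_
        unfold frob
        fun_prop
      refine hd.induction_on (p := fun P : admissible Λ₁ Λ₂ =>
        ENNReal.ofReal (frob X P.1.1 + frob Y P.1.2.1 + frob Z P.1.2.2) ≤ _)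
        (⟨P, hP⟩ : admissible Λ₁ Λ₂) (isClosed_le hc continuous_const) ?_
      intro i
      exact le_iSup_of_le (i + 1) le_rfl
    · rintro (_ | i)
      · exact le_costDensity (P := (0, 0, 0)) zero_mem_admissible
      · exact le_costDensity (Q i).2

end Cost

/-! ### Matrix-valued measures, their densities and the action -/

section MeasureTools

variable {X : Type*} [MeasurableSpace X] {n p m k : ℕ}

/-- The positive and negative parts of `u` define finite measures, against both of which the bounded
function `Φ` is integrable; the two integrals are then subtracted. -/
theorem integral_withDensityᵥ {ν : Measure X} {u Φ : X → ℝ} {M : ℝ} (hu : Integrable u ν)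
    (hΦ : AEStronglyMeasurable Φ ν) (hM : ∀ᵐ x ∂ν, ‖Φ x‖ ≤ M) :
    ∫ᵛ x, Φ x ∂<•(ν.withDensityᵥ u) = ∫ x, Φ x * u x ∂ν := by
  have hfin : ∀ v : X → ℝ, Integrable v ν →
      IsFiniteMeasure (ν.withDensity fun x => ENNReal.ofReal (v x)) := fun v hv =>
    isFiniteMeasure_withDensity_ofReal hv.2
  have hI : ∀ v : X → ℝ, Integrable v ν →
      Integrable Φ (ν.withDensity fun x => ENNReal.ofReal (v x)) := fun v hv => by
    have := hfin v hv
    exact Integrable.of_bound (hΦ.mono_ac (withDensity_absolutelyContinuous _ _)) M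
      ((withDensity_absolutelyContinuous _ _).ae_le hM)
  have hE : ∀ v : X → ℝ, Integrable v ν →
      ∫ x, Φ x ∂(ν.withDensity fun x => ENNReal.ofReal (v x)) =
        ∫ x, (ENNReal.ofReal (v x)).toReal * Φ x ∂ν := fun v hv => by
    rw [integral_withDensity_eq_integral_toReal_smul₀ hv.aemeasurable.ennreal_ofReal
      (ae_of_all _ fun _ => ENNReal.ofReal_lt_top)]
    rfl
  have := hfin u hu
  have := hfin (fun x => -u x) hu.neg
  have h1 := hI u hu
  have h2 := hI (fun x => -u x) hu.neg
  have hP : ∀ v : X → ℝ, Integrable v ν →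
      Integrable (fun x => (ENNReal.ofReal (v x)).toReal * Φ x) ν := fun v hv => by
    refine Integrable.mul_bdd (c := M) ?_ hΦ hM
    exact hv.real_toNNReal.congr (ae_of_all _ fun x => by simp [ENNReal.toReal_ofReal'])
  rw [withDensityᵥ_eq_withDensity_pos_part_sub_withDensity_neg_part hu,
    VectorMeasure.integral_sub_vectorMeasure
      (by rwa [VectorMeasure.Integrable, Measure.variation_toSignedMeasure])
      (by rwa [VectorMeasure.Integrable, Measure.variation_toSignedMeasure]),
    VectorMeasure.integral_toSignedMeasure, VectorMeasure.integral_toSignedMeasure, hE u hu,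
    hE (fun x => -u x) hu.neg, ← integral_sub (hP u hu) (hP (fun x => -u x) hu.neg)]
  refine integral_congr_ae (ae_of_all _ fun x => ?_)
  simp only [ENNReal.toReal_ofReal']
  rw [← sub_mul, mul_comm]
  congr 1
  rcases le_total (u x) 0 with h | h
  · rw [max_eq_right h, max_eq_left (by linarith)]; ring
  · rw [max_eq_left h, max_eq_right (by linarith)]; ring

theorem MatrixMeasure.IsOn.totalVariation_compl {μ : MatrixMeasure X p m} {K : Set X}
    (h : μ.IsOn K) (hK : MeasurableSet K) (i : Fin p) (j : Fin m) :
    (μ i j).totalVariation Kᶜ = 0 := by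
  rw [SignedMeasure.totalVariation_eq_variation,
    VectorMeasure.variation_apply_eq_zero hK.compl]
  intro t ht htm
  have := h t ‹_› (Set.disjoint_left.2 fun x hx hxK => ‹t ⊆ Kᶜ› hx hxK)
  simpa [MatrixMeasure.value] using congrFun (congrFun this i) j

instance (μ : MatrixMeasure X p m) : IsFiniteMeasure μ.refMeasure := by
  refine ⟨?_⟩
  simp only [MatrixMeasure.refMeasure, Measure.coe_finsetSum, Finset.sum_apply]
  exact ENNReal.sum_lt_top.2 fun i _ => ENNReal.sum_lt_top.2 fun j _ => measure_lt_top _ _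

instance (μ : Triplet X n k) : IsFiniteMeasure μ.refMeasure := by
  unfold Triplet.refMeasure; infer_instance

theorem MatrixMeasure.absCont_refMeasure (μ : MatrixMeasure X p m) : μ.AbsCont μ.refMeasure := by
  intro i j s hs
  simp only [MatrixMeasure.refMeasure, Measure.coe_finsetSum, Finset.sum_apply,
    Finset.sum_eq_zero_iff, Finset.mem_univ, true_imp_iff] at hs
  exact hs i j

theorem MatrixMeasure.refMeasure_absolutelyContinuous {μ : MatrixMeasure X p m} {ν : Measure X}
    (h : μ.AbsCont ν) : μ.refMeasure ≪ ν := by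
  intro s hs
  simp only [MatrixMeasure.refMeasure, Measure.coe_finsetSum, Finset.sum_apply,
    Finset.sum_eq_zero_iff, Finset.mem_univ, true_imp_iff]
  exact fun i j => h i j hs

theorem MatrixMeasure.AbsCont.hasDensity {μ : MatrixMeasure X p m} {ν : Measure X} [SigmaFinite ν]
    (h : μ.AbsCont ν) : μ.HasDensity ν (μ.density ν) := by
  intro i j
  refine ⟨SignedMeasure.integrable_rnDeriv _ _, ?_⟩
  refine (SignedMeasure.withDensityᵥ_rnDeriv_eq (μ i j) ν ?_).symm
  rw [SignedMeasure.absolutelyContinuous_ennreal_iff,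
    VectorMeasure.ennrealToMeasure_toENNRealVectorMeasure]
  exact h i j

theorem MatrixMeasure.HasDensity.absCont {μ : MatrixMeasure X p m} {ν : Measure X}
    {g : X → Matrix (Fin p) (Fin m) ℝ} (h : μ.HasDensity ν g) : μ.AbsCont ν := by
  intro i j
  rw [(h i j).2]
  have := Measure.withDensityᵥ_absolutelyContinuous ν fun x => g x i j
  rwa [SignedMeasure.absolutelyContinuous_ennreal_iff,
    VectorMeasure.ennrealToMeasure_toENNRealVectorMeasure] at this

theorem MatrixMeasure.refMeasure_compl {μ : MatrixMeasure X p m} {K : Set X}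
    (h : μ.IsOn K) (hK : MeasurableSet K) : μ.refMeasure Kᶜ = 0 := by
  simp only [MatrixMeasure.refMeasure, Measure.coe_finsetSum, Finset.sum_apply]
  exact Finset.sum_eq_zero fun i _ => Finset.sum_eq_zero fun j _ => h.totalVariation_compl hK i j

/-- The pairing of a measure with a density. -/
theorem MatrixMeasure.HasDensity.pairing_eq {μ : MatrixMeasure X p m} {ν : Measure X}
    {g Φ : X → Matrix (Fin p) (Fin m) ℝ} (h : μ.HasDensity ν g)
    (hΦ : ∀ i j, AEStronglyMeasurable (fun x => Φ x i j) ν)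
    (hM : ∀ i j, ∃ M, ∀ᵐ x ∂ν, ‖Φ x i j‖ ≤ M) :
    μ.pairing Φ = ∑ i, ∑ j, ∫ x, Φ x i j * g x i j ∂ν := by
  refine Finset.sum_congr rfl fun i _ => Finset.sum_congr rfl fun j _ => ?_
  obtain ⟨M, hM⟩ := hM i j
  rw [(h i j).2, integral_withDensityᵥ (h i j).1 (hΦ i j) hM]

theorem MatrixMeasure.HasDensity.isOn {μ : MatrixMeasure X p m} {ν : Measure X} {K : Set X}
    {g : X → Matrix (Fin p) (Fin m) ℝ} (h : μ.HasDensity (ν.restrict K) g) : μ.IsOn K := by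
  intro E hE hd
  ext i j
  simp only [MatrixMeasure.value, Matrix.of_apply, Matrix.zero_apply]
  rw [(h i j).2, withDensityᵥ_apply (h i j).1 hE, Measure.restrict_restrict hE,
    Set.disjoint_iff_inter_eq_empty.1 hd]
  simp

theorem MatrixMeasure.HasDensity.value_eq {μ : MatrixMeasure X p m} {ν : Measure X}
    {g : X → Matrix (Fin p) (Fin m) ℝ} (h : μ.HasDensity ν g) {E : Set X}
    (hE : MeasurableSet E) : μ.value E = Matrix.of fun i j => ∫ x in E, g x i j ∂ν := by
  ext i j
  simp only [MatrixMeasure.value, Matrix.of_apply]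
  rw [(h i j).2, withDensityᵥ_apply (h i j).1 hE]

theorem dotProduct_mulVec_integral {ν : Measure X} {g : X → Matrix (Fin n) (Fin n) ℝ}
    (hg : ∀ i j, Integrable (fun x => g x i j) ν) (v : Fin n → ℝ) :
    v ⬝ᵥ (Matrix.of fun i j => ∫ x, g x i j ∂ν) *ᵥ v = ∫ x, v ⬝ᵥ g x *ᵥ v ∂ν := by
  simp only [dotProduct_mulVec_self_eq_sum, Matrix.of_apply]
  rw [integral_finsetSum _ fun i _ => integrable_finsetSum _ fun j _ => (hg i j).mul_const _]
  refine Finset.sum_congr rfl fun i _ => ?_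
  rw [integral_finsetSum _ fun j _ => (hg i j).mul_const _]
  exact Finset.sum_congr rfl fun j _ => (integral_mul_const _ _).symm

theorem integrable_dotProduct_mulVec {ν : Measure X} {g : X → Matrix (Fin n) (Fin n) ℝ}
    (hg : ∀ i j, Integrable (fun x => g x i j) ν) (v : Fin n → ℝ) :
    Integrable (fun x => v ⬝ᵥ g x *ᵥ v) ν := by
  simp only [dotProduct_mulVec_self_eq_sum]
  exact integrable_finsetSum _ fun i _ => integrable_finsetSum _ fun j _ =>
    (hg i j).mul_const _

theorem MatrixMeasure.HasDensity.mem_psdMeasures {μ : MatrixMeasure X n n} {ν : Measure X}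
    {K : Set X} {g : X → Matrix (Fin n) (Fin n) ℝ} (h : μ.HasDensity (ν.restrict K) g)
    (hK : MeasurableSet K) (hsymm : ∀ x, (g x).IsSymm)
    (hg : ∀ x ∈ K, (g x).PosSemidef) : μ ∈ psdMeasures K n := by
  refine ⟨h.isOn, fun E hE => ?_⟩
  rw [h.value_eq hE]
  refine posSemidef_iff_isSymm.2 ⟨?_, fun v => ?_⟩
  · ext i j
    simp only [Matrix.transpose_apply, Matrix.of_apply]
    exact integral_congr_ae (ae_of_all _ fun x => (hsymm x).apply i j)
  · rw [dotProduct_mulVec_integral (fun i j => (h i j).1.restrict), Measure.restrict_restrict hE]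
    refine setIntegral_nonneg (hE.inter hK) fun x hx => ?_
    exact (posSemidef_iff_isSymm.1 (hg x hx.2)).2 v

/-- The density of a measure with positive semidefinite values is positive semidefinite. -/
theorem MatrixMeasure.HasDensity.ae_posSemidef {μ : MatrixMeasure X n n} {ν : Measure X}
    [SigmaFinite ν] {g : X → Matrix (Fin n) (Fin n) ℝ} (h : μ.HasDensity ν g)
    (hμ : ∀ E, MeasurableSet E → (μ.value E).PosSemidef) : ∀ᵐ x ∂ν, (g x).PosSemidef := by
  have h1 : ∀ v : Fin n → ℝ, ∀ᵐ x ∂ν, 0 ≤ v ⬝ᵥ g x *ᵥ v := by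
    intro v
    refine ae_nonneg_of_forall_setIntegral_nonneg
      (integrable_dotProduct_mulVec (fun i j => (h i j).1) v) fun E hE _ => ?_
    rw [← dotProduct_mulVec_integral (fun i j => (h i j).1.restrict), ← h.value_eq hE]
    exact (posSemidef_iff_isSymm.1 (hμ E hE)).2 v
  have h2 : ∀ i j, ∀ᵐ x ∂ν, g x i j = g x j i := by
    intro i j
    refine (h i j).1.ae_eq_of_withDensityᵥ_eq (h j i).1 ?_
    rw [← (h i j).2, ← (h j i).2]
    ext E hE
    have := (PosSemidef.isSymm (hμ E hE)).apply j i
    simpa [MatrixMeasure.value] using this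
  -- The null set in `h1` depends on the vector. A countable dense family gives a common null set,
  -- and continuity of the quadratic form covers the remaining vectors.
  have h1' : ∀ᵐ x ∂ν, ∀ l, 0 ≤ TopologicalSpace.denseSeq (Fin n → ℝ) l ⬝ᵥ
      g x *ᵥ TopologicalSpace.denseSeq (Fin n → ℝ) l := ae_all_iff.2 fun l => h1 _
  have h2' : ∀ᵐ x ∂ν, ∀ i j, g x i j = g x j i := ae_all_iff.2 fun i => ae_all_iff.2 (h2 i)
  filter_upwards [h1', h2'] with x hx1 hx2
  refine posSemidef_iff_isSymm.2 ⟨by ext i j; exact hx2 j i, fun v => ?_⟩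
  have hc : Continuous fun v : Fin n → ℝ => v ⬝ᵥ g x *ᵥ v := by fun_prop
  exact (TopologicalSpace.denseRange_denseSeq (Fin n → ℝ)).induction_on
    (p := fun v => 0 ≤ v ⬝ᵥ g x *ᵥ v) v (isClosed_le continuous_const hc) hx1

theorem Triplet.absCont_refMeasure (μ : Triplet X n k) :
    μ.G.AbsCont μ.refMeasure ∧ μ.q.AbsCont μ.refMeasure ∧ μ.R.AbsCont μ.refMeasure := by
  refine ⟨fun i j s hs => ?_, fun i j s hs => ?_, fun i j s hs => ?_⟩ <;>
  · simp only [Triplet.refMeasure, Measure.coe_add, Pi.add_apply, add_eq_zero] at hs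
    first
    | exact MatrixMeasure.absCont_refMeasure _ i j hs.1.1
    | exact MatrixMeasure.absCont_refMeasure _ i j hs.1.2
    | exact MatrixMeasure.absCont_refMeasure _ i j hs.2

/-- The action of a triplet with densities. -/
theorem action_eq_of_hasDensity (Λ₁ : Matrix (Fin k) (Fin k) ℝ) (Λ₂ : Matrix (Fin n) (Fin n) ℝ)
    {K : Set X} (hK : MeasurableSet K) {μ : Triplet X n k} {ν : Measure X} [SigmaFinite ν]
    {g r : X → Matrix (Fin n) (Fin n) ℝ} {q : X → Matrix (Fin n) (Fin k) ℝ}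
    (hG : μ.G.HasDensity ν g) (hq : μ.q.HasDensity ν q) (hR : μ.R.HasDensity ν r) :
    action Λ₁ Λ₂ K μ = ∫⁻ x in K, costDensity Λ₁ Λ₂ (g x) (q x) (r x) ∂ν := by
  have hac : μ.refMeasure ≪ ν := by
    intro s hs
    simp only [Triplet.refMeasure, Measure.coe_add, Pi.add_apply, add_eq_zero]
    exact ⟨⟨MatrixMeasure.refMeasure_absolutelyContinuous hG.absCont hs,
      MatrixMeasure.refMeasure_absolutelyContinuous hq.absCont hs⟩,
      MatrixMeasure.refMeasure_absolutelyContinuous hR.absCont hs⟩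
  set f := μ.refMeasure.rnDeriv ν with hf
  have hfm : Measurable f := Measure.measurable_rnDeriv _ _
  have hfν : ν.withDensity f = μ.refMeasure := Measure.withDensity_rnDeriv_eq _ _ hac
  have hftop : ∀ᵐ x ∂ν, f x < ⊤ := Measure.rnDeriv_lt_top _ _
  -- The chain rule for Radon-Nikodym densities, with f the density of the reference measure.
  -- Homogeneity of the cost then turns the weight f into a rescaling of its arguments.
  have key : ∀ {p m : ℕ} (τ : MatrixMeasure X p m) (a : X → Matrix (Fin p) (Fin m) ℝ),
      τ.HasDensity ν a → τ.AbsCont μ.refMeasure →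
      ∀ᵐ x ∂ν, a x = (f x).toReal • τ.density μ.refMeasure x := by
    intro p m τ a ha hτ
    have hd := hτ.hasDensity
    have : ∀ i j, ∀ᵐ x ∂ν, a x i j = (f x).toReal * τ.density μ.refMeasure x i j := by
      intro i j
      have h1 := (hd i j).1
      rw [← hfν, integrable_withDensity_iff_integrable_smul' hfm hftop] at h1
      have h1' : Integrable (fun x => (f x).toReal * τ.density μ.refMeasure x i j) ν := by
        rw [hfν] at h1; simpa only [smul_eq_mul] using h1
      refine (ha i j).1.ae_eq_of_withDensityᵥ_eq h1' ?_
      rw [← (ha i j).2, (hd i j).2]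
      ext E hE
      rw [withDensityᵥ_apply (hd i j).1 hE, withDensityᵥ_apply h1' hE]
      have := setIntegral_withDensity_eq_setIntegral_toReal_smul hfm
        (ae_restrict_of_ae hftop) (fun x => τ.density μ.refMeasure x i j) hE
      rw [hfν] at this
      exact this
    filter_upwards [ae_all_iff.2 fun i => ae_all_iff.2 (this i)] with x hx
    ext i j
    exact hx i j
  obtain ⟨a1, a2, a3⟩ := μ.absCont_refMeasure
  unfold action
  have h1 : ∫⁻ x in K, costDensity Λ₁ Λ₂ (μ.G.density μ.refMeasure x)
      (μ.q.density μ.refMeasure x) (μ.R.density μ.refMeasure x) ∂μ.refMeasure =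
      ∫⁻ x in K, (f * fun x => costDensity Λ₁ Λ₂ (μ.G.density μ.refMeasure x)
      (μ.q.density μ.refMeasure x) (μ.R.density μ.refMeasure x)) x ∂ν := by
    conv_lhs => rw [← hfν]
    -- Since f is measurable and finite almost everywhere, no measurability of the cost is required.
    rw [restrict_withDensity hK, lintegral_withDensity_eq_lintegral_mul_non_measurable _ hfm
      (ae_restrict_of_ae hftop)]
    simp only [hfν]
  rw [h1]
  refine lintegral_congr_ae (ae_restrict_of_ae ?_)
  filter_upwards [key _ _ hG a1, key _ _ hq a2, key _ _ hR a3, hftop] with x x1 x2 x3 x4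
  rw [x1, x2, x3, costDensity_smul ENNReal.toReal_nonneg, ENNReal.ofReal_toReal x4.ne]
  rfl

end MeasureTools

/-! ### Lower semicontinuity -/

section Duality

variable {V : Type*} [TopologicalSpace V] [NormalSpace V] [MeasurableSpace V] [BorelSpace V]

/-- A continuous substitute for selecting the index of the largest `u i`. Each `u i` is replaced by
a continuous function close in L¹, and the weights favour the indices that nearly attain the maximum
of these functions. -/
theorem exists_continuous_weights {ν : Measure V} [IsFiniteMeasure ν] [ν.WeaklyRegular]
    {u : ℕ → V → ℝ} (hu : ∀ i, Integrable (u i) ν) (M : ℕ) {δ : ℝ} (hδ : 0 < δ) :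
    ∃ φ : ℕ → V → ℝ, (∀ i, Continuous (φ i)) ∧ (∀ i w, 0 ≤ φ i w) ∧
      (∀ w, ∑ i ∈ Finset.range (M + 1), φ i w = 1) ∧
      ∫ w, partialSups u M w ∂ν ≤
        (∫ w, ∑ i ∈ Finset.range (M + 1), φ i w * u i w ∂ν) + δ := by
  -- The tolerance τ integrates to at most δ/2, and δ' makes twice the sum of the M + 1 errors in L¹
  -- at most δ/2.
  set τ : ℝ := δ / (2 * (ν.real Set.univ + 1)) with hτ
  have hτ0 : 0 < τ := by positivity
  set δ' : ℝ := δ / (4 * (M + 1)) with hδ'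
  have hδ0 : 0 < δ' := by positivity
  choose g hg hgi using fun i => (hu i).exists_boundedContinuous_integral_sub_le hδ0
  set G : V → ℝ := fun w => partialSups (fun i => g i w) M with hG
  have hGc : Continuous G := by
    have : ∀ N, Continuous fun w => partialSups (fun i => g i w) N := by
      intro N
      induction N with
      | zero => simpa using (g 0).continuous
      | succ N ih => simpa [partialSups_add_one] using ih.max (g (N + 1)).continuous
    exact this M
  -- Positive only where `g i` is within τ of the maximum. An index attaining the maximum has weight
  -- τ, so the sum never vanishes.
  set ψ : ℕ → V → ℝ := fun i w => max (g i w - G w + τ) 0 with hψ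
  have hψc : ∀ i, Continuous (ψ i) := fun i =>
    (((g i).continuous.sub hGc).add continuous_const).max continuous_const
  have hψ0 : ∀ i w, 0 ≤ ψ i w := fun i w => le_max_right _ _
  set Sψ : V → ℝ := fun w => ∑ i ∈ Finset.range (M + 1), ψ i w with hS
  have hattain : ∀ w, ∃ i ∈ Finset.range (M + 1), G w = g i w := by
    intro w
    have : ∀ N, ∃ i ∈ Finset.range (N + 1), partialSups (fun i => g i w) N = g i w := by
      intro N
      induction N with
      | zero => exact ⟨0, by simp, by simp⟩
      | succ N ih =>
        obtain ⟨i, hi, h⟩ := ih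
        rw [partialSups_add_one, h]
        rcases le_total (g i w) (g (N + 1) w) with h' | h'
        · exact ⟨N + 1, by simp, sup_eq_right.2 h'⟩
        · exact ⟨i, by simp at hi ⊢; omega, sup_eq_left.2 h'⟩
    exact this M
  have hSpos : ∀ w, 0 < Sψ w := by
    intro w
    obtain ⟨i, hi, h⟩ := hattain w
    refine lt_of_lt_of_le hτ0 (le_trans ?_ (Finset.single_le_sum (fun j _ => hψ0 j w) hi))
    simp [hψ, h]
  refine ⟨fun i w => ψ i w / Sψ w, fun i => (hψc i).div (continuous_finsetSum _ fun i _ => hψc i)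
    fun w => (hSpos w).ne', fun i w => div_nonneg (hψ0 i w) (hSpos w).le, fun w => ?_, ?_⟩
  · rw [← Finset.sum_div]
    exact div_self (hSpos w).ne'
  have hsum1 : ∀ w, ∑ i ∈ Finset.range (M + 1), ψ i w / Sψ w = 1 := fun w => by
    rw [← Finset.sum_div]
    exact div_self (hSpos w).ne'
  have hle1 : ∀ w, ∀ i ∈ Finset.range (M + 1), ψ i w / Sψ w ≤ 1 := fun w i hi => by
    rw [← hsum1 w]
    exact Finset.single_le_sum (f := fun i => ψ i w / Sψ w)
      (fun j _ => div_nonneg (hψ0 j w) (hSpos w).le) hi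
  -- The error between u and g enters twice: once inside the maximum, once when returning to u in
  -- the weighted sum.
  have hpt : ∀ w, partialSups u M w ≤ (∑ i ∈ Finset.range (M + 1), ψ i w / Sψ w * u i w) +
      (τ + 2 * ∑ i ∈ Finset.range (M + 1), ‖u i w - g i w‖) := by
    intro w
    have h1 : partialSups u M w ≤ G w + ∑ i ∈ Finset.range (M + 1), ‖u i w - g i w‖ := by
      have : partialSups u M ≤ fun w => G w + ∑ i ∈ Finset.range (M + 1), ‖u i w - g i w‖ := by
        refine partialSups_le _ _ _ fun i hi w => ?_
        have h2 : g i w ≤ G w := le_partialSups_of_le (fun i => g i w) hi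
        have h3 := Finset.single_le_sum (f := fun i => ‖u i w - g i w‖)
          (fun j _ => norm_nonneg _) (Finset.mem_range.2 (Nat.lt_succ_of_le hi))
        have h4 := Real.le_norm_self (u i w - g i w)
        linarith
      exact this w
    have h2 : ∀ i ∈ Finset.range (M + 1), ψ i w / Sψ w * (G w - τ) ≤
        ψ i w / Sψ w * u i w + ‖u i w - g i w‖ := by
      intro i hi
      have ha : ψ i w * (G w - τ) ≤ ψ i w * g i w := by
        rcases le_total (g i w - G w + τ) 0 with h | h
        · have : ψ i w = 0 := max_eq_right h
          simp [this]
        · exact mul_le_mul_of_nonneg_left (by linarith) (hψ0 i w)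
      have hb : ψ i w / Sψ w * (G w - τ) ≤ ψ i w / Sψ w * g i w := by
        rw [div_mul_eq_mul_div, div_mul_eq_mul_div]
        exact div_le_div_of_nonneg_right ha (hSpos w).le
      have hc : ψ i w / Sψ w * (g i w - u i w) ≤ ‖u i w - g i w‖ := by
        calc _ ≤ ψ i w / Sψ w * ‖u i w - g i w‖ := by
              refine mul_le_mul_of_nonneg_left ?_ (div_nonneg (hψ0 i w) (hSpos w).le)
              rw [norm_sub_rev]; exact Real.le_norm_self _
          _ ≤ 1 * ‖u i w - g i w‖ := mul_le_mul_of_nonneg_right (hle1 w i hi) (norm_nonneg _)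
          _ = _ := one_mul _
      linarith
    have h3 := Finset.sum_le_sum h2
    rw [← Finset.sum_mul, hsum1, Finset.sum_add_distrib] at h3
    linarith
  have hsup : ∀ N, Integrable (partialSups u N) ν := by
    intro N
    induction N with
    | zero => simpa using hu 0
    | succ N ih => rw [partialSups_add_one]; exact ih.sup (hu (N + 1))
  have hiφ : ∀ i ∈ Finset.range (M + 1), Integrable (fun w => ψ i w / Sψ w * u i w) ν := by
    intro i hi
    refine (hu i).bdd_mul (c := 1) ((hψc i).div (continuous_finsetSum _ fun i _ => hψc i)
      fun w => (hSpos w).ne').aestronglyMeasurable (ae_of_all _ fun w => ?_)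
    rw [Real.norm_of_nonneg (div_nonneg (hψ0 i w) (hSpos w).le)]
    exact hle1 w i hi
  have hin : ∀ i ∈ Finset.range (M + 1), Integrable (fun w => ‖u i w - g i w‖) ν :=
    fun i _ => ((hu i).sub (hgi i)).norm
  have herr : Integrable (fun w => τ + 2 * ∑ i ∈ Finset.range (M + 1), ‖u i w - g i w‖) ν :=
    (integrable_const _).add ((integrable_finsetSum _ hin).const_mul _)
  refine (integral_mono (hsup M) ((integrable_finsetSum _ hiφ).add herr) hpt).trans ?_
  rw [integral_add' (integrable_finsetSum _ hiφ) herr]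
  gcongr
  rw [integral_add (integrable_const _) ((integrable_finsetSum _ hin).const_mul _),
    integral_const_mul, integral_finsetSum _ hin, integral_const, smul_eq_mul]
  have h5 : ∑ i ∈ Finset.range (M + 1), ∫ w, ‖u i w - g i w‖ ∂ν ≤ (M + 1) * δ' := by
    refine (Finset.sum_le_sum fun i _ => hg i).trans ?_
    simp
  have h6 : (M + 1) * δ' = δ / 4 := by rw [hδ']; field_simp
  have h7 : ν.real Set.univ * τ ≤ δ / 2 := by
    have : 0 ≤ ν.real Set.univ := measureReal_nonneg
    rw [hτ, ← mul_div_assoc, div_le_iff₀ (by positivity)]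
    nlinarith
  linarith

variable {n k : ℕ}

theorem integrable_frob {W : Type*} [MeasurableSpace W] {ν : Measure W} {p m : ℕ}
    {X : W → Matrix (Fin p) (Fin m) ℝ} (hX : ∀ i j, Integrable (fun w => X w i j) ν)
    (A : Matrix (Fin p) (Fin m) ℝ) : Integrable (fun w => frob (X w) A) ν := by
  simp only [frob_eq_sum]
  exact integrable_finsetSum _ fun i _ => integrable_finsetSum _ fun j _ => (hX i j).mul_const _

/-- Uses the representation of the cost as a countable supremum. -/
theorem aemeasurable_costDensity {W : Type*} [MeasurableSpace W] {ν : Measure W}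
    (Λ₁ : Matrix (Fin k) (Fin k) ℝ) (Λ₂ : Matrix (Fin n) (Fin n) ℝ)
    {X Z : W → Matrix (Fin n) (Fin n) ℝ} {Y : W → Matrix (Fin n) (Fin k) ℝ}
    (hX : ∀ i j, Integrable (fun w => X w i j) ν) (hY : ∀ i j, Integrable (fun w => Y w i j) ν)
    (hZ : ∀ i j, Integrable (fun w => Z w i j) ν) :
    AEMeasurable (fun w => costDensity Λ₁ Λ₂ (X w) (Y w) (Z w)) ν := by
  obtain ⟨P, -, -, hJ⟩ := exists_seq_costDensity_eq_iSup Λ₁ Λ₂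
  simp only [hJ]
  refine AEMeasurable.iSup fun i => AEMeasurable.ennreal_ofReal ?_
  exact (((integrable_frob hX _).add (integrable_frob hY _)).add (integrable_frob hZ _)).aemeasurable

/-- The integral of the cost is approximated from below by continuous test functions. -/
theorem exists_continuous_lt_lintegral_costDensity {ν : Measure V} [IsFiniteMeasure ν]
    [ν.WeaklyRegular] {Λ₁ : Matrix (Fin k) (Fin k) ℝ} {Λ₂ : Matrix (Fin n) (Fin n) ℝ}
    {X Z : V → Matrix (Fin n) (Fin n) ℝ} {Y : V → Matrix (Fin n) (Fin k) ℝ}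
    (hX : ∀ i j, Integrable (fun w => X w i j) ν) (hY : ∀ i j, Integrable (fun w => Y w i j) ν)
    (hZ : ∀ i j, Integrable (fun w => Z w i j) ν) {c : ℝ≥0∞}
    (hc : c < ∫⁻ w, costDensity Λ₁ Λ₂ (X w) (Y w) (Z w) ∂ν) :
    ∃ (A : V → Matrix (Fin n) (Fin n) ℝ) (B : V → Matrix (Fin n) (Fin k) ℝ)
      (C : V → Matrix (Fin n) (Fin n) ℝ), Continuous A ∧ Continuous B ∧ Continuous C ∧
      (∀ w X Y Z, ENNReal.ofReal (frob X (A w) + frob Y (B w) + frob Z (C w)) ≤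
        costDensity Λ₁ Λ₂ X Y Z) ∧
      c < ENNReal.ofReal (∫ w, frob (X w) (A w) + frob (Y w) (B w) + frob (Z w) (C w) ∂ν) := by
  obtain ⟨P, hP, hP0, hJ⟩ := exists_seq_costDensity_eq_iSup Λ₁ Λ₂
  set u : ℕ → V → ℝ := fun i w =>
    frob (X w) (P i).1 + frob (Y w) (P i).2.1 + frob (Z w) (P i).2.2 with hudef
  have hu : ∀ i, Integrable (u i) ν := fun i =>
    ((integrable_frob hX _).add (integrable_frob hY _)).add (integrable_frob hZ _)
  have hsup : ∀ N, Integrable (partialSups u N) ν := by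
    intro N
    induction N with
    | zero => simpa using hu 0
    | succ N ih => rw [partialSups_add_one]; exact ih.sup (hu (N + 1))
  have hJ' : ∀ w, costDensity Λ₁ Λ₂ (X w) (Y w) (Z w) =
      ⨆ N, ENNReal.ofReal (partialSups u N w) := by
    intro w
    rw [hJ]
    refine le_antisymm (iSup_le fun i => le_iSup_of_le i ?_) (iSup_le fun N => ?_)
    · exact ENNReal.ofReal_le_ofReal (le_partialSups u i w)
    · induction N with
      | zero => exact le_iSup_of_le 0 (by simp [hudef])
      | succ N ih =>
        rw [partialSups_add_one, Pi.sup_apply, ENNReal.ofReal_max]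
        exact max_le ih (le_iSup_of_le (N + 1) le_rfl)
  simp only [hJ'] at hc
  rw [lintegral_iSup' (fun N => (hsup N).aemeasurable.ennreal_ofReal) (ae_of_all _ fun w a b hab =>
    ENNReal.ofReal_le_ofReal ((partialSups u).mono hab w)), lt_iSup_iff] at hc
  obtain ⟨M, hM⟩ := hc
  have hnn : 0 ≤ᵐ[ν] partialSups u M := ae_of_all _ fun w => by
    have h0 : u 0 w = 0 := by simp [hudef, hP0, frob_zero_right]
    have := le_partialSups_of_le u (Nat.zero_le M) w
    rw [h0] at this
    exact this
  rw [← ofReal_integral_eq_lintegral_ofReal (hsup M) hnn] at hM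
  set a := ∫ w, partialSups u M w ∂ν with ha
  have hctop : c ≠ ⊤ := (hM.trans ENNReal.ofReal_lt_top).ne
  have hca : c.toReal < a := (ENNReal.lt_ofReal_iff_toReal_lt hctop).1 hM
  obtain ⟨φ, hφc, hφ0, hφ1, hφ⟩ := exists_continuous_weights hu M
    (δ := (a - c.toReal) / 2) (by linarith)
  refine ⟨fun w => ∑ i ∈ Finset.range (M + 1), φ i w • (P i).1,
    fun w => ∑ i ∈ Finset.range (M + 1), φ i w • (P i).2.1,
    fun w => ∑ i ∈ Finset.range (M + 1), φ i w • (P i).2.2,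
    continuous_finsetSum _ fun i _ => (hφc i).smul continuous_const,
    continuous_finsetSum _ fun i _ => (hφc i).smul continuous_const,
    continuous_finsetSum _ fun i _ => (hφc i).smul continuous_const, ?_, ?_⟩
  all_goals
    have hfrob : ∀ (w : V) {p m : ℕ} (x : Matrix (Fin p) (Fin m) ℝ)
        (Q : ℕ → Matrix (Fin p) (Fin m) ℝ),
        frob x (∑ i ∈ Finset.range (M + 1), φ i w • Q i) =
          ∑ i ∈ Finset.range (M + 1), φ i w * frob x (Q i) := by
      intro w p m x Q
      simp [frob, Matrix.mul_sum, Matrix.trace_sum]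
  · intro w x y z
    rw [hfrob w x fun i => (P i).1, hfrob w y fun i => (P i).2.1, hfrob w z fun i => (P i).2.2,
      ← Finset.sum_add_distrib, ← Finset.sum_add_distrib]
    rcases eq_or_ne (costDensity Λ₁ Λ₂ x y z) ⊤ with htop | htop
    · rw [htop]; exact le_top
    rw [ENNReal.ofReal_le_iff_le_toReal htop]
    -- The weights are nonnegative with sum one, so the bound valid for each admissible triplet
    -- passes to the combination.
    calc _ ≤ ∑ i ∈ Finset.range (M + 1), φ i w * (costDensity Λ₁ Λ₂ x y z).toReal := by
          refine Finset.sum_le_sum fun i _ => ?_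
          rw [← mul_add, ← mul_add]
          exact mul_le_mul_of_nonneg_left
            (le_toReal_costDensity (lt_top_iff_ne_top.2 htop) (hP i)) (hφ0 i w)
      _ = _ := by rw [← Finset.sum_mul, hφ1, one_mul]
  · rw [ENNReal.lt_ofReal_iff_toReal_lt hctop]
    have : (∫ w, ∑ i ∈ Finset.range (M + 1), φ i w * u i w ∂ν) =
        ∫ w, frob (X w) (∑ i ∈ Finset.range (M + 1), φ i w • (P i).1) +
          frob (Y w) (∑ i ∈ Finset.range (M + 1), φ i w • (P i).2.1) +
          frob (Z w) (∑ i ∈ Finset.range (M + 1), φ i w • (P i).2.2) ∂ν := by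
      refine integral_congr_ae (ae_of_all _ fun w => ?_)
      simp only
      rw [hfrob w _ fun i => (P i).1, hfrob w _ fun i => (P i).2.1, hfrob w _ fun i => (P i).2.2,
        ← Finset.sum_add_distrib, ← Finset.sum_add_distrib]
      refine Finset.sum_congr rfl fun i _ => ?_
      simp only [hudef]
      ring
    rw [← this]
    linarith

end Duality

/-! ### Smearing a measure along a map -/

section Smear

variable {W V : Type*} [MeasurableSpace W] [NormedAddCommGroup V]

/-- The density `z ↦ ∫ η (z - F w) u(w) dν(w)`: the push-forward of `u ν` under `F`, convolved
with `η`. -/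
def smear (ν : Measure W) (η : V → ℝ) (F : W → V) (u : W → ℝ) (z : V) : ℝ :=
  ∫ w, η (z - F w) * u w ∂ν

/-- The matrix-valued version of `smear`. -/
def smearMatrix {p m : ℕ} (ν : Measure W) (η : V → ℝ) (F : W → V)
    (X : W → Matrix (Fin p) (Fin m) ℝ) (z : V) : Matrix (Fin p) (Fin m) ℝ :=
  Matrix.of fun i j => smear ν η F (fun w => X w i j) z

variable [NormedSpace ℝ V] [MeasureSpace V] [BorelSpace V]

/-- Smooth probability densities supported in the ball of radius `δ`. -/
structure IsMollifier (η : V → ℝ) (δ : ℝ) : Prop where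
  contDiff : ContDiff ℝ ∞ η
  hasCompactSupport : HasCompactSupport η
  nonneg : ∀ z, 0 ≤ η z
  integral_eq_one : ∫ z, η z = 1
  norm_lt : ∀ z, η z ≠ 0 → ‖z‖ < δ

variable {ν : Measure W} {η : V → ℝ} {δ : ℝ} {F : W → V} {u : W → ℝ}

theorem IsMollifier.exists_bound (h : IsMollifier η δ) : ∃ M, ∀ z, ‖η z‖ ≤ M :=
  h.contDiff.continuous.bounded_above_of_compact_support h.hasCompactSupport

theorem IsMollifier.integrable (h : IsMollifier η δ) [IsFiniteMeasureOnCompacts (volume : Measure V)] :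
    Integrable η volume :=
  h.contDiff.continuous.integrable_of_hasCompactSupport h.hasCompactSupport

variable [FiniteDimensional ℝ V]

theorem IsMollifier.measurable_sub (h : IsMollifier η δ) (hF : Measurable F) (z : V) :
    Measurable fun w => η (z - F w) :=
  h.contDiff.continuous.measurable.comp (measurable_const.sub hF)

theorem IsMollifier.integrable_sub_mul (h : IsMollifier η δ) (hF : Measurable F)
    (hu : Integrable u ν) (z : V) : Integrable (fun w => η (z - F w) * u w) ν := by
  obtain ⟨M, hM⟩ := h.exists_bound
  exact hu.bdd_mul (h.measurable_sub hF z).aestronglyMeasurable (ae_of_all _ fun w => hM _)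

/-- For nonnegative u this is the convolution of η with the push-forward of u ν under F, a finite
measure; it is written as the convolution of the constant 1 and η with respect to that measure. The
general case follows by splitting u into its positive and negative parts. -/
theorem contDiff_smear (h : IsMollifier η δ) (hF : Measurable F) (hu : Integrable u ν) :
    ContDiff ℝ ∞ (smear ν η F u) := by
  have key : ∀ v : W → ℝ, Integrable v ν →
      ContDiff ℝ ∞ fun z => ∫ w, (ENNReal.ofReal (v w)).toReal * η (z - F w) ∂ν := by
    intro v hv
    have : IsFiniteMeasure (ν.withDensity fun x => ENNReal.ofReal (v x)) :=
      isFiniteMeasure_withDensity_ofReal hv.2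
    set m := (ν.withDensity fun x => ENNReal.ofReal (v x)).map F with hm
    have hc := h.hasCompactSupport.contDiff_convolution_right (μ := m) (𝕜 := ℝ)
      (ContinuousLinearMap.lsmul ℝ ℝ) (f := fun _ : V => (1 : ℝ)) (n := ⊤)
      (integrable_const _).locallyIntegrable h.contDiff
    convert hc using 1
    ext z
    simp only [convolution, ContinuousLinearMap.lsmul_apply, one_smul]
    rw [hm, integral_map hF.aemeasurable (show Continuous fun y => η (z - y) from
        h.contDiff.continuous.comp (continuous_const.sub continuous_id)).aestronglyMeasurable,
      integral_withDensity_eq_integral_toReal_smul₀ hv.aemeasurable.ennreal_ofReal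
        (ae_of_all _ fun _ => ENNReal.ofReal_lt_top)]
    rfl
  have hI : ∀ v : W → ℝ, Integrable v ν → ∀ z,
      Integrable (fun w => (ENNReal.ofReal (v w)).toReal * η (z - F w)) ν := by
    intro v hv z
    have hv' : Integrable (fun w => (ENNReal.ofReal (v w)).toReal) ν :=
      hv.real_toNNReal.congr (ae_of_all _ fun x => by simp [ENNReal.toReal_ofReal'])
    exact (h.integrable_sub_mul hF hv' z).congr (ae_of_all _ fun w => mul_comm _ _)
  have e : smear ν η F u = fun z => (∫ w, (ENNReal.ofReal (u w)).toReal * η (z - F w) ∂ν) -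
      ∫ w, (ENNReal.ofReal (-u w)).toReal * η (z - F w) ∂ν := by
    ext z
    rw [smear, ← integral_sub (hI u hu z) (hI (fun w => -u w) hu.neg z)]
    refine integral_congr_ae (ae_of_all _ fun w => ?_)
    simp only [ENNReal.toReal_ofReal']
    rw [← sub_mul, mul_comm]
    congr 1
    rcases le_total (u w) 0 with h | h
    · rw [max_eq_right h, max_eq_left (by linarith)]; ring
    · rw [max_eq_left h, max_eq_right (by linarith)]; ring
  rw [e]
  exact (key u hu).sub (key (fun w => -u w) hu.neg)

theorem smear_nonneg (h : IsMollifier η δ) (hu : 0 ≤ᵐ[ν] u) (z : V) : 0 ≤ smear ν η F u z :=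
  integral_nonneg_of_ae (hu.mono fun _ hw => mul_nonneg (h.nonneg _) hw)

theorem smear_add (h : IsMollifier η δ) (hF : Measurable F) {v : W → ℝ} (hu : Integrable u ν)
    (hv : Integrable v ν) (z : V) :
    smear ν η F (fun w => u w + v w) z = smear ν η F u z + smear ν η F v z := by
  simp only [smear, mul_add]
  exact integral_add (h.integrable_sub_mul hF hu z) (h.integrable_sub_mul hF hv z)

theorem smear_const_mul (c : ℝ) (z : V) :
    smear ν η F (fun w => c * u w) z = c * smear ν η F u z := by
  simp only [smear]
  rw [← integral_const_mul]
  exact integral_congr_ae (ae_of_all _ fun w => by ring)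

theorem smear_sum {ι : Type*} (s : Finset ι) (h : IsMollifier η δ) (hF : Measurable F)
    {f : ι → W → ℝ} (hf : ∀ i ∈ s, Integrable (f i) ν) (z : V) :
    smear ν η F (fun w => ∑ i ∈ s, f i w) z = ∑ i ∈ s, smear ν η F (f i) z := by
  simp only [smear, Finset.mul_sum]
  exact integral_finsetSum _ fun i hi => h.integrable_sub_mul hF (hf i hi) z

theorem frob_smearMatrix (h : IsMollifier η δ) (hF : Measurable F) {p m : ℕ}
    {X : W → Matrix (Fin p) (Fin m) ℝ} (hX : ∀ i j, Integrable (fun w => X w i j) ν)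
    (A : Matrix (Fin p) (Fin m) ℝ) (z : V) :
    frob (smearMatrix ν η F X z) A = smear ν η F (fun w => frob (X w) A) z := by
  simp only [frob_eq_sum, smearMatrix, Matrix.of_apply]
  refine Eq.trans ?_ (smear_sum Finset.univ h hF (f := fun i w => ∑ j, X w i j * A i j)
    (fun i _ => integrable_finsetSum _ fun j _ => (hX i j).mul_const _) z).symm
  refine Finset.sum_congr rfl fun i _ => ?_
  refine Eq.trans ?_ (smear_sum Finset.univ h hF (f := fun j w => X w i j * A i j)
    (fun j _ => (hX i j).mul_const _) z).symm
  refine Finset.sum_congr rfl fun j _ => ?_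
  simp only [mul_comm _ (A i j)]
  exact (smear_const_mul _ _).symm

theorem posSemidef_smearMatrix (h : IsMollifier η δ) (hF : Measurable F) {n : ℕ}
    {X : W → Matrix (Fin n) (Fin n) ℝ} (hX : ∀ i j, Integrable (fun w => X w i j) ν)
    (hpos : ∀ᵐ w ∂ν, (X w).PosSemidef) (z : V) : (smearMatrix ν η F X z).PosSemidef := by
  refine posSemidef_iff_isSymm.2 ⟨?_, fun v => ?_⟩
  · ext i j
    refine integral_congr_ae (hpos.mono fun w hw => ?_)
    simp only [(PosSemidef.isSymm hw).apply i j]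
  · have e : v ⬝ᵥ smearMatrix ν η F X z *ᵥ v = smear ν η F (fun w => v ⬝ᵥ X w *ᵥ v) z := by
      have e1 : ∀ A : Matrix (Fin n) (Fin n) ℝ, v ⬝ᵥ A *ᵥ v = frob A (Matrix.vecMulVec v v) := by
        intro A
        rw [dotProduct_mulVec_self_eq_sum, frob_eq_sum]
        simp [Matrix.vecMulVec_apply]
      simp only [e1]
      exact frob_smearMatrix h hF hX _ z
    rw [e]
    exact smear_nonneg h (hpos.mono fun w hw => (posSemidef_iff_isSymm.1 hw).2 v) z

theorem ofReal_integral_le_lintegral_ofReal {f : W → ℝ} (hf : Integrable f ν) :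
    ENNReal.ofReal (∫ w, f w ∂ν) ≤ ∫⁻ w, ENNReal.ofReal (f w) ∂ν := by
  calc ENNReal.ofReal (∫ w, f w ∂ν) ≤ ENNReal.ofReal (∫ w, max (f w) 0 ∂ν) :=
        ENNReal.ofReal_le_ofReal (integral_mono hf hf.pos_part fun w => le_max_left _ _)
    _ = ∫⁻ w, ENNReal.ofReal (max (f w) 0) ∂ν :=
        ofReal_integral_eq_lintegral_ofReal hf.pos_part (ae_of_all _ fun w => le_max_right _ _)
    _ = _ := by simp [ENNReal.ofReal_max]

/-- Jensen's inequality for the cost. -/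
theorem costDensity_smearMatrix_le {n k : ℕ} {Λ₁ : Matrix (Fin k) (Fin k) ℝ}
    {Λ₂ : Matrix (Fin n) (Fin n) ℝ} (h : IsMollifier η δ) (hF : Measurable F)
    {X Z : W → Matrix (Fin n) (Fin n) ℝ} {Y : W → Matrix (Fin n) (Fin k) ℝ}
    (hX : ∀ i j, Integrable (fun w => X w i j) ν) (hY : ∀ i j, Integrable (fun w => Y w i j) ν)
    (hZ : ∀ i j, Integrable (fun w => Z w i j) ν) (z : V) :
    costDensity Λ₁ Λ₂ (smearMatrix ν η F X z) (smearMatrix ν η F Y z) (smearMatrix ν η F Z z) ≤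
      ∫⁻ w, ENNReal.ofReal (η (z - F w)) * costDensity Λ₁ Λ₂ (X w) (Y w) (Z w) ∂ν := by
  -- For a fixed admissible triplet the expression is linear and commutes with smearing. The cost
  -- enters only afterwards, as a bound of the integrand.
  refine iSup₂_le fun P hP => ?_
  have h1 := integrable_frob hX P.1
  have h2 := integrable_frob hY P.2.1
  have h3 := integrable_frob hZ P.2.2
  rw [frob_smearMatrix h hF hX, frob_smearMatrix h hF hY, frob_smearMatrix h hF hZ,
    ← smear_add h hF h1 h2, 
    ← smear_add h hF (u := fun w => frob (X w) P.1 + frob (Y w) P.2.1) (h1.add h2) h3]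
  refine (ofReal_integral_le_lintegral_ofReal
    (h.integrable_sub_mul hF ((h1.add h2).add h3) z)).trans (lintegral_mono fun w => ?_)
  rw [ENNReal.ofReal_mul (h.nonneg _)]
  exact mul_le_mul_right (le_costDensity hP) _

variable [SFinite ν] [(volume : Measure V).IsAddHaarMeasure]

theorem IsMollifier.lintegral_sub_le (h : IsMollifier η δ) (K : Set V) (a : V) :
    ∫⁻ z in K, ENNReal.ofReal (η (z - a)) ≤ 1 := by
  calc _ ≤ ∫⁻ z, ENNReal.ofReal (η (z - a)) := setLIntegral_le_lintegral _ _
    _ = ∫⁻ z, ENNReal.ofReal (η z) :=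
        lintegral_sub_right_eq_self (fun z => ENNReal.ofReal (η z)) a
    _ = 1 := by
        rw [← ofReal_integral_eq_lintegral_ofReal h.integrable (ae_of_all _ h.nonneg),
          h.integral_eq_one, ENNReal.ofReal_one]

/-- Tonelli: for every w the translated kernel has integral at most one over K. -/
theorem lintegral_lintegral_smear_le (h : IsMollifier η δ) (hF : Measurable F) (K : Set V)
    {H : W → ℝ≥0∞} (hH : AEMeasurable H ν) :
    ∫⁻ z in K, ∫⁻ w, ENNReal.ofReal (η (z - F w)) * H w ∂ν ≤ ∫⁻ w, H w ∂ν := by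
  rw [lintegral_lintegral_swap]
  · refine lintegral_mono fun w => ?_
    rw [lintegral_mul_const _ (by
      exact (h.contDiff.continuous.measurable.comp (measurable_id.sub_const _)).ennreal_ofReal)]
    exact mul_le_of_le_one_left zero_le (h.lintegral_sub_le K (F w))
  · refine AEMeasurable.mul ?_ hH.comp_snd
    exact (h.contDiff.continuous.measurable.comp
      (measurable_fst.sub (hF.comp measurable_snd))).ennreal_ofReal.aemeasurable

theorem lintegral_enorm_smear_le (h : IsMollifier η δ) (hF : Measurable F) (K : Set V)
    (hu : Integrable u ν) :
    ∫⁻ z in K, ‖smear ν η F u z‖ₑ ≤ ∫⁻ w, ‖u w‖ₑ ∂ν := by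
  refine le_trans (lintegral_mono fun z => ?_)
    (lintegral_lintegral_smear_le h hF K hu.aestronglyMeasurable.enorm)
  refine (enorm_integral_le_lintegral_enorm _).trans (le_of_eq ?_)
  refine lintegral_congr fun w => ?_
  rw [enorm_mul, Real.enorm_of_nonneg (h.nonneg _)]

theorem integrable_smear (h : IsMollifier η δ) (hF : Measurable F) (K : Set V)
    (hu : Integrable u ν) : Integrable (smear ν η F u) (volume.restrict K) :=
  ⟨(contDiff_smear h hF hu).continuous.aestronglyMeasurable,
    (lintegral_enorm_smear_le h hF K hu).trans_lt hu.2⟩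

theorem integral_abs_smear_le (h : IsMollifier η δ) (hF : Measurable F) (K : Set V)
    (hu : Integrable u ν) : ∫ z in K, |smear ν η F u z| ≤ ∫ w, |u w| ∂ν := by
  have h1 := lintegral_enorm_smear_le h hF K hu
  simp only [← Real.norm_eq_abs]
  rw [integral_norm_eq_lintegral_enorm (integrable_smear h hF K hu).aestronglyMeasurable,
    integral_norm_eq_lintegral_enorm hu.aestronglyMeasurable]
  exact ENNReal.toReal_mono hu.2.ne h1

/-- Integration of a test function against a smeared density. -/
theorem integral_mul_smear (h : IsMollifier η δ) (hF : Measurable F) {K : Set V}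
    (hK : volume K < ⊤) (hu : Integrable u ν) {Ψ : V → ℝ}
    (hΨ : AEStronglyMeasurable Ψ (volume.restrict K)) {M : ℝ}
    (hM : ∀ᵐ z ∂volume.restrict K, ‖Ψ z‖ ≤ M) :
    ∫ z in K, Ψ z * smear ν η F u z = ∫ w, (∫ z in K, Ψ z * η (z - F w)) * u w ∂ν := by
  have : IsFiniteMeasure (volume.restrict K) := ⟨by simpa using hK⟩
  obtain ⟨B, hB⟩ := h.exists_bound
  have hint : Integrable (fun p : V × W => Ψ p.1 * (η (p.1 - F p.2) * u p.2))
      ((volume.restrict K).prod ν) := by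
    have h1 : Integrable (fun p : V × W => u p.2) ((volume.restrict K).prod ν) := hu.comp_snd _
    have h2 : Integrable (fun p : V × W => η (p.1 - F p.2) * u p.2)
        ((volume.restrict K).prod ν) :=
      h1.bdd_mul (h.contDiff.continuous.measurable.comp
        (measurable_fst.sub (hF.comp measurable_snd))).aestronglyMeasurable
        (ae_of_all _ fun p => hB _)
    exact h2.bdd_mul hΨ.comp_fst (Measure.quasiMeasurePreserving_fst.ae hM)
  calc _ = ∫ z in K, ∫ w, Ψ z * (η (z - F w) * u w) ∂ν := by
        simp only [smear, integral_const_mul]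
    _ = ∫ w, (∫ z in K, Ψ z * (η (z - F w) * u w)) ∂ν := integral_integral_swap hint
    _ = _ := by
        refine integral_congr_ae (ae_of_all _ fun w => ?_)
        simp only [← mul_assoc]
        exact integral_mul_const _ _

theorem IsMollifier.setIntegral_sub_eq (h : IsMollifier η δ) {K : Set V} {a : V}
    (ha : ∀ ζ, ‖ζ‖ < δ → a + ζ ∈ K) (Ψ : V → ℝ) :
    ∫ z in K, Ψ z * η (z - a) = ∫ ζ, Ψ (a + ζ) * η ζ := by
  rw [setIntegral_eq_integral_of_forall_compl_eq_zero]
  · rw [← integral_add_left_eq_self (fun z => Ψ z * η (z - a)) a]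
    simp
  · intro z hz
    by_contra hne
    have := ha (z - a) (h.norm_lt _ (right_ne_zero_of_mul hne))
    rw [add_sub_cancel] at this
    exact hz this

/-- Integration of a continuous test function against a smeared density, as an average over
translations. -/
theorem integral_mul_smear_eq_average (h : IsMollifier η δ) (hF : Measurable F) {K : Set V}
    (hK : IsCompact K) (hFK : ∀ᵐ w ∂ν, ∀ ζ, ‖ζ‖ < δ → F w + ζ ∈ K) (hu : Integrable u ν)
    {Ψ : V → ℝ} (hΨ : Continuous Ψ) :
    ∫ z in K, Ψ z * smear ν η F u z = ∫ ζ, η ζ * ∫ w, Ψ (F w + ζ) * u w ∂ν := by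
  obtain ⟨M, hM⟩ := hK.exists_bound_of_continuousOn hΨ.continuousOn
  rw [integral_mul_smear h hF hK.measure_lt_top hu hΨ.aestronglyMeasurable
    ((ae_restrict_iff' hK.measurableSet).2 (ae_of_all _ hM))]
  -- Ψ is bounded only on K; this suffices because F w + ζ lies in K whenever η ζ ≠ 0.
  have hint : Integrable (fun p : W × V => Ψ (F p.1 + p.2) * η p.2 * u p.1)
      (ν.prod volume) := by
    refine Integrable.mono' ((hu.norm.mul_prod h.integrable.norm).const_mul M) ?_ ?_
    · refine AEStronglyMeasurable.mul (AEStronglyMeasurable.mul ?_ ?_) hu.1.comp_fst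
      · exact (hΨ.measurable.comp
          ((hF.comp measurable_fst).add measurable_snd)).aestronglyMeasurable
      · exact (h.contDiff.continuous.measurable.comp measurable_snd).aestronglyMeasurable
    · filter_upwards [Measure.quasiMeasurePreserving_fst.ae hFK] with p hp
      rcases eq_or_ne (η p.2) 0 with h0 | h0
      · simp [h0]
      · rw [norm_mul, norm_mul, mul_assoc, mul_comm ‖η p.2‖]
        exact mul_le_mul_of_nonneg_right (hM _ (hp _ (h.norm_lt _ h0))) (by positivity)
  calc _ = ∫ w, (∫ ζ, Ψ (F w + ζ) * η ζ * u w) ∂ν := by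
        refine integral_congr_ae (hFK.mono fun w hw => ?_)
        simp only
        rw [h.setIntegral_sub_eq hw, integral_mul_const]
    _ = ∫ ζ, ∫ w, Ψ (F w + ζ) * η ζ * u w ∂ν := integral_integral_swap hint
    _ = _ := by
        refine integral_congr_ae (ae_of_all _ fun ζ => ?_)
        simp only
        rw [← integral_const_mul]
        exact integral_congr_ae (ae_of_all _ fun w => by ring)

theorem integrable_average_smear (h : IsMollifier η δ) (hF : Measurable F) {K : Set V}
    (hK : IsCompact K) (hFK : ∀ᵐ w ∂ν, ∀ ζ, ‖ζ‖ < δ → F w + ζ ∈ K) (hu : Integrable u ν)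
    {Ψ : V → ℝ} (hΨ : Continuous Ψ) :
    Integrable (fun ζ => η ζ * ∫ w, Ψ (F w + ζ) * u w ∂ν) volume := by
  obtain ⟨M, hM⟩ := hK.exists_bound_of_continuousOn hΨ.continuousOn
  have hint : Integrable (fun p : V × W => Ψ (F p.2 + p.1) * η p.1 * u p.2)
      (Measure.prod volume ν) := by
    refine Integrable.mono' ((h.integrable.norm.mul_prod hu.norm).const_mul M) ?_ ?_
    · refine AEStronglyMeasurable.mul (AEStronglyMeasurable.mul ?_ ?_) hu.1.comp_snd
      · exact (hΨ.measurable.comp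
          ((hF.comp measurable_snd).add measurable_fst)).aestronglyMeasurable
      · exact (h.contDiff.continuous.measurable.comp measurable_fst).aestronglyMeasurable
    · filter_upwards [Measure.quasiMeasurePreserving_snd.ae hFK] with p hp
      rcases eq_or_ne (η p.1) 0 with h0 | h0
      · simp [h0]
      · rw [norm_mul, norm_mul, mul_assoc]
        exact mul_le_mul_of_nonneg_right (hM _ (hp _ (h.norm_lt _ h0))) (by positivity)
  refine hint.integral_prod_left.congr (ae_of_all _ fun ζ => ?_)
  simp only
  rw [← integral_const_mul]
  exact integral_congr_ae (ae_of_all _ fun w => by ring)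

end Smear

/-! ### Contractions of star-shaped sets and convergence of smeared measures -/

section Contraction

variable {V : Type*} [NormedAddCommGroup V] [NormedSpace ℝ V]

/-- The contraction of ratio `1 - e` towards `c`. -/
def shrink (c : V) (e : ℝ) (w : V) : V := c + (1 - e) • (w - c)

theorem continuous_shrink (c : V) (e : ℝ) : Continuous (shrink c e) := by
  unfold shrink; fun_prop

/-- The point equals e (c + ζ/e) + (1 - e) w, a convex combination of w and the star centre c + ζ/e.
This dictates the mollification radius e r. -/
theorem shrink_add_mem {K : Set V} {c : V} {r e : ℝ}
    (hK : ∀ y, ‖y - c‖ < r → StarConvex ℝ y K) (he : 0 < e) (he1 : e ≤ 1) {w ζ : V} (hw : w ∈ K)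
    (hζ : ‖ζ‖ < e * r) : shrink c e w + ζ ∈ K := by
  have h1 : ‖(c + e⁻¹ • ζ) - c‖ < r := by
    rw [add_sub_cancel_left, norm_smul, norm_inv, Real.norm_of_nonneg he.le,
      inv_mul_lt_iff₀ he]
    exact hζ
  have h2 := hK _ h1 hw he.le (sub_nonneg.2 he1) (by ring)
  convert h2 using 1
  rw [shrink, smul_add, smul_smul, mul_inv_cancel₀ he.ne', one_smul, smul_sub, sub_smul, one_smul,
    sub_smul, one_smul]
  abel

theorem tendsto_shrink (c w : V) {ι : Type*} {l : Filter ι} {e : ι → ℝ} (he : Tendsto e l (𝓝 0)) :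
    Tendsto (fun N => shrink c (e N) w) l (𝓝 w) := by
  have : Tendsto (fun N => c + (1 - e N) • (w - c)) l (𝓝 (c + (1 - 0 : ℝ) • (w - c))) :=
    tendsto_const_nhds.add ((tendsto_const_nhds.sub he).smul tendsto_const_nhds)
  simpa [shrink] using this

variable [MeasureSpace V] [BorelSpace V] [FiniteDimensional ℝ V]
  [(volume : Measure V).IsAddHaarMeasure]

/-- The kernel centred at `a N` has its full mass inside K and sees only points at distance less
than `δ N + dist (a N) b` from b. -/
theorem IsMollifier.tendsto_setIntegral_sub {η : ℕ → V → ℝ} {δ : ℕ → ℝ}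
    (h : ∀ N, IsMollifier (η N) (δ N)) (hδ : Tendsto δ atTop (𝓝 0)) {K : Set V}
    (hK : IsCompact K) {Ψ : V → ℝ} (hΨ : ContinuousOn Ψ K) {a : ℕ → V} {b : V} (hb : b ∈ K)
    (ha : Tendsto a atTop (𝓝 b)) (haK : ∀ N, ∀ ζ, ‖ζ‖ < δ N → a N + ζ ∈ K) :
    Tendsto (fun N => ∫ z in K, Ψ z * η N (z - a N)) atTop (𝓝 (Ψ b)) := by
  rw [Metric.tendsto_atTop]
  intro ε hε
  obtain ⟨τ, hτ, hτΨ⟩ := Metric.continuousWithinAt_iff.1 (hΨ b hb) (ε / 2) (by linarith)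
  have h1 : Tendsto (fun N => δ N + dist (a N) b) atTop (𝓝 (0 + 0)) :=
    hδ.add (tendsto_iff_dist_tendsto_zero.1 ha)
  rw [add_zero] at h1
  obtain ⟨N₀, hN₀⟩ := eventually_atTop.1 (h1.eventually_lt_const hτ)
  refine ⟨N₀, fun N hN => ?_⟩
  have hηc : Continuous fun z => η N (z - a N) :=
    (h N).contDiff.continuous.comp (continuous_id.sub continuous_const)
  have hone : ∫ z in K, η N (z - a N) = 1 := by
    have := (h N).setIntegral_sub_eq (haK N) fun _ => 1
    simpa [(h N).integral_eq_one] using this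
  have e1 : (∫ z in K, Ψ z * η N (z - a N)) - Ψ b =
      ∫ z in K, (Ψ z - Ψ b) * η N (z - a N) := by
    simp only [sub_mul]
    have i1 : IntegrableOn (fun z => Ψ z * η N (z - a N)) K volume :=
      (hΨ.mul hηc.continuousOn).integrableOn_compact hK
    have i2 : IntegrableOn (fun z => Ψ b * η N (z - a N)) K volume :=
      (continuousOn_const.mul hηc.continuousOn).integrableOn_compact hK
    rw [integral_sub i1 i2, integral_const_mul, hone, mul_one]
  rw [Real.dist_eq, e1]
  have h2 : ‖∫ z in K, (Ψ z - Ψ b) * η N (z - a N)‖ ≤ ∫ z in K, ε / 2 * η N (z - a N) := by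
    refine norm_integral_le_of_norm_le ?_ ((ae_restrict_iff' hK.measurableSet).2
      (ae_of_all _ fun z hz => ?_))
    · exact (continuous_const.mul hηc).continuousOn.integrableOn_compact hK
    · rw [norm_mul, Real.norm_of_nonneg ((h N).nonneg _)]
      rcases eq_or_ne (η N (z - a N)) 0 with h0 | h0
      · simp [h0]
      · refine mul_le_mul_of_nonneg_right ?_ ((h N).nonneg _)
        have h3 := (h N).norm_lt _ h0
        have h4 : dist z b < τ := by
          calc dist z b ≤ dist z (a N) + dist (a N) b := dist_triangle _ _ _
            _ < δ N + dist (a N) b := by rw [dist_eq_norm]; gcongr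
            _ < τ := hN₀ N hN
        have := hτΨ hz h4
        rw [Real.dist_eq] at this
        exact this.le
  rw [integral_const_mul, hone, mul_one, Real.norm_eq_abs] at h2
  linarith

/-- Weak-star convergence of smeared measures. -/
theorem tendsto_integral_mul_smear {W : Type*} [MeasurableSpace W] {ν : Measure W} [SFinite ν]
    {η : ℕ → V → ℝ} {δ : ℕ → ℝ} (h : ∀ N, IsMollifier (η N) (δ N)) (hδ : Tendsto δ atTop (𝓝 0))
    {K : Set V} (hK : IsCompact K) {Ψ : V → ℝ} (hΨ : ContinuousOn Ψ K) {F : ℕ → W → V}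
    {F' : W → V} (hF : ∀ N, Measurable (F N)) (hF' : ∀ᵐ w ∂ν, F' w ∈ K)
    (hFK : ∀ᵐ w ∂ν, ∀ N, ∀ ζ, ‖ζ‖ < δ N → F N w + ζ ∈ K)
    (hFF : ∀ᵐ w ∂ν, Tendsto (fun N => F N w) atTop (𝓝 (F' w)))
    {u : W → ℝ} (hu : Integrable u ν) :
    Tendsto (fun N => ∫ z in K, Ψ z * smear ν (η N) (F N) u z) atTop
      (𝓝 (∫ w, Ψ (F' w) * u w ∂ν)) := by
  obtain ⟨M, hM⟩ := hK.exists_bound_of_continuousOn hΨ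
  have hΨm : AEStronglyMeasurable Ψ (volume.restrict K) :=
    hΨ.aestronglyMeasurable_of_isCompact hK hK.measurableSet
  have hΨM : ∀ᵐ z ∂volume.restrict K, ‖Ψ z‖ ≤ M :=
    (ae_restrict_iff' hK.measurableSet).2 (ae_of_all _ hM)
  simp only [fun N => integral_mul_smear (h N) (hF N) hK.measure_lt_top hu hΨm hΨM]
  have : IsFiniteMeasure (volume.restrict K) := ⟨by simpa using hK.measure_lt_top⟩
  refine tendsto_integral_of_dominated_convergence (fun w => M * ‖u w‖) (fun N => ?_)
    (hu.norm.const_mul M) (fun N => ?_) ?_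
  · refine AEStronglyMeasurable.mul ?_ hu.1
    have h1 : AEStronglyMeasurable (fun p : W × V => Ψ p.2 * η N (p.2 - F N p.1))
        (ν.prod (volume.restrict K)) :=
      hΨm.comp_snd.mul ((h N).contDiff.continuous.measurable.comp
        (measurable_snd.sub ((hF N).comp measurable_fst))).aestronglyMeasurable
    exact h1.integral_prod_right'
  · filter_upwards [hFK, hF'] with w hw hw'
    rw [norm_mul]
    refine mul_le_mul_of_nonneg_right ?_ (norm_nonneg _)
    have hηc : Continuous fun z => η N (z - F N w) :=
      (h N).contDiff.continuous.comp (continuous_id.sub continuous_const)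
    have h2 : ‖∫ z in K, Ψ z * η N (z - F N w)‖ ≤ ∫ z in K, M * η N (z - F N w) := by
      refine norm_integral_le_of_norm_le ?_ (hΨM.mono fun z hz => ?_)
      · exact (continuous_const.mul hηc).continuousOn.integrableOn_compact hK
      · rw [norm_mul, Real.norm_of_nonneg ((h N).nonneg _)]
        exact mul_le_mul_of_nonneg_right hz ((h N).nonneg _)
    have hone : ∫ z in K, η N (z - F N w) = 1 := by
      have := (h N).setIntegral_sub_eq (hw N) fun _ => 1
      simpa [(h N).integral_eq_one] using this
    rwa [integral_const_mul, hone, mul_one] at h2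
  · filter_upwards [hFK, hF', hFF] with w hw hw' hw''
    exact (IsMollifier.tendsto_setIntegral_sub h hδ hK hΨ hw' hw'' hw).mul_const _

theorem integral_comp_shrink (c : V) {e : ℝ} (G : V → ℝ) :
    ∫ x, G (shrink c e x) = |((1 - e) ^ Module.finrank ℝ V)⁻¹| * ∫ x, G x := by
  have h1 := Measure.integral_comp_smul volume (fun v => G (v + (c - (1 - e) • c))) (1 - e)
  rw [integral_add_right_eq_self (fun v => G v)] at h1
  rw [smul_eq_mul] at h1
  rw [← h1]
  refine integral_congr_ae (ae_of_all _ fun x => ?_)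
  simp only [shrink, smul_sub]
  congr 1
  abel

/-- A change of variables that exhibits the smeared function as an average of values of f, up to the
Jacobian factor. -/
theorem smear_shrink_eq {η : V → ℝ} (c : V) {e : ℝ} (he : e < 1) (f : V → ℝ) (y : V) :
    smear volume η (shrink c e) f y =
      ((1 - e) ^ Module.finrank ℝ V)⁻¹ * ∫ ζ, η ζ * f (c + (1 - e)⁻¹ • (y - ζ - c)) := by
  have he' : 1 - e ≠ 0 := by linarith
  have h1 := integral_comp_shrink c (e := e)
    fun v => η (y - v) * f (c + (1 - e)⁻¹ • (v - c))
  rw [abs_of_nonneg (inv_nonneg.2 (pow_nonneg (by linarith) _))] at h1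
  have h2 := integral_sub_left_eq_self (fun ζ => η ζ * f (c + (1 - e)⁻¹ • (y - ζ - c))) volume y
  simp only [sub_sub_cancel] at h2
  rw [← h2, ← h1]
  refine integral_congr_ae (ae_of_all _ fun x => ?_)
  simp only [shrink, add_sub_cancel_left, smul_smul, inv_mul_cancel₀ he', one_smul,
    add_sub_cancel]

/-- Dominated convergence: the smeared functions are uniformly bounded and supported in a common
ball, and they converge pointwise by continuity of f. -/
theorem tendsto_integral_abs_smear_sub_of_continuous {η : ℕ → V → ℝ} {δ e : ℕ → ℝ}
    (h : ∀ N, IsMollifier (η N) (δ N)) (hδ : Tendsto δ atTop (𝓝 0)) (hδ1 : ∀ N, δ N ≤ 1) (c : V)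
    (he : Tendsto e atTop (𝓝 0)) (he0 : ∀ N, 0 ≤ e N) (he1 : ∀ N, e N ≤ 1 / 2) {f : V → ℝ}
    (hf : Continuous f) (hfc : HasCompactSupport f) :
    Tendsto (fun N => ∫ y, |smear volume (η N) (shrink c (e N)) f y - f y|) atTop (𝓝 0) := by
  set d := Module.finrank ℝ V with hd
  obtain ⟨M, hM⟩ := hf.bounded_above_of_compact_support hfc
  obtain ⟨R, hR⟩ := hfc.isCompact.isBounded.exists_norm_le
  have hM0 : 0 ≤ M := (norm_nonneg _).trans (hM 0)
  have hfi : Integrable f volume := hf.integrable_of_hasCompactSupport hfc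
  have hpow : ∀ N, 0 < (1 - e N) ^ d := fun N => pow_pos (by linarith [he1 N]) _
  have hpow2 : ∀ N, ((1 - e N) ^ d)⁻¹ ≤ 2 ^ d := fun N => by
    rw [← inv_pow]
    refine pow_le_pow_left₀ (inv_nonneg.2 (by linarith [he1 N])) ?_ _
    rw [inv_le_comm₀ (by linarith [he1 N]) (by norm_num)]
    linarith [he1 N]
  have hint : ∀ N y, Integrable (fun ζ => η N ζ * f (c + (1 - e N)⁻¹ • (y - ζ - c))) volume := by
    intro N y
    refine (h N).integrable.mul_bdd (c := M) ?_ (ae_of_all _ fun ζ => hM _)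
    exact (hf.comp (by fun_prop)).aestronglyMeasurable
  have hbound : ∀ N y, |∫ ζ, η N ζ * f (c + (1 - e N)⁻¹ • (y - ζ - c))| ≤ M := by
    intro N y
    have := norm_integral_le_of_norm_le (f := fun ζ => η N ζ * f (c + (1 - e N)⁻¹ • (y - ζ - c)))
      (g := fun ζ => η N ζ * M) ((h N).integrable.mul_const M) (ae_of_all _ fun ζ => by
        rw [norm_mul, Real.norm_of_nonneg ((h N).nonneg _)]
        exact mul_le_mul_of_nonneg_left (hM _) ((h N).nonneg _))
    rwa [integral_mul_const, (h N).integral_eq_one, one_mul] at this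
  -- A point c + (1 - e) (v - c) + ζ with ‖v‖ ≤ R and ‖ζ‖ < 1 has norm at most R + 2 ‖c‖ + 1.
  set B := Metric.closedBall (0 : V) (|R| + 2 * ‖c‖ + 1) with hB
  have hfB : ∀ y, y ∉ B → f y = 0 := by
    intro y hy
    by_contra hne
    have := hR y (subset_tsupport _ hne)
    refine hy (mem_closedBall_zero_iff.2 (this.trans ?_))
    linarith [le_abs_self R, norm_nonneg c]
  have hSB : ∀ N y, y ∉ B → smear volume (η N) (shrink c (e N)) f y = 0 := by
    intro N y hy
    rw [smear_shrink_eq c (by linarith [he1 N])]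
    refine mul_eq_zero_of_right _ (integral_eq_zero_of_ae (ae_of_all _ fun ζ => ?_))
    by_contra hne
    have h1 := (h N).norm_lt ζ (left_ne_zero_of_mul hne)
    have h2 := hR _ (subset_tsupport _ (right_ne_zero_of_mul hne))
    refine hy (mem_closedBall_zero_iff.2 ?_)
    set v := c + (1 - e N)⁻¹ • (y - ζ - c) with hv
    have h3 : y = c + (1 - e N) • (v - c) + ζ := by
      rw [hv, add_sub_cancel_left, smul_smul, mul_inv_cancel₀ (by linarith [he1 N]), one_smul]
      abel
    have h4 : ‖(1 - e N) • (v - c)‖ ≤ ‖v‖ + ‖c‖ := by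
      rw [norm_smul, Real.norm_of_nonneg (by linarith [he1 N])]
      calc _ ≤ 1 * ‖v - c‖ := by gcongr; linarith [he0 N]
        _ ≤ _ := by rw [one_mul]; exact norm_sub_le _ _
    rw [h3]
    refine (norm_add_le _ _).trans ?_
    have := norm_add_le c ((1 - e N) • (v - c))
    linarith [le_abs_self R, hδ1 N]
  have hlim : Tendsto (fun N => ∫ y, |smear volume (η N) (shrink c (e N)) f y - f y|) atTop
      (𝓝 (∫ _ : V, (0 : ℝ))) := by
    refine tendsto_integral_of_dominated_convergence (B.indicator fun _ => 2 ^ d * M + M)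
      (fun N => ?_) ?_ (fun N => ae_of_all _ fun y => ?_) (ae_of_all _ fun y => ?_)
    · exact (((contDiff_smear (h N) (continuous_shrink _ _).measurable hfi).continuous.sub
        hf).abs).aestronglyMeasurable
    · exact (integrable_indicator_iff Metric.isClosed_closedBall.measurableSet).2
        (integrableOn_const (isCompact_closedBall _ _).measure_lt_top.ne)
    · by_cases hy : y ∈ B
      · rw [Set.indicator_of_mem hy, Real.norm_eq_abs, abs_abs]
        refine (abs_sub _ _).trans (add_le_add ?_ (hM y))
        rw [smear_shrink_eq c (by linarith [he1 N]), abs_mul, abs_of_pos (inv_pos.2 (hpow N))]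
        exact mul_le_mul (hpow2 N) (hbound N y) (abs_nonneg _) (by positivity)
      · simp [hfB y hy, hSB N y hy, Set.indicator_of_notMem hy]
    · have hI : Tendsto (fun N => ∫ ζ, η N ζ * f (c + (1 - e N)⁻¹ • (y - ζ - c))) atTop
          (𝓝 (f y)) := by
        rw [Metric.tendsto_atTop]
        intro ε hε
        obtain ⟨τ, hτ, hτf⟩ := Metric.continuousAt_iff.1 (hf.continuousAt (x := y)) (ε / 2)
          (by linarith)
        -- This quantity bounds the distance from y to the point where f is evaluated; the factor 2
        -- comes from (1 - e)⁻¹ ≤ 2.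
        have h1 : Tendsto (fun N => |(1 - e N)⁻¹ - 1| * ‖y - c‖ + 2 * δ N) atTop
            (𝓝 (|(1 - 0 : ℝ)⁻¹ - 1| * ‖y - c‖ + 2 * 0)) :=
          (((((tendsto_const_nhds.sub he).inv₀ (by norm_num)).sub_const 1).abs).mul_const _).add
            (hδ.const_mul 2)
        simp only [sub_zero, inv_one, sub_self, abs_zero, zero_mul, mul_zero, add_zero] at h1
        obtain ⟨N₀, hN₀⟩ := eventually_atTop.1 (h1.eventually_lt_const hτ)
        refine ⟨N₀, fun N hN => ?_⟩
        have e1 : (∫ ζ, η N ζ * f (c + (1 - e N)⁻¹ • (y - ζ - c))) - f y =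
            ∫ ζ, (η N ζ * f (c + (1 - e N)⁻¹ • (y - ζ - c)) - η N ζ * f y) := by
          rw [integral_sub (hint N y) ((h N).integrable.mul_const _), integral_mul_const,
            (h N).integral_eq_one, one_mul]
        rw [Real.dist_eq, e1]
        have h2 := norm_integral_le_of_norm_le
          (f := fun ζ => η N ζ * f (c + (1 - e N)⁻¹ • (y - ζ - c)) - η N ζ * f y)
          (g := fun ζ => η N ζ * (ε / 2)) ((h N).integrable.mul_const _) (ae_of_all _ fun ζ => by
            rw [← mul_sub, norm_mul, Real.norm_of_nonneg ((h N).nonneg _)]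
            rcases eq_or_ne (η N ζ) 0 with h0 | h0
            · simp [h0]
            refine mul_le_mul_of_nonneg_left ?_ ((h N).nonneg _)
            have h3 := (h N).norm_lt ζ h0
            refine (hτf ?_).le
            refine lt_of_le_of_lt ?_ (hN₀ N hN)
            have h5 : c + (1 - e N)⁻¹ • (y - ζ - c) - y =
                ((1 - e N)⁻¹ - 1) • (y - c) - (1 - e N)⁻¹ • ζ := by
              simp only [smul_sub, sub_smul, one_smul]
              abel
            rw [dist_eq_norm, h5]
            refine (norm_sub_le _ _).trans (add_le_add (by rw [norm_smul, Real.norm_eq_abs]) ?_)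
            rw [norm_smul, Real.norm_of_nonneg (inv_nonneg.2 (by linarith [he1 N]))]
            refine mul_le_mul ?_ h3.le (norm_nonneg _) (by norm_num)
            rw [inv_le_comm₀ (by linarith [he1 N]) (by norm_num)]
            linarith [he1 N])
        rw [integral_mul_const, (h N).integral_eq_one, one_mul, Real.norm_eq_abs] at h2
        linarith
      have hp : Tendsto (fun N => ((1 - e N) ^ d)⁻¹) atTop (𝓝 ((1 - 0 : ℝ) ^ d)⁻¹) :=
        ((tendsto_const_nhds.sub he).pow d).inv₀ (by norm_num)
      have h6 := ((hp.mul hI).sub_const (f y)).abs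
      simp only [sub_zero, one_pow, inv_one, one_mul, sub_self, abs_zero] at h6
      refine h6.congr fun N => ?_
      rw [smear_shrink_eq c (by linarith [he1 N])]
  simpa using hlim

/-- Approximation of an integrable density in `L¹`. -/
theorem tendsto_integral_abs_smear_sub {η : ℕ → V → ℝ} {δ e : ℕ → ℝ}
    (h : ∀ N, IsMollifier (η N) (δ N)) (hδ : Tendsto δ atTop (𝓝 0)) (hδ1 : ∀ N, δ N ≤ 1) (c : V)
    (he : Tendsto e atTop (𝓝 0)) (he0 : ∀ N, 0 ≤ e N) (he1 : ∀ N, e N ≤ 1 / 2) {g : V → ℝ}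
    (hg : Integrable g volume) :
    Tendsto (fun N => ∫ y, |smear volume (η N) (shrink c (e N)) g y - g y|) atTop (𝓝 0) := by
  rw [Metric.tendsto_atTop]
  intro ε hε
  -- Smearing is a contraction in L¹, so replacing g by f costs ε/4 before and ε/4 after smearing;
  -- the continuous case provides the third ε/4.
  obtain ⟨f, hfc, hfg, hf, hfi⟩ := hg.exists_hasCompactSupport_integral_sub_le
    (ε := ε / 4) (by linarith)
  obtain ⟨N₀, hN₀⟩ := eventually_atTop.1
    ((tendsto_integral_abs_smear_sub_of_continuous h hδ hδ1 c he he0 he1 hf hfc).eventually_lt_const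
      (show (0 : ℝ) < ε / 4 by linarith))
  refine ⟨N₀, fun N hN => ?_⟩
  have hF : Measurable (shrink c (e N)) := (continuous_shrink _ _).measurable
  have hS : ∀ {v : V → ℝ}, Integrable v volume →
      Integrable (smear volume (η N) (shrink c (e N)) v) volume := fun hv => by
    simpa using integrable_smear (h N) hF Set.univ hv
  have h1 : ∫ y, |smear volume (η N) (shrink c (e N)) (fun y => g y - f y) y| ≤ ε / 4 := by
    have := integral_abs_smear_le (h N) hF Set.univ (hg.sub hfi)
    simp only [Measure.restrict_univ] at this
    exact this.trans hfg
  have h2 := hN₀ N hN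
  rw [Real.dist_eq, sub_zero, abs_of_nonneg (integral_nonneg fun _ => abs_nonneg _)]
  have h3 : ∫ y, |smear volume (η N) (shrink c (e N)) g y - g y| ≤
      ∫ y, (|smear volume (η N) (shrink c (e N)) (fun y => g y - f y) y| +
        |smear volume (η N) (shrink c (e N)) f y - f y| + |g y - f y|) := by
    refine integral_mono ((hS hg).sub hg).abs
      (((hS (hg.sub hfi)).abs.add ((hS hfi).sub hfi).abs).add (hg.sub hfi).abs) fun y => ?_
    have e1 := smear_add (h N) hF (u := fun y => g y - f y) (hg.sub hfi) hfi y
    simp only [sub_add_cancel] at e1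
    simp only
    rw [e1]
    have := abs_add_three (smear volume (η N) (shrink c (e N)) (fun y => g y - f y) y)
      (smear volume (η N) (shrink c (e N)) f y - f y) (f y - g y)
    rw [abs_sub_comm (f y)] at this
    refine le_trans (le_of_eq ?_) this
    congr 1
    ring
  have h4 : ∫ y, (|smear volume (η N) (shrink c (e N)) (fun y => g y - f y) y| +
        |smear volume (η N) (shrink c (e N)) f y - f y| + |g y - f y|) =
      (∫ y, |smear volume (η N) (shrink c (e N)) (fun y => g y - f y) y|) +
        (∫ y, |smear volume (η N) (shrink c (e N)) f y - f y|) + ∫ y, |g y - f y| := by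
    have i1 : Integrable
        (fun y => |smear volume (η N) (shrink c (e N)) (fun y => g y - f y) y|) volume :=
      (hS (hg.sub hfi)).abs
    have i2 : Integrable (fun y => |smear volume (η N) (shrink c (e N)) f y - f y|) volume :=
      ((hS hfi).sub hfi).abs
    have i3 : Integrable (fun y => |g y - f y|) volume := (hg.sub hfi).abs
    rw [← integral_add i1 i2, ← integral_add _ i3]
    exact i1.add i2
  simp only [Real.norm_eq_abs] at hfg
  linarith

end Contraction

/-! ### Existence of mollifiers and their products -/

section Existence

variable {V : Type*} [NormedAddCommGroup V] [NormedSpace ℝ V] [MeasureSpace V] [BorelSpace V]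
  [FiniteDimensional ℝ V] [(volume : Measure V).IsAddHaarMeasure]

theorem isMollifier_normed (f : ContDiffBump (0 : V)) :
    IsMollifier (f.normed volume) f.rOut where
  contDiff := f.contDiff_normed
  hasCompactSupport := f.hasCompactSupport_normed
  nonneg := f.nonneg_normed
  integral_eq_one := f.integral_normed
  norm_lt z hz := by
    have : z ∈ Function.support (f.normed volume) := hz
    rw [f.support_normed_eq] at this
    simpa using this

theorem exists_isMollifier {δ : ℝ} (hδ : 0 < δ) : ∃ η : V → ℝ, IsMollifier η δ :=
  ⟨_, isMollifier_normed (⟨δ / 2, δ, by linarith, by linarith⟩ : ContDiffBump (0 : V))⟩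

/-- The supremum bound on the time kernel is what later allows a term independent of time to
dominate the smeared trace. -/
theorem exists_isMollifier_real {δ : ℝ} (hδ : 0 < δ) :
    ∃ η : ℝ → ℝ, IsMollifier η δ ∧ ∀ t, η t ≤ δ⁻¹ := by
  -- The inner ball has radius δ/2, hence length δ, and the normalized bump is at most the inverse
  -- of that length.
  let f : ContDiffBump (0 : ℝ) := ⟨δ / 2, δ, by linarith, by linarith⟩
  refine ⟨_, isMollifier_normed f, fun t => ?_⟩
  refine (f.normed_le_div_measure_closedBall_rIn volume t).trans (le_of_eq ?_)
  rw [one_div, Measure.real, Real.volume_closedBall, ENNReal.toReal_ofReal (by simp [f]; linarith)]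
  simp only [f]
  congr 1
  ring

instance {E E' : Type*} [NormedAddCommGroup E] [NormedSpace ℝ E] [MeasureSpace E] [BorelSpace E]
    [FiniteDimensional ℝ E] [(volume : Measure E).IsAddHaarMeasure] [NormedAddCommGroup E']
    [NormedSpace ℝ E'] [MeasureSpace E'] [BorelSpace E'] [FiniteDimensional ℝ E']
    [(volume : Measure E').IsAddHaarMeasure] :
    (volume : Measure (E × E')).IsAddHaarMeasure :=
  inferInstanceAs ((volume : Measure E).prod (volume : Measure E')).IsAddHaarMeasure

/-- The product space carries the maximum norm, so the radius is unchanged. -/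
theorem IsMollifier.prod {E : Type*} [NormedAddCommGroup E] [NormedSpace ℝ E] [MeasureSpace E]
    [BorelSpace E] [FiniteDimensional ℝ E] [(volume : Measure E).IsAddHaarMeasure]
    {ψ : E → ℝ} {φ : V → ℝ} {δ : ℝ} (hψ : IsMollifier ψ δ) (hφ : IsMollifier φ δ) :
    IsMollifier (fun z : E × V => ψ z.1 * φ z.2) δ where
  contDiff := (hψ.contDiff.comp contDiff_fst).mul (hφ.contDiff.comp contDiff_snd)
  hasCompactSupport := by
    refine HasCompactSupport.of_support_subset_isCompact
      (isCompact_closedBall (0 : E × V) δ) fun z hz => ?_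
    have h1 := hψ.norm_lt _ (left_ne_zero_of_mul hz)
    have h2 := hφ.norm_lt _ (right_ne_zero_of_mul hz)
    rw [mem_closedBall_zero_iff]
    exact max_le h1.le h2.le
  nonneg z := mul_nonneg (hψ.nonneg _) (hφ.nonneg _)
  integral_eq_one := by
    have := integral_prod_mul (μ := (volume : Measure E)) (ν := (volume : Measure V)) ψ φ
    rw [hψ.integral_eq_one, hφ.integral_eq_one, one_mul] at this
    exact this
  norm_lt z hz := max_lt (hψ.norm_lt _ (left_ne_zero_of_mul hz))
    (hφ.norm_lt _ (right_ne_zero_of_mul hz))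

end Existence

/-! ### Measures defined by densities -/

section Densities

variable {X : Type*} [MeasurableSpace X] {n p m k : ℕ}

/-- The measure with a given density. -/
def MatrixMeasure.ofDensity (ν : Measure X) (g : X → Matrix (Fin p) (Fin m) ℝ) :
    MatrixMeasure X p m :=
  Matrix.of fun i j => ν.withDensityᵥ fun x => g x i j

theorem MatrixMeasure.hasDensity_ofDensity {ν : Measure X} {g : X → Matrix (Fin p) (Fin m) ℝ}
    (hg : ∀ i j, Integrable (fun x => g x i j) ν) : (ofDensity ν g).HasDensity ν g :=
  fun i j => ⟨hg i j, rfl⟩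

theorem MatrixMeasure.HasDensity.isSymm_value {μ : MatrixMeasure X n n} {ν : Measure X}
    {g : X → Matrix (Fin n) (Fin n) ℝ} (h : μ.HasDensity ν g) (hg : ∀ᵐ x ∂ν, (g x).IsSymm)
    {E : Set X} (hE : MeasurableSet E) : (μ.value E).IsSymm := by
  rw [h.value_eq hE]
  ext i j
  exact integral_congr_ae (ae_restrict_of_ae (hg.mono fun x hx => hx.apply i j))

end Densities

/-! ### Integration by parts in time -/

section TimeIntegration

variable {d : ℕ}

theorem volume_restrict_timeSpace (Ω : Set (Space d)) :
    (volume : Measure (ℝ × Space d)).restrict (timeSpace Ω) =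
      (volume.restrict (Set.Icc (0 : ℝ) 1)).prod (volume.restrict Ω) := by
  rw [Measure.prod_restrict]; rfl

theorem isCompact_timeSpace {Ω : Set (Space d)} (hΩ : IsCompact Ω) : IsCompact (timeSpace Ω) :=
  isCompact_Icc.prod hΩ

theorem integral_deriv_mul_Icc {f χ χ' : ℝ → ℝ} (hf : ContDiff ℝ 1 f)
    (hχ : ∀ t, HasDerivAt χ (χ' t) t) (hχ' : Continuous χ') :
    ∫ t in Set.Icc (0 : ℝ) 1, deriv f t * χ t =
      f 1 * χ 1 - f 0 * χ 0 - ∫ t in Set.Icc (0 : ℝ) 1, f t * χ' t := by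
  have h1 := intervalIntegral.integral_deriv_mul_eq_sub (a := 0) (b := 1) (u := f) (v := χ)
    (u' := deriv f) (v' := χ')
    (fun t _ => (hf.differentiable (by norm_num)).differentiableAt.hasDerivAt) (fun t _ => hχ t)
    ((hf.continuous_deriv le_rfl).intervalIntegrable _ _) (hχ'.intervalIntegrable _ _)
  have hχc : Continuous χ := continuous_iff_continuousAt.2 fun t => (hχ t).continuousAt
  have i1 : IntervalIntegrable (fun t => deriv f t * χ t) volume 0 1 :=
    ((hf.continuous_deriv le_rfl).mul hχc).intervalIntegrable _ _
  have i2 : IntervalIntegrable (fun t => f t * χ' t) volume 0 1 :=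
    (hf.continuous.mul hχ').intervalIntegrable _ _
  rw [intervalIntegral.integral_add i1 i2,
    intervalIntegral.integral_of_le zero_le_one, intervalIntegral.integral_of_le zero_le_one,
    ← integral_Icc_eq_integral_Ioc, ← integral_Icc_eq_integral_Ioc] at h1
  linarith

theorem integral_add₃ {α : Type*} [MeasurableSpace α] {ν : Measure α} {f g h : α → ℝ}
    (hf : Integrable f ν) (hg : Integrable g ν) (hh : Integrable h ν) :
    ∫ x, (f x + g x + h x) ∂ν = ∫ x, f x ∂ν + ∫ x, g x ∂ν + ∫ x, h x ∂ν := by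
  have hfg : Integrable (fun x => f x + g x) ν := hf.add hg
  rw [integral_add hfg hh, integral_add hf hg]

theorem contDiff_slice {Φ : ℝ × Space d → ℝ} {r : WithTop ℕ∞} (hΦ : ContDiff ℝ r Φ)
    (y : Space d) : ContDiff ℝ r fun t => Φ (t, y) :=
  hΦ.comp (contDiff_id.prodMk contDiff_const)

/-- Expressing the partial derivative through `fderiv` makes its joint continuity in (t, x)
available. -/
theorem deriv_slice {Φ : ℝ × Space d → ℝ} (hΦ : ContDiff ℝ 1 Φ) (z : ℝ × Space d) :
    deriv (fun s => Φ (s, z.2)) z.1 = fderiv ℝ Φ z (1, 0) := by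
  have h1 : HasFDerivAt Φ (fderiv ℝ Φ z) (z.1, z.2) :=
    (hΦ.differentiable (by norm_num)).differentiableAt.hasFDerivAt
  exact (h1.comp_hasDerivAt z.1 ((hasDerivAt_id z.1).prodMk (hasDerivAt_const z.1 z.2))).deriv

theorem lineDeriv_slice {Φ : ℝ × Space d → ℝ} (hΦ : ContDiff ℝ 1 Φ) (z : ℝ × Space d)
    (v : Space d) : lineDeriv ℝ (fun y => Φ (z.1, y)) z.2 v = fderiv ℝ Φ z (0, v) := by
  have h1 : HasFDerivAt Φ (fderiv ℝ Φ z) (z.1, z.2) :=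
    (hΦ.differentiable (by norm_num)).differentiableAt.hasFDerivAt
  have h2 := h1.comp z.2 ((hasFDerivAt_const z.1 z.2).prodMk (hasFDerivAt_id z.2))
  have h3 := (h2.hasLineDerivAt v).lineDeriv
  simpa [Function.comp_def] using h3

theorem continuous_deriv_slice {Φ : ℝ × Space d → ℝ} (hΦ : ContDiff ℝ 1 Φ) :
    Continuous fun z : ℝ × Space d => deriv (fun s => Φ (s, z.2)) z.1 := by
  simp only [deriv_slice hΦ]
  exact (hΦ.continuous_fderiv (by norm_num)).clm_apply continuous_const

theorem integrable_mul_prod_mul {Ω : Set (Space d)} (hΩ : IsCompact Ω) {f : ℝ × Space d → ℝ}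
    (hf : Continuous f) {χ : ℝ → ℝ} (hχ : Continuous χ) {s : Space d → ℝ}
    (hs : Integrable s (volume.restrict Ω)) :
    Integrable (fun z : ℝ × Space d => f z * (χ z.1 * s z.2))
      (volume.restrict (timeSpace Ω)) := by
  have hQ := isCompact_timeSpace hΩ
  obtain ⟨M, hM⟩ := hQ.exists_bound_of_continuousOn
    (hf.mul (hχ.comp continuous_fst)).continuousOn
  have h1 : Integrable (fun z : ℝ × Space d => s z.2) (volume.restrict (timeSpace Ω)) := by
    rw [volume_restrict_timeSpace]
    exact hs.comp_snd _
  refine (h1.bdd_mul (hf.mul (hχ.comp continuous_fst)).aestronglyMeasurable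
    ((ae_restrict_iff' hQ.measurableSet).2 (ae_of_all _ hM))).congr (ae_of_all _ fun z => ?_)
  simp only [Pi.mul_apply, Function.comp_apply]
  ring

/-- Integration by parts in time against a density of the form `χ(t) s(x)`. -/
theorem integral_timeDeriv_mul {Ω : Set (Space d)} (hΩ : IsCompact Ω) {Φ : ℝ × Space d → ℝ}
    (hΦ : ContDiff ℝ 1 Φ) {χ χ' : ℝ → ℝ} (hχ : ∀ t, HasDerivAt χ (χ' t) t)
    (hχ' : Continuous χ') {s : Space d → ℝ} (hs : Integrable s (volume.restrict Ω)) :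
    (∫ z in timeSpace Ω, deriv (fun τ => Φ (τ, z.2)) z.1 * (χ z.1 * s z.2)) +
        ∫ z in timeSpace Ω, Φ z * (χ' z.1 * s z.2) =
      χ 1 * (∫ y in Ω, Φ (1, y) * s y) - χ 0 * ∫ y in Ω, Φ (0, y) * s y := by
  have hχc : Continuous χ := continuous_iff_continuousAt.2 fun t => (hχ t).continuousAt
  have i1 := integrable_mul_prod_mul hΩ (continuous_deriv_slice hΦ) hχc hs
  have i2 := integrable_mul_prod_mul hΩ hΦ.continuous hχ' hs
  have i3 : ∀ t : ℝ, Integrable (fun y => Φ (t, y) * s y) (volume.restrict Ω) := by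
    intro t
    have hc : Continuous fun y => Φ (t, y) := hΦ.continuous.comp (by fun_prop)
    obtain ⟨M, hM⟩ := hΩ.exists_bound_of_continuousOn hc.continuousOn
    exact hs.bdd_mul hc.aestronglyMeasurable
      ((ae_restrict_iff' hΩ.measurableSet).2 (ae_of_all _ hM))
  rw [volume_restrict_timeSpace] at i1 i2 ⊢
  rw [integral_prod_symm _ i1, integral_prod_symm _ i2,
    ← integral_add i1.integral_prod_right i2.integral_prod_right, ← integral_const_mul,
    ← integral_const_mul, ← integral_sub ((i3 1).const_mul _) ((i3 0).const_mul _)]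
  refine integral_congr_ae (ae_of_all _ fun y => ?_)
  simp only [← mul_assoc]
  rw [integral_mul_const, integral_mul_const,
    integral_deriv_mul_Icc (contDiff_slice hΦ y) hχ hχ']
  ring

end TimeIntegration

/-! ### Bound of the distance by the L¹ distance of the densities -/

section Hellinger

variable {d n k : ℕ}

theorem MatrixMeasure.HasDensity.pairing_eq_of_continuous {E : Type*} [TopologicalSpace E]
    [MeasurableSpace E] [OpensMeasurableSpace E] {p m : ℕ} {μ : MatrixMeasure E p m}
    {ν : Measure E} {K : Set E} (hK : IsCompact K) (hKm : MeasurableSet K)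
    {g Φ : E → Matrix (Fin p) (Fin m) ℝ} (h : μ.HasDensity (ν.restrict K) g)
    (hΦ : ∀ i j, Continuous fun x => Φ x i j) :
    μ.pairing Φ = ∑ i, ∑ j, ∫ x in K, Φ x i j * g x i j ∂ν :=
  h.pairing_eq (fun i j => (hΦ i j).measurable.aestronglyMeasurable) fun i j => by
    obtain ⟨M, hM⟩ := hK.exists_bound_of_continuousOn (hΦ i j).continuousOn
    exact ⟨M, (ae_restrict_iff' hKm).2 (ae_of_all _ hM)⟩

theorem lintegral_timeSpace_snd {Ω : Set (Space d)} {f : Space d → ℝ≥0∞}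
    (hf : AEMeasurable f (volume.restrict Ω)) :
    ∫⁻ z in timeSpace Ω, f z.2 = ∫⁻ y in Ω, f y := by
  rw [volume_restrict_timeSpace, lintegral_prod_symm _ hf.comp_snd]
  simp

/-- Two absolutely continuous measures are connected by a curve whose action is controlled by the
total variation of their difference. -/
theorem exists_wbDist_le (Λ₁ : Matrix (Fin k) (Fin k) ℝ) (h₁ : Λ₁.IsSymm)
    (Λ₂ : Matrix (Fin n) (Fin n) ℝ) (h₂ : Λ₂.PosDef) (D : DiffOp d n k) {Ω : Set (Space d)}
    (hΩ : IsCompact Ω) :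
    ∃ C : ℝ, 0 ≤ C ∧ ∀ (G₀ G₁ : MatrixMeasure (Space d) n n)
      (g₀ g₁ : Space d → Matrix (Fin n) (Fin n) ℝ),
      G₀.HasDensity (volume.restrict Ω) g₀ → G₁.HasDensity (volume.restrict Ω) g₁ →
      (∀ᵐ x ∂volume.restrict Ω, (g₀ x).PosSemidef) →
      (∀ᵐ x ∂volume.restrict Ω, (g₁ x).PosSemidef) →
      wbDist Λ₁ Λ₂ D Ω G₀ G₁ ≤
        ENNReal.ofReal (C * ∑ i, ∑ j, ∫ x in Ω, |g₁ x i j - g₀ x i j|) ^ (1 / 2 : ℝ) := by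
  obtain ⟨C, hC, hCle⟩ := exists_costDensity_le (k := k) h₁ h₂
  -- 80 = 2 · 36 + 2 · 4, from θ'² = 36 β and β'² ≤ 4 β on [0,1].
  refine ⟨C * 80, by positivity, fun G₀ G₁ g₀ g₁ hG₀ hG₁ hp₀ hp₁ => ?_⟩
  have hQ := isCompact_timeSpace hΩ
  have hQm := hQ.measurableSet
  set h : Space d → ℝ := fun x => ∑ i, ∑ j, |g₁ x i j - g₀ x i j| with hh
  have hdi : ∀ i j, Integrable (fun x => g₁ x i j - g₀ x i j) (volume.restrict Ω) :=
    fun i j => (hG₁ i j).1.sub (hG₀ i j).1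
  have hhi : Integrable h (volume.restrict Ω) :=
    integrable_finsetSum _ fun i _ => integrable_finsetSum _ fun j _ => (hdi i j).abs
  have hh0 : ∀ x, 0 ≤ h x := fun x =>
    Finset.sum_nonneg fun i _ => Finset.sum_nonneg fun j _ => abs_nonneg _
  have hle : ∀ x i j, |g₁ x i j - g₀ x i j| ≤ h x := fun x i j => by
    refine le_trans ?_ (Finset.single_le_sum (f := fun i => ∑ j, |g₁ x i j - g₀ x i j|)
      (fun i _ => Finset.sum_nonneg fun j _ => abs_nonneg _) (Finset.mem_univ i))
    exact Finset.single_le_sum (f := fun j => |g₁ x i j - g₀ x i j|)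
      (fun j _ => abs_nonneg _) (Finset.mem_univ j)
  -- The curve is (1 - θ) g₀ + θ g₁ + β h I with zero flux, its time derivative being the reaction.
  -- The step θ goes from 0 to 1, and β = t² (1 - t)² vanishes at both ends, precisely at the rate
  -- of θ'². Thus the elliptic part β h I pays for the reaction up to the endpoints.
  set θ : ℝ → ℝ := fun t => 3 * t ^ 2 - 2 * t ^ 3 with hθ
  set θ' : ℝ → ℝ := fun t => 6 * t - 6 * t ^ 2 with hθ'
  set β : ℝ → ℝ := fun t => t ^ 2 - 2 * t ^ 3 + t ^ 4 with hβ
  set β' : ℝ → ℝ := fun t => 2 * t - 6 * t ^ 2 + 4 * t ^ 3 with hβ'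
  have hθd : ∀ t, HasDerivAt θ (θ' t) t := fun t => by
    have := ((hasDerivAt_pow 2 t).const_mul 3).sub ((hasDerivAt_pow 3 t).const_mul 2)
    refine HasDerivAt.congr_deriv (f := θ) this ?_
    simp only [hθ', Nat.cast_ofNat, Nat.add_one_sub_one]
    ring
  have hβd : ∀ t, HasDerivAt β (β' t) t := fun t => by
    have := ((hasDerivAt_pow 2 t).sub ((hasDerivAt_pow 3 t).const_mul 2)).add (hasDerivAt_pow 4 t)
    refine HasDerivAt.congr_deriv (f := β) this ?_
    simp only [hβ', Nat.cast_ofNat, Nat.add_one_sub_one]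
    ring
  have hθc : Continuous θ' := by simp only [hθ']; fun_prop
  have hβc : Continuous β' := by simp only [hβ']; fun_prop
  have hθcc : Continuous θ := by simp only [hθ]; fun_prop
  have hβcc : Continuous β := by simp only [hβ]; fun_prop
  set hI : Fin n → Fin n → Space d → ℝ := fun i j x =>
    h x * (1 : Matrix (Fin n) (Fin n) ℝ) i j with hhI
  have hIi : ∀ i j, Integrable (hI i j) (volume.restrict Ω) := fun i j => hhi.mul_const _
  -- The factors 1 here and 0 in ρ give every summand the form χ(t) s(x) of
  -- `integral_timeDeriv_mul`.
  let g : ℝ × Space d → Matrix (Fin n) (Fin n) ℝ := fun z => Matrix.of fun i j =>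
    1 * g₀ z.2 i j + θ z.1 * (g₁ z.2 i j - g₀ z.2 i j) + β z.1 * hI i j z.2
  let ρ : ℝ × Space d → Matrix (Fin n) (Fin n) ℝ := fun z => Matrix.of fun i j =>
    0 * g₀ z.2 i j + θ' z.1 * (g₁ z.2 i j - g₀ z.2 i j) + β' z.1 * hI i j z.2
  have key : ∀ {f : ℝ × Space d → ℝ}, Continuous f → ∀ {χ : ℝ → ℝ}, Continuous χ →
      ∀ {s : Space d → ℝ}, Integrable s (volume.restrict Ω) →
      Integrable (fun z : ℝ × Space d => f z * (χ z.1 * s z.2))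
        (volume.restrict (timeSpace Ω)) := fun hf _ hχ _ hs => integrable_mul_prod_mul hΩ hf hχ hs
  have key1 : ∀ {χ : ℝ → ℝ}, Continuous χ → ∀ {s : Space d → ℝ},
      Integrable s (volume.restrict Ω) →
      Integrable (fun z : ℝ × Space d => χ z.1 * s z.2) (volume.restrict (timeSpace Ω)) :=
    fun {χ} hχ {s} hs => by simpa using key (f := fun _ => 1) continuous_const hχ hs
  have hgi : ∀ i j, Integrable (fun z => g z i j) (volume.restrict (timeSpace Ω)) := fun i j =>
    ((key1 (χ := fun _ => 1) continuous_const (hG₀ i j).1).add (key1 hθcc (hdi i j))).add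
      (key1 hβcc (hIi i j))
  have hρi : ∀ i j, Integrable (fun z => ρ z i j) (volume.restrict (timeSpace Ω)) := fun i j =>
    ((key1 (χ := fun _ => 0) continuous_const (hG₀ i j).1).add (key1 hθc (hdi i j))).add
      (key1 hβc (hIi i j))
  let μ : Triplet (ℝ × Space d) n k :=
    ⟨MatrixMeasure.ofDensity (volume.restrict (timeSpace Ω)) g,
      MatrixMeasure.ofDensity (volume.restrict (timeSpace Ω)) 0,
      MatrixMeasure.ofDensity (volume.restrict (timeSpace Ω)) ρ⟩
  have hμG : μ.G.HasDensity (volume.restrict (timeSpace Ω)) g :=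
    MatrixMeasure.hasDensity_ofDensity hgi
  have hμq : μ.q.HasDensity (volume.restrict (timeSpace Ω)) 0 :=
    MatrixMeasure.hasDensity_ofDensity fun i j => integrable_zero _ _ _
  have hμR : μ.R.HasDensity (volume.restrict (timeSpace Ω)) ρ :=
    MatrixMeasure.hasDensity_ofDensity hρi
  have hpos : ∀ᵐ z ∂volume.restrict (timeSpace Ω),
      (g₀ z.2).PosSemidef ∧ (g₁ z.2).PosSemidef := by
    rw [volume_restrict_timeSpace]
    exact Measure.quasiMeasurePreserving_snd.ae (hp₀.and hp₁)
  have hge : ∀ z, g z = (1 - θ z.1) • g₀ z.2 + θ z.1 • g₁ z.2 +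
      (β z.1 * h z.2) • (1 : Matrix (Fin n) (Fin n) ℝ) := fun z => by
    ext i j
    simp only [g, hhI, Matrix.of_apply, Matrix.add_apply, Matrix.smul_apply, smul_eq_mul]
    ring
  have hCE : μ ∈ continuityEq D Ω G₀ G₁ := by
    refine ⟨⟨hμG.isOn, hμq.isOn, hμR.isOn, fun E hE => hμG.isSymm_value ?_ hE⟩, ?_⟩
    · filter_upwards [hpos] with z hz
      rw [hge]
      exact (((PosSemidef.isSymm hz.1).smul _).add ((PosSemidef.isSymm hz.2).smul _)).add
        (Matrix.isSymm_one.smul _)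
    intro Φ hΦ _
    have e1 := hμG.pairing_eq_of_continuous hQ hQm (Φ := timeDeriv Φ)
      fun i j => continuous_deriv_slice (hΦ i j)
    have e2 : μ.q.pairing (fun z => D.apply (fun y => Φ (z.1, y)) z.2) = 0 := by
      refine Finset.sum_eq_zero fun i _ => Finset.sum_eq_zero fun j _ => ?_
      have : μ.q i j = 0 := by
        rw [(hμq i j).2]
        exact withDensityᵥ_zero
      rw [this, VectorMeasure.integral_zero_vectorMeasure]
    have e3 := hμR.pairing_eq_of_continuous hQ hQm (Φ := Φ) fun i j => (hΦ i j).continuous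
    have e4 := hG₁.pairing_eq_of_continuous hΩ hΩ.measurableSet (Φ := fun x => Φ (1, x))
      fun i j => (hΦ i j).continuous.comp (by fun_prop)
    have e5 := hG₀.pairing_eq_of_continuous hΩ hΩ.measurableSet (Φ := fun x => Φ (0, x))
      fun i j => (hΦ i j).continuous.comp (by fun_prop)
    rw [e1, e2, e3, e4, e5, add_zero, ← Finset.sum_add_distrib, ← Finset.sum_sub_distrib]
    refine Finset.sum_congr rfl fun i _ => ?_
    rw [← Finset.sum_add_distrib, ← Finset.sum_sub_distrib]
    refine Finset.sum_congr rfl fun j _ => ?_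
    have a0 := integral_timeDeriv_mul hΩ (hΦ i j) (χ := fun _ => 1) (χ' := fun _ => 0)
      (fun t => hasDerivAt_const t 1) continuous_const (hG₀ i j).1
    have a1 := integral_timeDeriv_mul hΩ (hΦ i j) hθd hθc (hdi i j)
    have a2 := integral_timeDeriv_mul hΩ (hΦ i j) hβd hβc (hIi i j)
    have hct := continuous_deriv_slice (hΦ i j)
    have hc := (hΦ i j).continuous
    have b1 : ∫ z in timeSpace Ω, timeDeriv Φ z i j * g z i j =
        (∫ z in timeSpace Ω, deriv (fun τ => Φ (τ, z.2) i j) z.1 * (1 * g₀ z.2 i j)) +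
        (∫ z in timeSpace Ω, deriv (fun τ => Φ (τ, z.2) i j) z.1 *
          (θ z.1 * (g₁ z.2 i j - g₀ z.2 i j))) +
        ∫ z in timeSpace Ω, deriv (fun τ => Φ (τ, z.2) i j) z.1 * (β z.1 * hI i j z.2) := by
      have i0 := key hct (χ := fun _ => 1) continuous_const (hG₀ i j).1
      have i1 := key hct hθcc (hdi i j)
      refine Eq.trans ?_ (integral_add₃ i0 i1 (key hct hβcc (hIi i j)))
      refine integral_congr_ae (ae_of_all _ fun z => ?_)
      simp only [g, timeDeriv, Matrix.of_apply]
      ring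
    have b2 : ∫ z in timeSpace Ω, Φ z i j * ρ z i j =
        (∫ z in timeSpace Ω, Φ z i j * (0 * g₀ z.2 i j)) +
        (∫ z in timeSpace Ω, Φ z i j * (θ' z.1 * (g₁ z.2 i j - g₀ z.2 i j))) +
        ∫ z in timeSpace Ω, Φ z i j * (β' z.1 * hI i j z.2) := by
      have i0 := key hc (χ := fun _ => 0) continuous_const (hG₀ i j).1
      have i1 := key hc hθc (hdi i j)
      refine Eq.trans ?_ (integral_add₃ i0 i1 (key hc hβc (hIi i j)))
      refine integral_congr_ae (ae_of_all _ fun z => ?_)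
      simp only [ρ, Matrix.of_apply]
      ring
    have b3 : ∫ y in Ω, Φ (1, y) i j * (g₁ y i j - g₀ y i j) =
        (∫ y in Ω, Φ (1, y) i j * g₁ y i j) - ∫ y in Ω, Φ (1, y) i j * g₀ y i j := by
      have hb : Continuous fun y => Φ (1, y) i j := hc.comp (by fun_prop)
      obtain ⟨M, hM⟩ := hΩ.exists_bound_of_continuousOn hb.continuousOn
      have hM' := (ae_restrict_iff' (μ := volume) hΩ.measurableSet).2 (ae_of_all _ hM)
      rw [← integral_sub ((hG₁ i j).1.bdd_mul hb.aestronglyMeasurable hM')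
        ((hG₀ i j).1.bdd_mul hb.aestronglyMeasurable hM')]
      simp only [mul_sub]
    have t1 : θ 1 = 1 := by norm_num [hθ]
    have t0 : θ 0 = 0 := by norm_num [hθ]
    have s1 : β 1 = 0 := by norm_num [hβ]
    have s0 : β 0 = 0 := by norm_num [hβ]
    rw [t1, t0, b3] at a1
    rw [s1, s0] at a2
    rw [b1, b2]
    linarith
  have hact : action Λ₁ Λ₂ (timeSpace Ω) μ ≤
      ENNReal.ofReal (C * 80 * ∑ i, ∑ j, ∫ x in Ω, |g₁ x i j - g₀ x i j|) := by
    rw [action_eq_of_hasDensity Λ₁ Λ₂ hQm hμG hμq hμR, Measure.restrict_restrict hQm,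
      Set.inter_self]
    have hpt : ∀ᵐ z ∂volume.restrict (timeSpace Ω), costDensity Λ₁ Λ₂ (g z)
        ((0 : ℝ × Space d → Matrix (Fin n) (Fin k) ℝ) z) (ρ z) ≤
        ENNReal.ofReal (C * (80 * h z.2)) := by
      filter_upwards [hpos, ae_restrict_mem hQm] with z hz hzQ
      have ht := hzQ.1
      have hβ0 : 0 ≤ β z.1 := by
        have : β z.1 = z.1 ^ 2 * (1 - z.1) ^ 2 := by simp only [hβ]; ring
        rw [this]; positivity
      -- With a = β h and b = 80 h the bound is linear in h and does not see β, so no singularity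
      -- appears at t = 0 and t = 1.
      refine hCle _ _ (β z.1 * h z.2) _ (mul_nonneg hβ0 (hh0 _))
        (mul_nonneg (by norm_num) (hh0 _)) ?_ fun i j => ?_
      · rw [hge, add_sub_cancel_right]
        refine (hz.1.smul ?_).add (hz.2.smul ?_)
        -- 1 - θ(t) = (1 - t)² (1 + 2 t), and in the next case θ(t) = t² (3 - 2 t).
        · simp only [hθ]
          nlinarith [mul_nonneg ht.1 (sub_nonneg.2 ht.2), ht.1, ht.2, sq_nonneg (1 - z.1),
            mul_nonneg ht.1 (sq_nonneg (1 - z.1))]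
        · simp only [hθ]
          nlinarith [mul_nonneg (sq_nonneg z.1) (sub_nonneg.2 ht.2), sq_nonneg z.1]
      · have hx : (g₁ z.2 i j - g₀ z.2 i j) ^ 2 ≤ h z.2 ^ 2 := by
          rw [← sq_abs]
          exact pow_le_pow_left₀ (abs_nonneg _) (hle _ _ _) 2
        have hy : hI i j z.2 ^ 2 ≤ h z.2 ^ 2 := by
          simp only [hhI]
          rcases eq_or_ne i j with rfl | hij
          · simp
          · rw [Matrix.one_apply_ne hij]
            nlinarith [sq_nonneg (h z.2)]
        have hT : θ' z.1 ^ 2 = 36 * β z.1 := by simp only [hθ', hβ]; ring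
        have hB : β' z.1 ^ 2 ≤ 4 * β z.1 := by
          have e : β' z.1 ^ 2 = 4 * β z.1 * (1 - 2 * z.1) ^ 2 := by simp only [hβ', hβ]; ring
          have : (1 - 2 * z.1) ^ 2 ≤ 1 := by nlinarith [ht.1, ht.2]
          rw [e]
          exact mul_le_of_le_one_right (by positivity) this
        have e : ρ z i j = θ' z.1 * (g₁ z.2 i j - g₀ z.2 i j) + β' z.1 * hI i j z.2 := by
          simp only [ρ, Matrix.of_apply]; ring
        rw [e]
        calc _ ≤ 2 * (θ' z.1 ^ 2 * (g₁ z.2 i j - g₀ z.2 i j) ^ 2) +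
              2 * (β' z.1 ^ 2 * hI i j z.2 ^ 2) := by
              nlinarith [sq_nonneg (θ' z.1 * (g₁ z.2 i j - g₀ z.2 i j) - β' z.1 * hI i j z.2)]
          _ ≤ 2 * (36 * β z.1 * h z.2 ^ 2) + 2 * (4 * β z.1 * h z.2 ^ 2) := by
              rw [hT]; gcongr
          _ = _ := by ring
    refine (lintegral_mono_ae hpt).trans (le_of_eq ?_)
    rw [lintegral_timeSpace_snd (f := fun x => ENNReal.ofReal (C * (80 * h x)))
      (((hhi.const_mul 80).const_mul C).aemeasurable.ennreal_ofReal),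
      ← ofReal_integral_eq_lintegral_ofReal ((hhi.const_mul 80).const_mul C)
        (ae_of_all _ fun x => mul_nonneg hC (mul_nonneg (by norm_num) (hh0 x)))]
    congr 1
    rw [integral_const_mul, integral_const_mul, hh, integral_finsetSum _ fun i _ =>
      integrable_finsetSum _ fun j _ => (hdi i j).abs, mul_assoc]
    congr 2
    exact Finset.sum_congr rfl fun i _ => integral_finsetSum _ fun j _ => (hdi i j).abs
  exact ENNReal.rpow_le_rpow ((iInf₂_le μ hCE).trans hact) (by norm_num)

end Hellinger

/-! ### Frobenius adjoints of linear maps -/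

section Adjoint

variable {n p m : ℕ}

/-- The adjoint, for the Frobenius inner product, of a linear map between matrix spaces. -/
def frobAdjoint (T : Matrix (Fin n) (Fin n) ℝ →ₗ[ℝ] Matrix (Fin p) (Fin m) ℝ)
    (Y : Matrix (Fin p) (Fin m) ℝ) : Matrix (Fin n) (Fin n) ℝ :=
  Matrix.of fun i j => frob (T (Matrix.single i j 1)) Y

theorem frob_map_eq (T : Matrix (Fin n) (Fin n) ℝ →ₗ[ℝ] Matrix (Fin p) (Fin m) ℝ)
    (A : Matrix (Fin n) (Fin n) ℝ) (Y : Matrix (Fin p) (Fin m) ℝ) :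
    frob (T A) Y = frob A (frobAdjoint T Y) := by
  have h1 : A = ∑ i, ∑ j, A i j • Matrix.single i j (1 : ℝ) := by
    conv_lhs => rw [Matrix.matrix_eq_sum_single A]
    simp [Matrix.smul_single]
  conv_lhs => rw [h1]
  simp only [map_sum, map_smul]
  rw [frob_eq_sum (A := A)]
  simp only [frobAdjoint, Matrix.of_apply, frob, Matrix.transpose_sum, Matrix.sum_mul,
    Matrix.trace_sum, Matrix.transpose_smul, Matrix.smul_mul, Matrix.trace_smul, smul_eq_mul]

theorem exists_frobAdjoint_sq_le (T : Matrix (Fin n) (Fin n) ℝ →ₗ[ℝ] Matrix (Fin p) (Fin m) ℝ) :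
    ∃ K : ℝ, 0 ≤ K ∧ ∀ Y i j, frobAdjoint T Y i j ^ 2 ≤ K * ∑ a, ∑ b, Y a b ^ 2 := by
  set f : Fin n → Fin n → ℝ := fun i j => ∑ a, ∑ b, T (Matrix.single i j 1) a b ^ 2 with hf
  have hf0 : ∀ i j, 0 ≤ f i j := fun i j =>
    Finset.sum_nonneg fun a _ => Finset.sum_nonneg fun b _ => sq_nonneg _
  refine ⟨∑ i, ∑ j, f i j, Finset.sum_nonneg fun i _ => Finset.sum_nonneg fun j _ => hf0 i j,
    fun Y i j => ?_⟩
  have h1 : frobAdjoint T Y i j ^ 2 ≤ f i j * ∑ a, ∑ b, Y a b ^ 2 := by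
    simp only [frobAdjoint, Matrix.of_apply, frob_eq_sum, hf,
      ← Finset.sum_product']
    exact Finset.sum_mul_sq_le_sq_mul_sq _ _ _
  refine h1.trans (mul_le_mul_of_nonneg_right ?_
    (Finset.sum_nonneg fun a _ => Finset.sum_nonneg fun b _ => sq_nonneg _))
  refine le_trans ?_ (Finset.single_le_sum (f := fun i => ∑ j, f i j)
    (fun i _ => Finset.sum_nonneg fun j _ => hf0 i j) (Finset.mem_univ i))
  exact Finset.single_le_sum (f := fun j => f i j) (fun j _ => hf0 i j) (Finset.mem_univ j)

theorem integrable_frobAdjoint {W : Type*} [MeasurableSpace W] {ν : Measure W}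
    (T : Matrix (Fin n) (Fin n) ℝ →ₗ[ℝ] Matrix (Fin p) (Fin m) ℝ)
    {Y : W → Matrix (Fin p) (Fin m) ℝ} (hY : ∀ i j, Integrable (fun w => Y w i j) ν)
    (i j : Fin n) : Integrable (fun w => frobAdjoint T (Y w) i j) ν := by
  simp only [frobAdjoint, Matrix.of_apply, frob_eq_sum]
  exact integrable_finsetSum _ fun a _ => integrable_finsetSum _ fun b _ => (hY a b).const_mul _

end Adjoint

/-! ### Smooth steps in time -/

section Cutoff

/-- The smooth step `t ↦ ∫₀ᵗ ψ(τ - a) dτ`. -/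
def timeStep (ψ : ℝ → ℝ) (a t : ℝ) : ℝ := ∫ τ in (0 : ℝ)..t, ψ (τ - a)

variable {ψ : ℝ → ℝ} {δ a : ℝ}

theorem hasDerivAt_timeStep (hψ : IsMollifier ψ δ) (t : ℝ) :
    HasDerivAt (timeStep ψ a) (ψ (t - a)) t := by
  have hc : Continuous fun τ => ψ (τ - a) := hψ.contDiff.continuous.comp (by fun_prop)
  exact hc.deriv_integral _ 0 t ▸
    (intervalIntegral.integral_hasDerivAt_right (hc.intervalIntegrable _ _)
      hc.stronglyMeasurable.stronglyMeasurableAtFilter hc.continuousAt)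

theorem contDiff_timeStep (hψ : IsMollifier ψ δ) : ContDiff ℝ ∞ (timeStep ψ a) := by
  rw [contDiff_infty_iff_deriv]
  refine ⟨fun t => (hasDerivAt_timeStep hψ t).differentiableAt, ?_⟩
  have : deriv (timeStep ψ a) = fun t => ψ (t - a) :=
    funext fun t => (hasDerivAt_timeStep hψ t).deriv
  rw [this]
  exact hψ.contDiff.comp (contDiff_id.sub contDiff_const)

theorem monotone_timeStep (hψ : IsMollifier ψ δ) : Monotone (timeStep ψ a) :=
  monotone_of_deriv_nonneg (fun t => (hasDerivAt_timeStep hψ t).differentiableAt) fun t => by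
    rw [(hasDerivAt_timeStep hψ t).deriv]
    exact hψ.nonneg _

theorem timeStep_zero : timeStep ψ a 0 = 0 := intervalIntegral.integral_same

theorem timeStep_eq_zero (hψ : IsMollifier ψ δ) {t : ℝ} (ht0 : 0 ≤ t) (ht : t ≤ a - δ) :
    timeStep ψ a t = 0 := by
  rw [timeStep, intervalIntegral.integral_of_le ht0]
  refine setIntegral_eq_zero_of_forall_eq_zero fun τ hτ => ?_
  by_contra h
  have := hψ.norm_lt _ h
  rw [Real.norm_eq_abs, abs_lt] at this
  linarith [hτ.2]

/-- The condition δ ≤ a places the support of the translated kernel to the right of 0, where the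
integration starts, so the full mass is counted. -/
theorem timeStep_eq_one (hψ : IsMollifier ψ δ) {t : ℝ} (ha : δ ≤ a) (ht0 : 0 ≤ t)
    (ht : a + δ ≤ t) : timeStep ψ a t = 1 := by
  rw [timeStep, intervalIntegral.integral_of_le ht0,
    setIntegral_eq_integral_of_forall_compl_eq_zero, integral_sub_right_eq_self ψ a,
    hψ.integral_eq_one]
  intro τ hτ
  by_contra h
  have := hψ.norm_lt _ h
  rw [Real.norm_eq_abs, abs_lt] at this
  exact hτ ⟨by linarith, by linarith⟩

end Cutoff

/-! ### Star-shapedness of the time-space domain -/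

section Product

variable {d : ℕ}

/-- A ball for the maximum norm splits into its time and space parts, and r ≤ 1/2 keeps the time
part inside [0,1]. -/
theorem starConvex_timeSpace {Ω : Set (Space d)} {x₀ : Space d} {r : ℝ} (hr : r ≤ 1 / 2)
    (hΩ : ∀ y, ‖y - x₀‖ < r → StarConvex ℝ y Ω) (y : ℝ × Space d)
    (hy : ‖y - ((1 / 2 : ℝ), x₀)‖ < r) : StarConvex ℝ y (timeSpace Ω) := by
  have h1 : |y.1 - 1 / 2| < r := lt_of_le_of_lt (norm_fst_le (y - ((1 / 2 : ℝ), x₀))) hy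
  have h2 : ‖y.2 - x₀‖ < r := lt_of_le_of_lt (norm_snd_le (y - ((1 / 2 : ℝ), x₀))) hy
  rw [abs_lt] at h1
  have h3 : StarConvex ℝ y.1 (Set.Icc (0 : ℝ) 1) :=
    (convex_Icc 0 1).starConvex ⟨by linarith, by linarith⟩
  exact h3.prod (hΩ _ h2)

end Product

/-! ### Averages over translations and weak-star convergence -/

section Averages

variable {W V : Type*} [MeasurableSpace W] [NormedAddCommGroup V] [NormedSpace ℝ V]
  [MeasureSpace V] [BorelSpace V] [FiniteDimensional ℝ V] [(volume : Measure V).IsAddHaarMeasure]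
  {ν : Measure W} [SFinite ν] {η : V → ℝ} {δ : ℝ} {F : W → V} {p m : ℕ}

/-- Allows an identity that holds for every single translation ζ to be integrated against η. -/
theorem sum_integral_mul_smearMatrix (h : IsMollifier η δ) (hF : Measurable F) {K : Set V}
    (hK : IsCompact K) (hFK : ∀ᵐ w ∂ν, ∀ ζ, ‖ζ‖ < δ → F w + ζ ∈ K)
    {X : W → Matrix (Fin p) (Fin m) ℝ} (hX : ∀ i j, Integrable (fun w => X w i j) ν)
    {Ψ : V → Matrix (Fin p) (Fin m) ℝ} (hΨ : ∀ i j, Continuous fun z => Ψ z i j) :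
    Integrable (fun ζ => η ζ * ∑ i, ∑ j, ∫ w, Ψ (F w + ζ) i j * X w i j ∂ν) volume ∧
    ∑ i, ∑ j, (∫ z in K, Ψ z i j * smearMatrix ν η F X z i j) =
      ∫ ζ, η ζ * ∑ i, ∑ j, ∫ w, Ψ (F w + ζ) i j * X w i j ∂ν := by
  have hi := fun i j => integrable_average_smear h hF hK hFK (hX i j) (hΨ i j)
  simp only [Finset.mul_sum]
  refine ⟨integrable_finsetSum _ fun i _ => integrable_finsetSum _ fun j _ => hi i j, ?_⟩
  rw [integral_finsetSum _ fun i _ => integrable_finsetSum _ fun j _ => hi i j]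
  refine Finset.sum_congr rfl fun i _ => ?_
  rw [integral_finsetSum _ fun j _ => hi i j]
  exact Finset.sum_congr rfl fun j _ =>
    integral_mul_smear_eq_average h hF hK hFK (hX i j) (hΨ i j)

/-- Densities that are smeared versions of `X ν`, up to errors that vanish in `L¹`, converge
weakly-star. -/
theorem weakStarTendsto_of_smear {ν : Measure V} [IsFiniteMeasure ν] {K : Set V}
    (hK : IsCompact K) (hνK : ∀ᵐ w ∂ν, w ∈ K) {η : ℕ → V → ℝ} {δ : ℕ → ℝ}
    (h : ∀ N, IsMollifier (η N) (δ N)) (hδ : Tendsto δ atTop (𝓝 0)) {c : V} {r : ℝ} {e : ℕ → ℝ}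
    (hstar : ∀ y, ‖y - c‖ < r → StarConvex ℝ y K) (he0 : ∀ N, 0 < e N) (he1 : ∀ N, e N ≤ 1)
    (he : Tendsto e atTop (𝓝 0)) (hδe : ∀ N, δ N = e N * r) {X : V → Matrix (Fin p) (Fin m) ℝ}
    {μ : MatrixMeasure V p m} (hμ : μ.HasDensity ν X) {μs : ℕ → MatrixMeasure V p m}
    {g : ℕ → V → Matrix (Fin p) (Fin m) ℝ}
    (hμs : ∀ N, (μs N).HasDensity (volume.restrict K) (g N))
    (hg : ∀ i j, Tendsto (fun N => ∫ z in K, |g N z i j -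
      smear ν (η N) (shrink c (e N)) (fun w => X w i j) z|) atTop (𝓝 0)) :
    WeakStarTendsto K μs μ := by
  intro Φ hΦ
  have hKm := hK.measurableSet
  have hΦc : ∀ i j, ContinuousOn (fun z => Φ z i j) K := fun i j =>
    (continuous_id.matrix_elem i j).comp_continuousOn hΦ
  have hνr : ν.restrict K = ν := Measure.restrict_eq_self_of_ae_mem hνK
  have hM := fun i j => hK.exists_bound_of_continuousOn (hΦc i j)
  choose M hM using hM
  have e1 : μ.pairing Φ = ∑ i, ∑ j, ∫ w, Φ w i j * X w i j ∂ν := by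
    refine hμ.pairing_eq (fun i j => ?_) fun i j => ⟨M i j, hνK.mono fun w hw => hM i j w hw⟩
    rw [← hνr]
    exact (hΦc i j).aestronglyMeasurable hKm
  have hMr : ∀ i j, ∀ᵐ z ∂volume.restrict K, ‖Φ z i j‖ ≤ M i j := fun i j =>
    (ae_restrict_iff' hKm).2 (ae_of_all _ (hM i j))
  have e2 : ∀ N, (μs N).pairing Φ = ∑ i, ∑ j, ∫ z in K, Φ z i j * g N z i j := fun N =>
    (hμs N).pairing_eq (fun i j => (hΦc i j).aestronglyMeasurable hKm)
      fun i j => ⟨M i j, hMr i j⟩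
  simp only [e1, e2]
  refine tendsto_finsetSum _ fun i _ => tendsto_finsetSum _ fun j _ => ?_
  set s : ℕ → V → ℝ := fun N => smear ν (η N) (shrink c (e N)) fun w => X w i j with hs
  have hFm : ∀ N, Measurable (shrink c (e N)) := fun N => (continuous_shrink c (e N)).measurable
  have hsi : ∀ N, Integrable (s N) (volume.restrict K) := fun N =>
    integrable_smear (h N) (hFm N) K (hμ i j).1
  have t1 : Tendsto (fun N => ∫ z in K, Φ z i j * s N z) atTop (𝓝 (∫ w, Φ w i j * X w i j ∂ν)) :=
    tendsto_integral_mul_smear (F' := fun w => w) h hδ hK (hΦc i j) hFm hνK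
      (hνK.mono fun w hw N ζ hζ => shrink_add_mem hstar (he0 N) (he1 N) hw (hδe N ▸ hζ))
      (ae_of_all _ fun w => tendsto_shrink c w he) (hμ i j).1
  have hdi : ∀ N, Integrable (fun z => g N z i j - s N z) (volume.restrict K) := fun N =>
    (hμs N i j).1.sub (hsi N)
  have t2 : Tendsto (fun N => ∫ z in K, Φ z i j * (g N z i j - s N z)) atTop (𝓝 0) := by
    refine squeeze_zero_norm (a := fun N => |M i j| * ∫ z in K, |g N z i j - s N z|)
      (fun N => ?_) (by simpa using (hg i j).const_mul |M i j|)
    rw [← integral_const_mul]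
    refine norm_integral_le_of_norm_le ((hdi N).abs.const_mul _) ?_
    filter_upwards [hMr i j] with z hz
    rw [norm_mul, Real.norm_eq_abs (g N z i j - s N z)]
    exact mul_le_mul_of_nonneg_right (hz.trans (le_abs_self _)) (abs_nonneg _)
  have t3 := t1.add t2
  rw [add_zero] at t3
  refine t3.congr fun N => ?_
  have hb : ∀ {f : V → ℝ}, Integrable f (volume.restrict K) →
      Integrable (fun z => Φ z i j * f z) (volume.restrict K) := fun hf =>
    hf.bdd_mul ((hΦc i j).aestronglyMeasurable hKm) (hMr i j)
  rw [← integral_add (hb (hsi N)) (hb (hdi N))]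
  refine integral_congr_ae (ae_of_all _ fun z => ?_)
  simp only []
  ring

end Averages

/-- A solution of the continuity equation given by densities, on a domain that is star-shaped with
respect to a ball. -/
structure CurveData (d n k : ℕ) where
  Ω : Set (Space d)
  isCompact : IsCompact Ω
  D : DiffOp d n k
  ν : Measure (ℝ × Space d)
  ν' : Measure (Space d)
  [finite : IsFiniteMeasure ν]
  [finite' : IsFiniteMeasure ν']
  X : ℝ × Space d → Matrix (Fin n) (Fin n) ℝ
  Y : ℝ × Space d → Matrix (Fin n) (Fin k) ℝ
  Z : ℝ × Space d → Matrix (Fin n) (Fin n) ℝ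
  X₀ : Space d → Matrix (Fin n) (Fin n) ℝ
  X₁ : Space d → Matrix (Fin n) (Fin n) ℝ
  integrable_X : ∀ i j, Integrable (fun w => X w i j) ν
  integrable_Y : ∀ i j, Integrable (fun w => Y w i j) ν
  integrable_Z : ∀ i j, Integrable (fun w => Z w i j) ν
  integrable_X₀ : ∀ i j, Integrable (fun x => X₀ x i j) ν'
  integrable_X₁ : ∀ i j, Integrable (fun x => X₁ x i j) ν'
  posSemidef_X : ∀ᵐ w ∂ν, (X w).PosSemidef
  posSemidef_X₀ : ∀ᵐ x ∂ν', (X₀ x).PosSemidef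
  posSemidef_X₁ : ∀ᵐ x ∂ν', (X₁ x).PosSemidef
  ae_mem : ∀ᵐ w ∂ν, w ∈ timeSpace Ω
  ae_mem' : ∀ᵐ x ∂ν', x ∈ Ω
  center : Space d
  radius : ℝ
  radius_pos : 0 < radius
  radius_le : radius ≤ 1 / 2
  starConvex : ∀ y, ‖y - center‖ < radius → StarConvex ℝ y Ω
  weak_eq : ∀ Φ : ℝ × Space d → Matrix (Fin n) (Fin n) ℝ, EntrywiseContDiff 1 Φ →
    (∀ z, (Φ z).IsSymm) →
      ∑ i, ∑ j, (∫ w, timeDeriv Φ w i j * X w i j ∂ν) +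
        ∑ i, ∑ j, (∫ w, D.apply (fun y => Φ (w.1, y)) w.2 i j * Y w i j ∂ν) +
        ∑ i, ∑ j, (∫ w, Φ w i j * Z w i j ∂ν) =
      ∑ i, ∑ j, (∫ x, Φ (1, x) i j * X₁ x i j ∂ν') - ∑ i, ∑ j, ∫ x, Φ (0, x) i j * X₀ x i j ∂ν'

/-- The shrinking parameter `e` and mollifiers of radius `e r` in time and in space. -/
structure Mollification (d : ℕ) (r : ℝ) where
  e : ℝ
  e_pos : 0 < e
  e_le : e ≤ 1 / 2
  ψ : ℝ → ℝ
  φ : Space d → ℝ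
  isMollifier_ψ : IsMollifier ψ (e * r)
  isMollifier_φ : IsMollifier φ (e * r)
  ψ_le : ∀ t, ψ t ≤ (e * r)⁻¹

/-! ### The regularized curve: definition, smoothness and positivity -/

namespace CurveData

attribute [instance] CurveData.finite CurveData.finite'

variable {d n k : ℕ} (C : CurveData d n k) (m : Mollification d C.radius)

/-- The time-space mollifier. -/
def kernel (z : ℝ × Space d) : ℝ := m.ψ z.1 * m.φ z.2

/-- The contraction of the time-space domain. -/
def contract : ℝ × Space d → ℝ × Space d := shrink ((1 / 2 : ℝ), C.center) m.e

/-- The contraction of the domain. -/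
def contractSpace : Space d → Space d := shrink C.center m.e

/-- The smeared measure `u ν` on the time-space domain. -/
def smeared (u : ℝ × Space d → ℝ) : ℝ × Space d → ℝ := smear C.ν (C.kernel m) (C.contract m) u

/-- The matrix-valued version of `smeared`. -/
def smearedMatrix {p q : ℕ} (U : ℝ × Space d → Matrix (Fin p) (Fin q) ℝ) :
    ℝ × Space d → Matrix (Fin p) (Fin q) ℝ :=
  smearMatrix C.ν (C.kernel m) (C.contract m) U

/-- The smeared boundary values. -/
def base (U : Space d → Matrix (Fin n) (Fin n) ℝ) : Space d → Matrix (Fin n) (Fin n) ℝ :=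
  smearMatrix C.ν' m.φ (C.contractSpace m) U

/-- The smeared time marginal of the trace. -/
def mass : Space d → ℝ :=
  smear C.ν m.φ (fun w => C.contractSpace m w.2) fun w => (C.X w).trace

/-- The elliptic part added to all densities. -/
def lift (y : Space d) : ℝ := √m.e * C.mass m y + m.e

/-- The cutoff that switches off the initial value. -/
def χ₀ (t : ℝ) : ℝ := 1 - timeStep m.ψ (m.e / 2) t

/-- The cutoff that switches on the final value. -/
def χ₁ (t : ℝ) : ℝ := timeStep m.ψ (1 - m.e / 2) t

/-- The regularized boundary densities. -/
def bdry (U : Space d → Matrix (Fin n) (Fin n) ℝ) (y : Space d) : Matrix (Fin n) (Fin n) ℝ :=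
  Matrix.of fun i j => C.base m U y i j + C.lift m y * (1 : Matrix (Fin n) (Fin n) ℝ) i j

/-- The regularized density of `G`. -/
def densG (z : ℝ × Space d) : Matrix (Fin n) (Fin n) ℝ :=
  Matrix.of fun i j => (1 - m.e) * C.smearedMatrix m C.X z i j +
    (C.χ₀ m z.1 * C.base m C.X₀ z.2 i j + C.χ₁ m z.1 * C.base m C.X₁ z.2 i j +
      1 * (C.lift m z.2 * (1 : Matrix (Fin n) (Fin n) ℝ) i j))

/-- The regularized density of `q`. -/
def densq (z : ℝ × Space d) : Matrix (Fin n) (Fin k) ℝ :=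
  Matrix.of fun i j => (1 - m.e) * C.smearedMatrix m C.Y z i j

/-- The density of `R`, corrected by the zeroth-order term. -/
def Z' (w : ℝ × Space d) : Matrix (Fin n) (Fin n) ℝ :=
  C.Z w + m.e • frobAdjoint C.D.zeroth (C.Y w)

/-- The regularized density of `R`. -/
def densR : ℝ × Space d → Matrix (Fin n) (Fin n) ℝ := C.smearedMatrix m (C.Z' m)

/-- The regularized triplet. -/
def triplet : Triplet (ℝ × Space d) n k :=
  ⟨MatrixMeasure.ofDensity (volume.restrict (timeSpace C.Ω)) (C.densG m),
    MatrixMeasure.ofDensity (volume.restrict (timeSpace C.Ω)) (C.densq m),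
    MatrixMeasure.ofDensity (volume.restrict (timeSpace C.Ω)) (C.densR m)⟩

/-- The regularized boundary measures. -/
def bdryMeasure (U : Space d → Matrix (Fin n) (Fin n) ℝ) : MatrixMeasure (Space d) n n :=
  MatrixMeasure.ofDensity (volume.restrict C.Ω) (C.bdry m U)

theorem isMollifier_kernel : IsMollifier (C.kernel m) (m.e * C.radius) :=
  m.isMollifier_ψ.prod m.isMollifier_φ

theorem measurable_contract : Measurable (C.contract m) := (continuous_shrink _ _).measurable

theorem measurable_contractSpace : Measurable (C.contractSpace m) :=
  (continuous_shrink _ _).measurable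

theorem measurable_contractSpace_snd :
    Measurable fun w : ℝ × Space d => C.contractSpace m w.2 :=
  (C.measurable_contractSpace m).comp measurable_snd

theorem integrable_trace : Integrable (fun w => (C.X w).trace) C.ν := by
  simp only [Matrix.trace, Matrix.diag_apply]
  exact integrable_finsetSum _ fun i _ => C.integrable_X i i

theorem integrable_Z' (i j : Fin n) : Integrable (fun w => C.Z' m w i j) C.ν :=
  (C.integrable_Z i j).add ((integrable_frobAdjoint C.D.zeroth C.integrable_Y i j).const_mul m.e)

theorem contDiff_smearedMatrix {p q : ℕ} {U : ℝ × Space d → Matrix (Fin p) (Fin q) ℝ}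
    (hU : ∀ i j, Integrable (fun w => U w i j) C.ν) :
    EntrywiseContDiff ∞ (C.smearedMatrix m U) := fun i j =>
  contDiff_smear (C.isMollifier_kernel m) (C.measurable_contract m) (hU i j)

theorem contDiff_base {U : Space d → Matrix (Fin n) (Fin n) ℝ}
    (hU : ∀ i j, Integrable (fun x => U x i j) C.ν') : EntrywiseContDiff ∞ (C.base m U) :=
  fun i j => contDiff_smear m.isMollifier_φ (C.measurable_contractSpace m) (hU i j)

theorem contDiff_mass : ContDiff ℝ ∞ (C.mass m) :=
  contDiff_smear m.isMollifier_φ (C.measurable_contractSpace_snd m) C.integrable_trace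

theorem contDiff_lift : ContDiff ℝ ∞ (C.lift m) :=
  (contDiff_const.mul (C.contDiff_mass m)).add contDiff_const

theorem contDiff_χ₀ : ContDiff ℝ ∞ (C.χ₀ m) :=
  contDiff_const.sub (contDiff_timeStep m.isMollifier_ψ)

theorem contDiff_χ₁ : ContDiff ℝ ∞ (C.χ₁ m) := contDiff_timeStep m.isMollifier_ψ

theorem contDiff_bdry {U : Space d → Matrix (Fin n) (Fin n) ℝ}
    (hU : ∀ i j, Integrable (fun x => U x i j) C.ν') : EntrywiseContDiff ∞ (C.bdry m U) :=
  fun i j => (C.contDiff_base m hU i j).add ((C.contDiff_lift m).mul contDiff_const)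

theorem contDiff_densG : EntrywiseContDiff ∞ (C.densG m) := fun i j =>
  (contDiff_const.mul (C.contDiff_smearedMatrix m C.integrable_X i j)).add
    (((((C.contDiff_χ₀ m).comp contDiff_fst).mul
      ((C.contDiff_base m C.integrable_X₀ i j).comp contDiff_snd)).add
      (((C.contDiff_χ₁ m).comp contDiff_fst).mul
        ((C.contDiff_base m C.integrable_X₁ i j).comp contDiff_snd))).add
      (contDiff_const.mul (((C.contDiff_lift m).comp contDiff_snd).mul contDiff_const)))

theorem contDiff_densq : EntrywiseContDiff ∞ (C.densq m) := fun i j =>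
  contDiff_const.mul (C.contDiff_smearedMatrix m C.integrable_Y i j)

theorem contDiff_densR : EntrywiseContDiff ∞ (C.densR m) := fun i j =>
  C.contDiff_smearedMatrix m (C.integrable_Z' m) i j

theorem _root_.MatrixOT.EntrywiseContDiff.hasSmoothDensity {V : Type*} [NormedAddCommGroup V]
    [NormedSpace ℝ V] [MeasureSpace V] [BorelSpace V]
    [IsFiniteMeasureOnCompacts (volume : Measure V)] {p q : ℕ} {K : Set V} (hK : IsCompact K)
    {g : V → Matrix (Fin p) (Fin q) ℝ} (hg : EntrywiseContDiff ∞ g) :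
    HasSmoothDensity (MatrixMeasure.ofDensity (volume.restrict K) g) K g :=
  ⟨hg, MatrixMeasure.hasDensity_ofDensity fun i j =>
    (hg i j).continuous.continuousOn.integrableOn_compact hK⟩

theorem hasSmoothDensity_triplet :
    HasSmoothDensity (C.triplet m).G (timeSpace C.Ω) (C.densG m) ∧
    HasSmoothDensity (C.triplet m).q (timeSpace C.Ω) (C.densq m) ∧
    HasSmoothDensity (C.triplet m).R (timeSpace C.Ω) (C.densR m) :=
  have hQ := isCompact_timeSpace C.isCompact
  ⟨(C.contDiff_densG m).hasSmoothDensity hQ, (C.contDiff_densq m).hasSmoothDensity hQ,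
    (C.contDiff_densR m).hasSmoothDensity hQ⟩

theorem hasSmoothDensity_bdry {U : Space d → Matrix (Fin n) (Fin n) ℝ}
    (hU : ∀ i j, Integrable (fun x => U x i j) C.ν') :
    HasSmoothDensity (C.bdryMeasure m U) C.Ω (C.bdry m U) :=
  (C.contDiff_bdry m hU).hasSmoothDensity C.isCompact

/-! ### Positivity -/

theorem trace_nonneg : 0 ≤ᵐ[C.ν] fun w => (C.X w).trace :=
  C.posSemidef_X.mono fun _ h => h.trace_nonneg

theorem mass_nonneg (y : Space d) : 0 ≤ C.mass m y := smear_nonneg m.isMollifier_φ C.trace_nonneg y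

theorem le_lift (y : Space d) : m.e ≤ C.lift m y :=
  le_add_of_nonneg_left (mul_nonneg (Real.sqrt_nonneg _) (C.mass_nonneg m y))

theorem mul_radius_le : m.e * C.radius ≤ m.e / 2 := by
  have := C.radius_le
  nlinarith [m.e_pos]

theorem χ₀_zero : C.χ₀ m 0 = 1 := by rw [χ₀, timeStep_zero, sub_zero]

theorem χ₁_zero : C.χ₁ m 0 = 0 := timeStep_zero

/-- Since e r ≤ e/2, the kernel centred at e/2 is supported in [0, e]. -/
theorem χ₀_eq_zero {t : ℝ} (ht : m.e ≤ t) : C.χ₀ m t = 0 := by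
  have := C.mul_radius_le m
  rw [χ₀, timeStep_eq_one m.isMollifier_ψ (by linarith) (by linarith [m.e_pos]) (by linarith),
    sub_self]

theorem χ₁_eq_zero {t : ℝ} (ht0 : 0 ≤ t) (ht : t ≤ 1 - m.e) : C.χ₁ m t = 0 := by
  have := C.mul_radius_le m
  exact timeStep_eq_zero m.isMollifier_ψ ht0 (by linarith)

theorem χ₀_one : C.χ₀ m 1 = 0 := C.χ₀_eq_zero m (by linarith [m.e_le])

theorem χ₁_one : C.χ₁ m 1 = 1 := by
  have := C.mul_radius_le m
  have := m.e_le
  exact timeStep_eq_one m.isMollifier_ψ (by linarith) (by linarith) (by linarith)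

theorem χ₀_mem {t : ℝ} (ht : t ∈ Set.Icc (0 : ℝ) 1) : C.χ₀ m t ∈ Set.Icc (0 : ℝ) 1 := by
  have h0 := monotone_timeStep (a := m.e / 2) m.isMollifier_ψ ht.1
  have h1 := monotone_timeStep (a := m.e / 2) m.isMollifier_ψ ht.2
  have h2 := C.χ₀_one m
  rw [timeStep_zero] at h0
  rw [χ₀] at h2 ⊢
  exact ⟨by linarith, by linarith⟩

theorem χ₁_mem {t : ℝ} (ht : t ∈ Set.Icc (0 : ℝ) 1) : C.χ₁ m t ∈ Set.Icc (0 : ℝ) 1 := by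
  have h0 := monotone_timeStep (a := 1 - m.e / 2) m.isMollifier_ψ ht.1
  have h1 := monotone_timeStep (a := 1 - m.e / 2) m.isMollifier_ψ ht.2
  have h2 := C.χ₁_one m
  rw [timeStep_zero] at h0
  rw [χ₁] at h2 ⊢
  exact ⟨h0, h1.trans h2.le⟩

theorem posSemidef_base {U : Space d → Matrix (Fin n) (Fin n) ℝ}
    (hU : ∀ i j, Integrable (fun x => U x i j) C.ν') (hp : ∀ᵐ x ∂C.ν', (U x).PosSemidef)
    (y : Space d) : (C.base m U y).PosSemidef :=
  posSemidef_smearMatrix m.isMollifier_φ (C.measurable_contractSpace m) hU hp y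

theorem posSemidef_smearedMatrix (z : ℝ × Space d) : (C.smearedMatrix m C.X z).PosSemidef :=
  posSemidef_smearMatrix (C.isMollifier_kernel m) (C.measurable_contract m) C.integrable_X
    C.posSemidef_X z

theorem bdry_eq (U : Space d → Matrix (Fin n) (Fin n) ℝ) (y : Space d) :
    C.bdry m U y = C.base m U y + C.lift m y • (1 : Matrix (Fin n) (Fin n) ℝ) := by
  ext i j
  simp [bdry]

theorem densG_eq (z : ℝ × Space d) :
    C.densG m z = (1 - m.e) • C.smearedMatrix m C.X z + (C.χ₀ m z.1 • C.base m C.X₀ z.2 +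
      C.χ₁ m z.1 • C.base m C.X₁ z.2 + C.lift m z.2 • (1 : Matrix (Fin n) (Fin n) ℝ)) := by
  ext i j
  simp [densG]

theorem posSemidef_bdry {U : Space d → Matrix (Fin n) (Fin n) ℝ}
    (hU : ∀ i j, Integrable (fun x => U x i j) C.ν') (hp : ∀ᵐ x ∂C.ν', (U x).PosSemidef)
    (y : Space d) : (C.bdry m U y).PosSemidef := by
  rw [bdry_eq]
  exact (C.posSemidef_base m hU hp y).add
    (Matrix.PosSemidef.one.smul (m.e_pos.le.trans (C.le_lift m y)))

theorem bdryMeasure_mem {U : Space d → Matrix (Fin n) (Fin n) ℝ}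
    (hU : ∀ i j, Integrable (fun x => U x i j) C.ν') (hp : ∀ᵐ x ∂C.ν', (U x).PosSemidef) :
    C.bdryMeasure m U ∈ psdMeasures C.Ω n :=
  (C.hasSmoothDensity_bdry m hU).2.mem_psdMeasures C.isCompact.measurableSet
    (fun y => PosSemidef.isSymm (C.posSemidef_bdry m hU hp y))
    fun y _ => C.posSemidef_bdry m hU hp y

theorem isSymm_densG (z : ℝ × Space d) : (C.densG m z).IsSymm := by
  rw [densG_eq]
  exact ((PosSemidef.isSymm (C.posSemidef_smearedMatrix m z)).smul _).add
    ((((PosSemidef.isSymm (C.posSemidef_base m C.integrable_X₀ C.posSemidef_X₀ _)).smul _).add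
      ((PosSemidef.isSymm (C.posSemidef_base m C.integrable_X₁ C.posSemidef_X₁ _)).smul _)).add
      (Matrix.isSymm_one.smul _))

/-- The constant is e: `lift` is at least e, and on Q all other summands are positive semidefinite.
-/
theorem uniformlyElliptic_densG : UniformlyElliptic (timeSpace C.Ω) (C.densG m) := by
  refine ⟨m.e, m.e_pos, fun z hz => ?_⟩
  have e1 : C.densG m z - m.e • (1 : Matrix (Fin n) (Fin n) ℝ) =
      (1 - m.e) • C.smearedMatrix m C.X z + (C.χ₀ m z.1 • C.base m C.X₀ z.2 +
        C.χ₁ m z.1 • C.base m C.X₁ z.2 +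
        (C.lift m z.2 - m.e) • (1 : Matrix (Fin n) (Fin n) ℝ)) := by
    rw [densG_eq, sub_smul (C.lift m z.2)]
    abel
  rw [e1]
  exact ((C.posSemidef_smearedMatrix m z).smul (by linarith [m.e_le])).add
    ((((C.posSemidef_base m C.integrable_X₀ C.posSemidef_X₀ _).smul (C.χ₀_mem m hz.1).1).add
      ((C.posSemidef_base m C.integrable_X₁ C.posSemidef_X₁ _).smul (C.χ₁_mem m hz.1).1)).add
      (Matrix.PosSemidef.one.smul (sub_nonneg.2 (C.le_lift m _))))

end CurveData

/-! ### Derivatives of contracted test functions -/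

section Calculus

variable {d n k : ℕ}

theorem timeDeriv_apply {Φ : ℝ × Space d → Matrix (Fin n) (Fin n) ℝ} (hΦ : EntrywiseContDiff 1 Φ)
    (z : ℝ × Space d) (i j : Fin n) :
    timeDeriv Φ z i j = fderiv ℝ (fun w => Φ w i j) z (1, 0) := deriv_slice (hΦ i j) z

theorem spaceDeriv_apply {Φ : ℝ × Space d → Matrix (Fin n) (Fin n) ℝ}
    (hΦ : EntrywiseContDiff 1 Φ) (z : ℝ × Space d) (l : Fin d) (i j : Fin n) :
    spaceDeriv l (fun y => Φ (z.1, y)) z.2 i j =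
      fderiv ℝ (fun w => Φ w i j) z (0, EuclideanSpace.single l 1) :=
  lineDeriv_slice (hΦ i j) z _

theorem continuous_apply_diffOp (D : DiffOp d n k) {Φ : ℝ × Space d → Matrix (Fin n) (Fin n) ℝ}
    (hΦ : EntrywiseContDiff 1 Φ) (i : Fin n) (j : Fin k) :
    Continuous fun z : ℝ × Space d => D.apply (fun y => Φ (z.1, y)) z.2 i j := by
  have h0 : Continuous Φ := continuous_matrix fun a b => (hΦ a b).continuous
  have h1 : ∀ l, Continuous fun z : ℝ × Space d => spaceDeriv l (fun y => Φ (z.1, y)) z.2 :=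
    fun l => continuous_matrix fun a b => by
      simp only [spaceDeriv_apply hΦ]
      exact ((hΦ a b).continuous_fderiv (by norm_num)).clm_apply continuous_const
  have h2 : ∀ T : Matrix (Fin n) (Fin n) ℝ →ₗ[ℝ] Matrix (Fin n) (Fin k) ℝ, Continuous T :=
    fun T => T.continuous_of_finiteDimensional
  have h3 : Continuous fun z : ℝ × Space d => D.apply (fun y => Φ (z.1, y)) z.2 :=
    ((h2 _).comp h0).add (continuous_finsetSum _ fun l _ => (h2 _).comp (h1 l))
  exact h3.matrix_elem i j

theorem fderiv_comp_shrink {V : Type*} [NormedAddCommGroup V] [NormedSpace ℝ V] {f : V → ℝ}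
    (hf : ContDiff ℝ 1 f) (c : V) (e : ℝ) (ζ w v : V) :
    fderiv ℝ (fun w => f (shrink c e w + ζ)) w v =
      (1 - e) * fderiv ℝ f (shrink c e w + ζ) v := by
  have h1 : HasFDerivAt (fun w => shrink c e w + ζ) ((1 - e) • ContinuousLinearMap.id ℝ V) w :=
    ((((hasFDerivAt_id w).sub_const c).const_smul (1 - e)).const_add c).add_const ζ
  have h2 := ((hf.differentiable (by norm_num)).differentiableAt
    (x := shrink c e w + ζ)).hasFDerivAt.comp w h1
  have h3 : fderiv ℝ (fun w => f (shrink c e w + ζ)) w =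
      (fderiv ℝ f (shrink c e w + ζ)).comp ((1 - e) • ContinuousLinearMap.id ℝ V) := h2.fderiv
  rw [h3]
  simp

theorem contDiff_comp_shrink {V : Type*} [NormedAddCommGroup V] [NormedSpace ℝ V] {f : V → ℝ}
    (hf : ContDiff ℝ 1 f) (c : V) (e : ℝ) (ζ : V) :
    ContDiff ℝ 1 fun w => f (shrink c e w + ζ) :=
  hf.comp ((contDiff_const.add (contDiff_const.smul (contDiff_id.sub contDiff_const))).add
    contDiff_const)

theorem timeDeriv_comp_shrink {Φ : ℝ × Space d → Matrix (Fin n) (Fin n) ℝ}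
    (hΦ : EntrywiseContDiff 1 Φ) (c : ℝ × Space d) (e : ℝ) (ζ w : ℝ × Space d) :
    timeDeriv (fun w => Φ (shrink c e w + ζ)) w = (1 - e) • timeDeriv Φ (shrink c e w + ζ) := by
  ext i j
  rw [timeDeriv_apply (fun i j => contDiff_comp_shrink (hΦ i j) c e ζ), Matrix.smul_apply,
    timeDeriv_apply hΦ, fderiv_comp_shrink (hΦ i j), smul_eq_mul]

/-- Only the first-order part gains the factor 1 - e. Writing the order-zero coefficient 1 as (1 -
e) + e gives the whole operator a common factor, with a remainder that is charged to the reaction.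
-/
theorem apply_comp_shrink (D : DiffOp d n k) {Φ : ℝ × Space d → Matrix (Fin n) (Fin n) ℝ}
    (hΦ : EntrywiseContDiff 1 Φ) (c : ℝ × Space d) (e : ℝ) (ζ w : ℝ × Space d) :
    D.apply (fun y => Φ (shrink c e (w.1, y) + ζ)) w.2 =
      (1 - e) • D.apply (fun y => Φ ((shrink c e w + ζ).1, y)) (shrink c e w + ζ).2 +
        e • D.zeroth (Φ (shrink c e w + ζ)) := by
  have h1 : ∀ l, spaceDeriv l (fun y => Φ (shrink c e (w.1, y) + ζ)) w.2 =
      (1 - e) • spaceDeriv l (fun y => Φ ((shrink c e w + ζ).1, y)) (shrink c e w + ζ).2 := by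
    intro l
    ext i j
    rw [spaceDeriv_apply (Φ := fun w => Φ (shrink c e w + ζ))
      (fun i j => contDiff_comp_shrink (hΦ i j) c e ζ), Matrix.smul_apply,
      spaceDeriv_apply hΦ, fderiv_comp_shrink (hΦ i j), smul_eq_mul]
  simp only [DiffOp.apply, h1, map_smul, smul_add, Finset.smul_sum, Prod.mk.eta]
  rw [add_right_comm, ← add_smul, sub_add_cancel, one_smul]

theorem frob_add_right {p q : ℕ} (A B B' : Matrix (Fin p) (Fin q) ℝ) :
    frob A (B + B') = frob A B + frob A B' := by
  simp [frob, Matrix.mul_add]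

end Calculus

/-! ### The continuity equation under contraction and mollification -/

namespace CurveData

variable {d n k : ℕ} (C : CurveData d n k) (m : Mollification d C.radius)

theorem integrable_mul {f : ℝ × Space d → ℝ} (hf : Continuous f)
    {u : ℝ × Space d → ℝ} (hu : Integrable u C.ν) : Integrable (fun w => f w * u w) C.ν := by
  obtain ⟨M, hM⟩ := (isCompact_timeSpace C.isCompact).exists_bound_of_continuousOn hf.continuousOn
  exact hu.bdd_mul hf.aestronglyMeasurable (C.ae_mem.mono hM)

theorem sum_integral_eq_integral_frob {W : Type*} [MeasurableSpace W] {ν : Measure W} {p q : ℕ}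
    {A B : W → Matrix (Fin p) (Fin q) ℝ} (h : ∀ i j, Integrable (fun w => A w i j * B w i j) ν) :
    Integrable (fun w => frob (A w) (B w)) ν ∧
    ∑ i, ∑ j, (∫ w, A w i j * B w i j ∂ν) = ∫ w, frob (A w) (B w) ∂ν := by
  simp only [frob_eq_sum]
  refine ⟨integrable_finsetSum _ fun i _ => integrable_finsetSum _ fun j _ => h i j, ?_⟩
  rw [integral_finsetSum _ fun i _ => integrable_finsetSum _ fun j _ => h i j]
  exact Finset.sum_congr rfl fun i _ => (integral_finsetSum _ fun j _ => h i j).symm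

/-- The continuity equation tested with the contracted and translated function. -/
theorem weak_eq_contract {Φ : ℝ × Space d → Matrix (Fin n) (Fin n) ℝ}
    (hΦ : EntrywiseContDiff 1 Φ) (hs : ∀ z, (Φ z).IsSymm) (ζ : ℝ × Space d) :
    (1 - m.e) * ∑ i, ∑ j, (∫ w, timeDeriv Φ (C.contract m w + ζ) i j * C.X w i j ∂C.ν) +
      (1 - m.e) * ∑ i, ∑ j, (∫ w, C.D.apply (fun y => Φ ((C.contract m w + ζ).1, y))
        (C.contract m w + ζ).2 i j * C.Y w i j ∂C.ν) +
      ∑ i, ∑ j, (∫ w, Φ (C.contract m w + ζ) i j * C.Z' m w i j ∂C.ν) =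
    ∑ i, ∑ j, (∫ x, Φ (C.contract m (1, x) + ζ) i j * C.X₁ x i j ∂C.ν') -
      ∑ i, ∑ j, ∫ x, Φ (C.contract m (0, x) + ζ) i j * C.X₀ x i j ∂C.ν' := by
  have hc : Continuous fun w => C.contract m w + ζ :=
    (continuous_shrink _ _).add continuous_const
  have key := C.weak_eq (fun w => Φ (C.contract m w + ζ))
    (fun i j => contDiff_comp_shrink (hΦ i j) _ _ ζ) fun z => hs _
  have iX := sum_integral_eq_integral_frob (A := fun w => timeDeriv Φ (C.contract m w + ζ))
    (B := C.X) fun i j => C.integrable_mul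
      ((continuous_deriv_slice (hΦ i j)).comp hc) (C.integrable_X i j)
  have iY := sum_integral_eq_integral_frob (A := fun w =>
      C.D.apply (fun y => Φ ((C.contract m w + ζ).1, y)) (C.contract m w + ζ).2)
    (B := C.Y) fun i j => C.integrable_mul
      ((continuous_apply_diffOp C.D hΦ i j).comp hc) (C.integrable_Y i j)
  have iZ := sum_integral_eq_integral_frob (A := fun w => Φ (C.contract m w + ζ))
    (B := C.Z) fun i j => C.integrable_mul
      ((hΦ i j).continuous.comp hc) (C.integrable_Z i j)
  have iT := sum_integral_eq_integral_frob (A := fun w => Φ (C.contract m w + ζ))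
    (B := fun w => frobAdjoint C.D.zeroth (C.Y w)) fun i j => C.integrable_mul
      ((hΦ i j).continuous.comp hc) (integrable_frobAdjoint C.D.zeroth C.integrable_Y i j)
  have iZ' := sum_integral_eq_integral_frob (A := fun w => Φ (C.contract m w + ζ))
    (B := C.Z' m) fun i j => C.integrable_mul
      ((hΦ i j).continuous.comp hc) (C.integrable_Z' m i j)
  have iD := sum_integral_eq_integral_frob (A := fun w =>
      C.D.apply (fun y => Φ (C.contract m (w.1, y) + ζ)) w.2)
    (B := C.Y) fun i j => C.integrable_mul (continuous_apply_diffOp C.D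
      (Φ := fun w => Φ (C.contract m w + ζ)) (fun i j => contDiff_comp_shrink (hΦ i j) _ _ ζ) i j)
      (C.integrable_Y i j)
  have iD' := sum_integral_eq_integral_frob (A := timeDeriv fun w => Φ (C.contract m w + ζ))
    (B := C.X) fun i j => C.integrable_mul (continuous_deriv_slice
      (contDiff_comp_shrink (hΦ i j) _ _ ζ)) (C.integrable_X i j)
  have t1 : ∀ w, timeDeriv (fun w => Φ (C.contract m w + ζ)) w =
      (1 - m.e) • timeDeriv Φ (C.contract m w + ζ) := timeDeriv_comp_shrink hΦ _ _ ζ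
  have t2 : ∀ w : ℝ × Space d, C.D.apply (fun y => Φ (C.contract m (w.1, y) + ζ)) w.2 =
      (1 - m.e) • C.D.apply (fun y => Φ ((C.contract m w + ζ).1, y)) (C.contract m w + ζ).2 +
        m.e • C.D.zeroth (Φ (C.contract m w + ζ)) := apply_comp_shrink C.D hΦ _ _ ζ
  have k1 : ∫ w, frob (timeDeriv (fun w => Φ (C.contract m w + ζ)) w) (C.X w) ∂C.ν =
      (1 - m.e) * ∫ w, frob (timeDeriv Φ (C.contract m w + ζ)) (C.X w) ∂C.ν := by
    simp only [t1, frob_smul_left, integral_const_mul]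
  -- Moved onto Y by the adjoint, the remainder of order zero is the correction contained in `Z'`;
  -- compare `k3`.
  have k2 : ∫ w, frob (C.D.apply (fun y => Φ (C.contract m (w.1, y) + ζ)) w.2) (C.Y w) ∂C.ν =
      (1 - m.e) * (∫ w, frob (C.D.apply (fun y => Φ ((C.contract m w + ζ).1, y))
        (C.contract m w + ζ).2) (C.Y w) ∂C.ν) +
      m.e * ∫ w, frob (Φ (C.contract m w + ζ)) (frobAdjoint C.D.zeroth (C.Y w)) ∂C.ν := by
    simp only [t2, frob_add_left, frob_smul_left, frob_map_eq]
    rw [integral_add (iY.1.const_mul _) (iT.1.const_mul _), integral_const_mul,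
      integral_const_mul]
  have k3 : ∫ w, frob (Φ (C.contract m w + ζ)) (C.Z' m w) ∂C.ν =
      (∫ w, frob (Φ (C.contract m w + ζ)) (C.Z w) ∂C.ν) +
      m.e * ∫ w, frob (Φ (C.contract m w + ζ)) (frobAdjoint C.D.zeroth (C.Y w)) ∂C.ν := by
    simp only [Z', frob_add_right, frob_smul_right]
    rw [integral_add iZ.1 (iT.1.const_mul _), integral_const_mul]
  rw [iD.2, iD'.2, iZ.2, k1, k2] at key
  rw [iX.2, iY.2, iZ'.2, k3, ← key]
  ring

theorem ae_contract_add_mem : ∀ᵐ w ∂C.ν, ∀ ζ, ‖ζ‖ < m.e * C.radius →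
    C.contract m w + ζ ∈ timeSpace C.Ω :=
  C.ae_mem.mono fun _ hw _ hζ => shrink_add_mem
    (starConvex_timeSpace C.radius_le C.starConvex) m.e_pos (by linarith [m.e_le]) hw hζ

theorem ae_contract_prodMk_add_mem {t : ℝ} (ht : t ∈ Set.Icc (0 : ℝ) 1) :
    ∀ᵐ x ∂C.ν', ∀ ζ, ‖ζ‖ < m.e * C.radius → C.contract m (t, x) + ζ ∈ timeSpace C.Ω :=
  C.ae_mem'.mono fun _ hx _ hζ => shrink_add_mem
    (starConvex_timeSpace C.radius_le C.starConvex) m.e_pos (by linarith [m.e_le])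
    (Set.mk_mem_prod ht hx) hζ

/-- The kernel factorizes and the contraction acts on time and space separately. An endpoint measure
at time t thus becomes its spatial smearing times a bump around the contracted time. -/
theorem smearMatrix_contract_prodMk (U : Space d → Matrix (Fin n) (Fin n) ℝ) (t : ℝ)
    (z : ℝ × Space d) (i j : Fin n) :
    smearMatrix C.ν' (C.kernel m) (fun x => C.contract m (t, x)) U z i j =
      m.ψ (z.1 - (1 / 2 + (1 - m.e) * (t - 1 / 2))) * C.base m U z.2 i j := by
  simp only [smearMatrix, base, smear, Matrix.of_apply]
  rw [← integral_const_mul]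
  refine integral_congr_ae (ae_of_all _ fun x => ?_)
  simp only [kernel, contract, contractSpace, shrink, Prod.fst_sub, Prod.snd_sub, Prod.fst_add,
    Prod.snd_add, Prod.smul_fst, Prod.smul_snd, smul_eq_mul, mul_assoc]

/-- The continuity equation tested with an average of contracted and translated functions. -/
theorem average_eq {Φ : ℝ × Space d → Matrix (Fin n) (Fin n) ℝ}
    (hΦ : EntrywiseContDiff 1 Φ) (hs : ∀ z, (Φ z).IsSymm) :
    (1 - m.e) * ∑ i, ∑ j, (∫ z in timeSpace C.Ω, timeDeriv Φ z i j *
        C.smearedMatrix m C.X z i j) +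
      (1 - m.e) * ∑ i, ∑ j, (∫ z in timeSpace C.Ω, C.D.apply (fun y => Φ (z.1, y)) z.2 i j *
        C.smearedMatrix m C.Y z i j) +
      ∑ i, ∑ j, (∫ z in timeSpace C.Ω, Φ z i j * C.densR m z i j) =
    ∑ i, ∑ j, (∫ z in timeSpace C.Ω, Φ z i j *
        (m.ψ (z.1 - (1 - m.e / 2)) * C.base m C.X₁ z.2 i j)) -
      ∑ i, ∑ j, (∫ z in timeSpace C.Ω, Φ z i j *
        (m.ψ (z.1 - m.e / 2) * C.base m C.X₀ z.2 i j)) := by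
  have hQ := isCompact_timeSpace C.isCompact
  have hη := C.isMollifier_kernel m
  have hF := C.measurable_contract m
  have hmem := C.ae_contract_add_mem m
  obtain ⟨iX, eX⟩ := sum_integral_mul_smearMatrix hη hF hQ hmem C.integrable_X
    (Ψ := timeDeriv Φ) fun i j => continuous_deriv_slice (hΦ i j)
  obtain ⟨iY, eY⟩ := sum_integral_mul_smearMatrix hη hF hQ hmem C.integrable_Y
    (Ψ := fun z => C.D.apply (fun y => Φ (z.1, y)) z.2)
    fun i j => continuous_apply_diffOp C.D hΦ i j
  obtain ⟨iZ, eZ⟩ := sum_integral_mul_smearMatrix hη hF hQ hmem (C.integrable_Z' m)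
    (Ψ := Φ) fun i j => (hΦ i j).continuous
  obtain ⟨i1, e1⟩ := sum_integral_mul_smearMatrix hη (F := fun x => C.contract m (1, x))
    (hF.comp measurable_prodMk_left) hQ (C.ae_contract_prodMk_add_mem m (by norm_num))
    C.integrable_X₁ (Ψ := Φ) fun i j => (hΦ i j).continuous
  obtain ⟨i0, e0⟩ := sum_integral_mul_smearMatrix hη (F := fun x => C.contract m (0, x))
    (hF.comp measurable_prodMk_left) hQ (C.ae_contract_prodMk_add_mem m (by norm_num))
    C.integrable_X₀ (Ψ := Φ) fun i j => (hΦ i j).continuous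
  -- The contracted images of the times 1 and 0.
  have a1 : 1 / 2 + (1 - m.e) * ((1 : ℝ) - 1 / 2) = 1 - m.e / 2 := by ring
  have a0 : 1 / 2 + (1 - m.e) * ((0 : ℝ) - 1 / 2) = m.e / 2 := by ring
  simp only [smearMatrix_contract_prodMk, a1] at e1
  simp only [smearMatrix_contract_prodMk, a0] at e0
  rw [e1, e0]
  simp only [smearedMatrix, densR]
  rw [eX, eY, eZ, ← integral_sub i1 i0, ← integral_const_mul, ← integral_const_mul,
    ← integral_add (iX.const_mul _) (iY.const_mul _)]
  refine Eq.trans (integral_add ((iX.const_mul _).add (iY.const_mul _)) iZ).symm ?_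
  refine integral_congr_ae (ae_of_all _ fun ζ => ?_)
  have h := congrArg (C.kernel m ζ * ·) (C.weak_eq_contract m hΦ hs ζ)
  simp only [Pi.add_apply] at h ⊢
  linarith

end CurveData

/-! ### The continuity equation of the regularized curve -/

namespace CurveData

variable {d n k : ℕ} (C : CurveData d n k) (m : Mollification d C.radius)

theorem integrable_base {U : Space d → Matrix (Fin n) (Fin n) ℝ}
    (hU : ∀ i j, Integrable (fun x => U x i j) C.ν') (i j : Fin n) :
    Integrable (fun y => C.base m U y i j) (volume.restrict C.Ω) :=
  (C.contDiff_base m hU i j).continuous.continuousOn.integrableOn_compact C.isCompact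

theorem integrable_lift_mul (a : ℝ) :
    Integrable (fun y => C.lift m y * a) (volume.restrict C.Ω) :=
  ((C.contDiff_lift m).continuous.mul continuous_const).continuousOn.integrableOn_compact
    C.isCompact

theorem hasDerivAt_χ₀ (t : ℝ) : HasDerivAt (C.χ₀ m) (-m.ψ (t - m.e / 2)) t :=
  (hasDerivAt_timeStep m.isMollifier_ψ t).const_sub 1

theorem hasDerivAt_χ₁ (t : ℝ) : HasDerivAt (C.χ₁ m) (m.ψ (t - (1 - m.e / 2))) t :=
  hasDerivAt_timeStep m.isMollifier_ψ t

theorem continuous_ψ_sub (a : ℝ) : Continuous fun t => m.ψ (t - a) :=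
  m.isMollifier_ψ.contDiff.continuous.comp (by fun_prop)

/-- The regularized triplet solves the continuity equation. -/
theorem triplet_mem_continuityEq :
    C.triplet m ∈ continuityEq C.D C.Ω (C.bdryMeasure m C.X₀) (C.bdryMeasure m C.X₁) := by
  have hQ := isCompact_timeSpace C.isCompact
  have hQm := hQ.measurableSet
  obtain ⟨hG, hq, hR⟩ := C.hasSmoothDensity_triplet m
  refine ⟨⟨hG.2.isOn, hq.2.isOn, hR.2.isOn, fun E hE => hG.2.isSymm_value
    (ae_of_all _ fun z => C.isSymm_densG m z) hE⟩, fun Φ hΦ hs => ?_⟩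
  have p1 := hG.2.pairing_eq_of_continuous hQ hQm (Φ := timeDeriv Φ)
    fun i j => continuous_deriv_slice (hΦ i j)
  have p2 := hq.2.pairing_eq_of_continuous hQ hQm (Φ := fun z =>
    C.D.apply (fun y => Φ (z.1, y)) z.2) fun i j => continuous_apply_diffOp C.D hΦ i j
  have p3 := hR.2.pairing_eq_of_continuous hQ hQm (Φ := Φ) fun i j => (hΦ i j).continuous
  have p4 := (C.hasSmoothDensity_bdry m C.integrable_X₁).2.pairing_eq_of_continuous C.isCompact
    C.isCompact.measurableSet (Φ := fun x => Φ (1, x))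
    fun i j => (hΦ i j).continuous.comp (by fun_prop)
  have p5 := (C.hasSmoothDensity_bdry m C.integrable_X₀).2.pairing_eq_of_continuous C.isCompact
    C.isCompact.measurableSet (Φ := fun x => Φ (0, x))
    fun i j => (hΦ i j).continuous.comp (by fun_prop)
  have hint : ∀ {f : ℝ × Space d → ℝ}, Continuous f →
      Integrable f (volume.restrict (timeSpace C.Ω)) := fun hf =>
    hf.continuousOn.integrableOn_compact hQ
  have key := C.average_eq m hΦ hs
  have e2 : ∑ i, ∑ j, (∫ z in timeSpace C.Ω, C.D.apply (fun y => Φ (z.1, y)) z.2 i j *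
      C.densq m z i j) = (1 - m.e) * ∑ i, ∑ j, (∫ z in timeSpace C.Ω,
        C.D.apply (fun y => Φ (z.1, y)) z.2 i j * C.smearedMatrix m C.Y z i j) := by
    simp only [densq, Matrix.of_apply, mul_left_comm _ (1 - m.e), integral_const_mul,
      Finset.mul_sum]
  -- Integration by parts for the time profiles χ₀, χ₁ and 1. The boundary values assemble into the
  -- regularized endpoints, and the terms with ψ cancel the smeared endpoint terms of `average_eq`.
  have e1 : ∀ i j, ∫ z in timeSpace C.Ω, timeDeriv Φ z i j * C.densG m z i j =
      (1 - m.e) * (∫ z in timeSpace C.Ω, timeDeriv Φ z i j * C.smearedMatrix m C.X z i j) +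
      ((∫ y in C.Ω, Φ (1, y) i j * C.bdry m C.X₁ y i j) -
        ∫ y in C.Ω, Φ (0, y) i j * C.bdry m C.X₀ y i j) +
      ((∫ z in timeSpace C.Ω, Φ z i j * (m.ψ (z.1 - m.e / 2) * C.base m C.X₀ z.2 i j)) -
      ∫ z in timeSpace C.Ω, Φ z i j *
        (m.ψ (z.1 - (1 - m.e / 2)) * C.base m C.X₁ z.2 i j)) := by
    intro i j
    have a0 := integral_timeDeriv_mul C.isCompact (hΦ i j) (C.hasDerivAt_χ₀ m)
      (C.continuous_ψ_sub m _).neg (C.integrable_base m C.integrable_X₀ i j)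
    have a1 := integral_timeDeriv_mul C.isCompact (hΦ i j) (C.hasDerivAt_χ₁ m)
      (C.continuous_ψ_sub m _) (C.integrable_base m C.integrable_X₁ i j)
    have a2 := integral_timeDeriv_mul C.isCompact (hΦ i j) (χ := fun _ => 1) (χ' := fun _ => 0)
      (fun t => hasDerivAt_const t 1) continuous_const
      (C.integrable_lift_mul m ((1 : Matrix (Fin n) (Fin n) ℝ) i j))
    rw [χ₀_zero, χ₀_one] at a0
    rw [χ₁_zero, χ₁_one] at a1
    simp only [neg_mul, mul_neg, integral_neg] at a0
    simp only [zero_mul, mul_zero, integral_zero] at a2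
    have hct : Continuous fun z => timeDeriv Φ z i j := continuous_deriv_slice (hΦ i j)
    have hS := (C.contDiff_smearedMatrix m C.integrable_X i j).continuous
    have hb0 := ((C.contDiff_base m C.integrable_X₀ i j).continuous.comp
      (continuous_snd (X := ℝ)))
    have hb1 := ((C.contDiff_base m C.integrable_X₁ i j).continuous.comp
      (continuous_snd (X := ℝ)))
    have hl := ((C.contDiff_lift m).continuous.comp (continuous_snd (X := ℝ)))
    have hx0 := ((C.contDiff_χ₀ m).continuous.comp (continuous_fst (Y := Space d)))
    have hx1 := ((C.contDiff_χ₁ m).continuous.comp (continuous_fst (Y := Space d)))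
    have split : ∫ z in timeSpace C.Ω, timeDeriv Φ z i j * C.densG m z i j =
        (∫ z in timeSpace C.Ω, (1 - m.e) * (timeDeriv Φ z i j * C.smearedMatrix m C.X z i j)) +
        ((∫ z in timeSpace C.Ω, timeDeriv Φ z i j * (C.χ₀ m z.1 * C.base m C.X₀ z.2 i j)) +
        (∫ z in timeSpace C.Ω, timeDeriv Φ z i j * (C.χ₁ m z.1 * C.base m C.X₁ z.2 i j)) +
        ∫ z in timeSpace C.Ω, timeDeriv Φ z i j *
          (1 * (C.lift m z.2 * (1 : Matrix (Fin n) (Fin n) ℝ) i j))) := by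
      have i0 := hint (hct.mul (hx0.mul hb0))
      have i1 := hint (hct.mul (hx1.mul hb1))
      have i2 := hint (hct.mul ((continuous_const (y := (1 : ℝ))).mul (hl.mul
        (continuous_const (y := (1 : Matrix (Fin n) (Fin n) ℝ) i j)))))
      have i3 := hint ((continuous_const (y := 1 - m.e)).mul (hct.mul hS))
      refine Eq.trans ?_ (congrArg _ (integral_add₃ i0 i1 i2))
      refine Eq.trans ?_ (integral_add i3 ((i0.add i1).add i2))
      refine integral_congr_ae (ae_of_all _ fun z => ?_)
      simp only [densG, Matrix.of_apply]
      ring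
    have hbd : ∀ (t : ℝ) {U : Space d → Matrix (Fin n) (Fin n) ℝ},
        (∀ i j, Integrable (fun x => U x i j) C.ν') →
        ∫ y in C.Ω, Φ (t, y) i j * C.bdry m U y i j =
          (∫ y in C.Ω, Φ (t, y) i j * C.base m U y i j) +
          ∫ y in C.Ω, Φ (t, y) i j * (C.lift m y * (1 : Matrix (Fin n) (Fin n) ℝ) i j) := by
      intro t U hU
      have hc : Continuous fun y => Φ (t, y) i j := (hΦ i j).continuous.comp (by fun_prop)
      have i0 := (hc.mul (C.contDiff_base m hU i j).continuous).continuousOn.integrableOn_compact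
        (μ := volume) C.isCompact
      have i1 := (hc.mul ((C.contDiff_lift m).continuous.mul (continuous_const
        (y := (1 : Matrix (Fin n) (Fin n) ℝ) i j)))).continuousOn.integrableOn_compact
        (μ := volume) C.isCompact
      refine Eq.trans ?_ (integral_add i0 i1)
      refine integral_congr_ae (ae_of_all _ fun z => ?_)
      simp only [bdry, Matrix.of_apply]
      ring
    rw [split, hbd 1 C.integrable_X₁, hbd 0 C.integrable_X₀, integral_const_mul]
    simp only [timeDeriv, Matrix.of_apply] at a0 a1 a2 ⊢
    linarith
  rw [p1, p2, p3, p4, p5, e2]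
  simp only [e1, Finset.sum_add_distrib, Finset.sum_sub_distrib, ← Finset.mul_sum]
  linarith

/-! ### The action -/

/-- The bound ψ ≤ (e r)⁻¹ removes the time dependence: the smeared trace is at most (e r)⁻¹ times
the smeared time marginal. The prefactor e r √e is the κ of the perturbation estimate, and the
right-hand side is contained in `lift`. -/
theorem smul_mass_le (z : ℝ × Space d) :
    m.e * C.radius * √m.e * C.smeared m (fun w => (C.X w).trace) z ≤ √m.e * C.mass m z.2 := by
  have hpos : 0 < m.e * C.radius := mul_pos m.e_pos C.radius_pos
  have h1 : C.smeared m (fun w => (C.X w).trace) z ≤ (m.e * C.radius)⁻¹ * C.mass m z.2 := by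
    simp only [smeared, mass, smear]
    rw [← integral_const_mul]
    refine integral_mono_ae ((C.isMollifier_kernel m).integrable_sub_mul
      (C.measurable_contract m) C.integrable_trace z)
      ((m.isMollifier_φ.integrable_sub_mul (C.measurable_contractSpace_snd m)
        C.integrable_trace z.2).const_mul _) ?_
    filter_upwards [C.trace_nonneg] with w hw
    have : C.kernel m (z - C.contract m w) = m.ψ (z.1 - (C.contract m w).1) *
      m.φ (z.2 - C.contractSpace m w.2) := rfl
    simp only [this, ← mul_assoc]
    exact mul_le_mul_of_nonneg_right (mul_le_mul_of_nonneg_right (m.ψ_le _)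
      (m.isMollifier_φ.nonneg _)) hw
  calc m.e * C.radius * √m.e * C.smeared m (fun w => (C.X w).trace) z
      ≤ m.e * C.radius * √m.e * ((m.e * C.radius)⁻¹ * C.mass m z.2) :=
        mul_le_mul_of_nonneg_left h1 (by positivity)
    _ = √m.e * (m.e * C.radius * (m.e * C.radius)⁻¹) * C.mass m z.2 := by ring
    _ = _ := by rw [mul_inv_cancel₀ hpos.ne', mul_one]

theorem smearedMatrix_perturbed (c κ : ℝ) (z : ℝ × Space d) :
    C.smearedMatrix m (fun w => c • C.X w + (κ * (C.X w).trace) • (1 : Matrix (Fin n) (Fin n) ℝ)) z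
      = c • C.smearedMatrix m C.X z +
        (κ * C.smeared m (fun w => (C.X w).trace) z) • (1 : Matrix (Fin n) (Fin n) ℝ) := by
  ext i j
  simp only [smearedMatrix, smearMatrix, smeared, Matrix.of_apply, Matrix.add_apply,
    Matrix.smul_apply, smul_eq_mul]
  rw [smear_add (C.isMollifier_kernel m) (C.measurable_contract m)
    ((C.integrable_X i j).const_mul c)
    ((C.integrable_trace.const_mul κ).mul_const ((1 : Matrix (Fin n) (Fin n) ℝ) i j)),
    smear_const_mul]
  congr 1
  rw [mul_right_comm, ← smear_const_mul]
  congr 1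
  funext w
  ring

/-- The density of G exceeds the smearing of (1 - e) X + κ (tr X) I by a positive semidefinite
matrix. Monotonicity of the cost removes the excess, and Jensen's inequality applies to what
remains. -/
theorem costDensity_dens_le {Λ₁ : Matrix (Fin k) (Fin k) ℝ} {Λ₂ : Matrix (Fin n) (Fin n) ℝ}
    (h₁ : Λ₁.IsSymm) (h₂ : Λ₂.PosDef) {z : ℝ × Space d} (hz : z ∈ timeSpace C.Ω) :
    costDensity Λ₁ Λ₂ (C.densG m z) (C.densq m z) (C.densR m z) ≤
      ∫⁻ w, ENNReal.ofReal (C.kernel m (z - C.contract m w)) *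
        costDensity Λ₁ Λ₂ ((1 - m.e) • C.X w + (m.e * C.radius * √m.e * (C.X w).trace) •
          (1 : Matrix (Fin n) (Fin n) ℝ)) ((1 - m.e) • C.Y w) (C.Z' m w) ∂C.ν := by
  have hq : C.densq m z = C.smearedMatrix m (fun w => (1 - m.e) • C.Y w) z := by
    ext i j
    simp only [densq, smearedMatrix, smearMatrix, Matrix.of_apply, Matrix.smul_apply, smul_eq_mul]
    rw [smear_const_mul]
  have hG : (C.densG m z - C.smearedMatrix m (fun w => (1 - m.e) • C.X w +
      (m.e * C.radius * √m.e * (C.X w).trace) • (1 : Matrix (Fin n) (Fin n) ℝ)) z).PosSemidef := by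
    have e1 : C.densG m z - C.smearedMatrix m (fun w => (1 - m.e) • C.X w +
        (m.e * C.radius * √m.e * (C.X w).trace) • (1 : Matrix (Fin n) (Fin n) ℝ)) z =
        C.χ₀ m z.1 • C.base m C.X₀ z.2 + C.χ₁ m z.1 • C.base m C.X₁ z.2 +
        (C.lift m z.2 - m.e * C.radius * √m.e * C.smeared m (fun w => (C.X w).trace) z) •
          (1 : Matrix (Fin n) (Fin n) ℝ) := by
      rw [densG_eq, smearedMatrix_perturbed, sub_smul (C.lift m z.2)]
      abel
    rw [e1]
    refine (((C.posSemidef_base m C.integrable_X₀ C.posSemidef_X₀ _).smul (C.χ₀_mem m hz.1).1).add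
      ((C.posSemidef_base m C.integrable_X₁ C.posSemidef_X₁ _).smul (C.χ₁_mem m hz.1).1)).add
      (Matrix.PosSemidef.one.smul ?_)
    have := C.smul_mass_le m z
    have := m.e_pos
    simp only [lift]
    linarith
  refine (costDensity_mono h₁ (PosSemidef.isSymm h₂.posSemidef) hG _ _).trans ?_
  rw [hq]
  exact costDensity_smearMatrix_le (C.isMollifier_kernel m) (C.measurable_contract m)
    (fun i j => ((C.integrable_X i j).const_mul _).add
      ((C.integrable_trace.const_mul _).mul_const _))
    (fun i j => (C.integrable_Y i j).const_mul _) (C.integrable_Z' m) z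

/-- The action of the regularized triplets is asymptotically not larger than the original one. -/
theorem exists_lintegral_costDensity_le (Λ₁ : Matrix (Fin k) (Fin k) ℝ) (h₁ : Λ₁.IsSymm)
    (Λ₂ : Matrix (Fin n) (Fin n) ℝ) (h₂ : Λ₂.PosDef)
    (hfin : ∀ᵐ w ∂C.ν, costDensity Λ₁ Λ₂ (C.X w) (C.Y w) (C.Z w) < ⊤) :
    ∃ K : ℝ, 0 ≤ K ∧ ∀ m : Mollification d C.radius,
      ∫⁻ z in timeSpace C.Ω, costDensity Λ₁ Λ₂ (C.densG m z) (C.densq m z) (C.densR m z) ≤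
        ENNReal.ofReal ((1 - m.e)⁻¹ + K * √m.e) *
          ∫⁻ w, costDensity Λ₁ Λ₂ (C.X w) (C.Y w) (C.Z w) ∂C.ν := by
  obtain ⟨K, hK, hle⟩ := exists_costDensity_perturbation_le h₁ h₂ (frobAdjoint C.D.zeroth)
    (exists_frobAdjoint_sq_le _)
  refine ⟨K * C.radius⁻¹, mul_nonneg hK (inv_nonneg.2 C.radius_pos.le), fun m => ?_⟩
  have he := m.e_pos
  have hr := C.radius_pos
  have hs : 0 < √m.e := Real.sqrt_pos.2 he
  refine (setLIntegral_mono_ae' (isCompact_timeSpace C.isCompact).measurableSet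
    (ae_of_all _ fun z hz => C.costDensity_dens_le m h₁ h₂ hz)).trans ?_
  refine (lintegral_lintegral_smear_le (C.isMollifier_kernel m) (C.measurable_contract m) _
    (aemeasurable_costDensity Λ₁ Λ₂ (fun i j => ?_) (fun i j => ?_) fun i j => ?_)).trans ?_
  · exact ((C.integrable_X i j).const_mul _).add
      ((C.integrable_trace.const_mul _).mul_const _)
  · exact (C.integrable_Y i j).const_mul _
  · exact C.integrable_Z' m i j
  rw [← lintegral_const_mul' _ _ ENNReal.ofReal_ne_top]
  refine lintegral_mono_ae ?_
  filter_upwards [hfin, C.posSemidef_X] with w hw hX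
  -- With κ = e r √e the ratio e²/κ is √e / r, which explains the factor r⁻¹ in the constant.
  refine (hle (C.X w) (C.Y w) (C.Z w) (1 - m.e) (m.e * C.radius * √m.e) m.e
    (PosSemidef.isSymm hX) hw (by linarith [m.e_le]) (by linarith) (by positivity)).trans
    (le_of_eq ?_)
  congr 3
  have : m.e ^ 2 = m.e * (√m.e * √m.e) := by rw [Real.mul_self_sqrt he.le, sq]
  rw [this, mul_assoc K]
  congr 1
  field_simp

end CurveData

/-! ### L¹ errors of the regularized densities -/

namespace CurveData

variable {d n k : ℕ} (C : CurveData d n k) (m : Mollification d C.radius)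

/-- χ₀ is at most 1 and vanishes after time e, so the added initial value has mass of order e. -/
theorem setIntegral_χ₀_le : ∫ t in Set.Icc (0 : ℝ) 1, C.χ₀ m t ≤ m.e := by
  have he := m.e_pos
  have h1 : Set.Icc (0 : ℝ) m.e ⊆ Set.Icc 0 1 :=
    Set.Icc_subset_Icc le_rfl (by linarith [m.e_le])
  rw [setIntegral_eq_of_subset_of_forall_sdiff_eq_zero measurableSet_Icc h1 fun t ht =>
    C.χ₀_eq_zero m (le_of_lt (not_le.1 fun h => ht.2 ⟨ht.1.1, h⟩))]
  refine (Real.le_norm_self _).trans ((norm_setIntegral_le_of_norm_le_const (C := 1)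
    measure_Icc_lt_top fun t ht => ?_).trans ?_)
  · have := C.χ₀_mem m (h1 ht)
    rw [Real.norm_eq_abs, abs_of_nonneg this.1]
    exact this.2
  · simp [he.le]

theorem setIntegral_χ₁_le : ∫ t in Set.Icc (0 : ℝ) 1, C.χ₁ m t ≤ m.e := by
  have he := m.e_pos
  have h1 : Set.Icc (1 - m.e) 1 ⊆ Set.Icc (0 : ℝ) 1 :=
    Set.Icc_subset_Icc (by linarith [m.e_le]) le_rfl
  rw [setIntegral_eq_of_subset_of_forall_sdiff_eq_zero measurableSet_Icc h1 fun t ht =>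
    C.χ₁_eq_zero m ht.1.1 (le_of_lt (not_le.1 fun h => ht.2 ⟨h, ht.1.2⟩))]
  refine (Real.le_norm_self _).trans ((norm_setIntegral_le_of_norm_le_const (C := 1)
    measure_Icc_lt_top fun t ht => ?_).trans ?_)
  · have := C.χ₁_mem m (h1 ht)
    rw [Real.norm_eq_abs, abs_of_nonneg this.1]
    exact this.2
  · simp [he.le]

theorem integral_timeSpace_mul {Ω : Set (Space d)} (f : ℝ → ℝ) (g : Space d → ℝ) :
    ∫ z in timeSpace Ω, f z.1 * g z.2 = (∫ t in Set.Icc (0 : ℝ) 1, f t) * ∫ y in Ω, g y := by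
  rw [volume_restrict_timeSpace]
  exact integral_prod_mul f g

theorem integral_abs_lift_le :
    ∫ y in C.Ω, |C.lift m y| ≤
      √m.e * (∫ w, |(C.X w).trace| ∂C.ν) + m.e * volume.real C.Ω := by
  have hi : Integrable (fun y => |C.mass m y|) (volume.restrict C.Ω) :=
    (C.contDiff_mass m).continuous.abs.continuousOn.integrableOn_compact C.isCompact
  have : IsFiniteMeasure (volume.restrict C.Ω) :=
    ⟨by simpa using C.isCompact.measure_lt_top⟩
  calc ∫ y in C.Ω, |C.lift m y| ≤ ∫ y in C.Ω, (√m.e * |C.mass m y| + m.e) := by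
        refine integral_mono ((C.contDiff_lift m).continuous.abs.continuousOn.integrableOn_compact
          C.isCompact) ((hi.const_mul _).add (integrable_const _)) fun y => ?_
        refine (abs_add_le _ _).trans (le_of_eq ?_)
        rw [abs_mul, abs_of_nonneg (Real.sqrt_nonneg _), abs_of_pos m.e_pos]
    _ = √m.e * (∫ y in C.Ω, |C.mass m y|) + m.e * volume.real C.Ω := by
        rw [integral_add (hi.const_mul _) (integrable_const _), integral_const_mul,
          integral_const, smul_eq_mul, mul_comm m.e]
        simp [Measure.real]
    _ ≤ _ := by
        gcongr
        exact integral_abs_smear_le m.isMollifier_φ (C.measurable_contractSpace_snd m) _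
          C.integrable_trace

theorem abs_mul_one_apply_le (a : ℝ) (i j : Fin n) :
    |a * (1 : Matrix (Fin n) (Fin n) ℝ) i j| ≤ |a| := by
  rcases eq_or_ne i j with rfl | h
  · simp
  · simp [Matrix.one_apply_ne h]

theorem integral_abs_bdry_sub_le {U : Space d → Matrix (Fin n) (Fin n) ℝ} (i j : Fin n) :
    ∫ y in C.Ω, |C.bdry m U y i j - smear C.ν' m.φ (C.contractSpace m) (fun x => U x i j) y| ≤
      √m.e * (∫ w, |(C.X w).trace| ∂C.ν) + m.e * volume.real C.Ω := by
  refine le_trans (integral_mono_of_nonneg (ae_of_all _ fun y => abs_nonneg _)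
    ((C.contDiff_lift m).continuous.abs.continuousOn.integrableOn_compact
      C.isCompact) (ae_of_all _ fun y => ?_)) (C.integral_abs_lift_le m)
  simp only [bdry, base, smearMatrix, Matrix.of_apply, add_sub_cancel_left]
  exact abs_mul_one_apply_le _ i j

theorem integral_abs_base_le {U : Space d → Matrix (Fin n) (Fin n) ℝ}
    (hU : ∀ i j, Integrable (fun x => U x i j) C.ν') (i j : Fin n) :
    ∫ y in C.Ω, |C.base m U y i j| ≤ ∫ x, |U x i j| ∂C.ν' :=
  integral_abs_smear_le m.isMollifier_φ (C.measurable_contractSpace m) _ (hU i j)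

theorem integral_abs_smeared_le {u : ℝ × Space d → ℝ} (hu : Integrable u C.ν) :
    ∫ z in timeSpace C.Ω, |C.smeared m u z| ≤ ∫ w, |u w| ∂C.ν :=
  integral_abs_smear_le (C.isMollifier_kernel m) (C.measurable_contract m) _ hu

/-- The errors are the factor 1 - e, the two endpoint terms, which live on time intervals of length
e, and the elliptic part, which is of order √e. -/
theorem integral_abs_densG_sub_le (i j : Fin n) :
    ∫ z in timeSpace C.Ω, |C.densG m z i j - C.smeared m (fun w => C.X w i j) z| ≤
      m.e * (∫ w, |C.X w i j| ∂C.ν) + m.e * (∫ x, |C.X₀ x i j| ∂C.ν') +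
        m.e * (∫ x, |C.X₁ x i j| ∂C.ν') +
        (√m.e * (∫ w, |(C.X w).trace| ∂C.ν) + m.e * volume.real C.Ω) := by
  have hQ := isCompact_timeSpace C.isCompact
  have he := m.e_pos
  have hint : ∀ {f : ℝ × Space d → ℝ}, Continuous f →
      Integrable f (volume.restrict (timeSpace C.Ω)) := fun hf =>
    hf.continuousOn.integrableOn_compact hQ
  have hS : Continuous fun z => m.e * |C.smeared m (fun w => C.X w i j) z| :=
    continuous_const.mul (C.contDiff_smearedMatrix m C.integrable_X i j).continuous.abs
  have hb : ∀ {χ : ℝ → ℝ}, Continuous χ → ∀ {b : Space d → ℝ}, Continuous b →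
      Continuous fun z : ℝ × Space d => χ z.1 * |b z.2| := fun hχ _ hb =>
    (hχ.comp continuous_fst).mul (hb.comp continuous_snd).abs
  have h0 := hb (C.contDiff_χ₀ m).continuous (C.contDiff_base m C.integrable_X₀ i j).continuous
  have h1 := hb (C.contDiff_χ₁ m).continuous (C.contDiff_base m C.integrable_X₁ i j).continuous
  have hl := hb (continuous_const (y := (1 : ℝ))) (C.contDiff_lift m).continuous
  calc _ ≤ ∫ z in timeSpace C.Ω, ((m.e * |C.smeared m (fun w => C.X w i j) z| +
          C.χ₀ m z.1 * |C.base m C.X₀ z.2 i j| + C.χ₁ m z.1 * |C.base m C.X₁ z.2 i j|) +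
          1 * |C.lift m z.2|) := by
        refine setIntegral_mono_on (hint (((C.contDiff_densG m i j).continuous.sub
          (C.contDiff_smearedMatrix m C.integrable_X i j).continuous).abs))
          (hint (((hS.add h0).add h1).add hl)) hQ.measurableSet fun z hz => ?_
        have e1 : C.densG m z i j - C.smeared m (fun w => C.X w i j) z =
            -(m.e * C.smeared m (fun w => C.X w i j) z) + C.χ₀ m z.1 * C.base m C.X₀ z.2 i j +
              C.χ₁ m z.1 * C.base m C.X₁ z.2 i j +
              C.lift m z.2 * (1 : Matrix (Fin n) (Fin n) ℝ) i j := by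
          simp only [densG, smearedMatrix, smearMatrix, smeared, Matrix.of_apply]
          ring
        rw [e1, one_mul]
        refine (abs_add_le _ _).trans (add_le_add ((abs_add_le _ _).trans (add_le_add
          ((abs_add_le _ _).trans (add_le_add ?_ ?_)) ?_)) (abs_mul_one_apply_le _ i j))
        · rw [abs_neg, abs_mul, abs_of_pos he]
        · rw [abs_mul, abs_of_nonneg (C.χ₀_mem m hz.1).1]
        · rw [abs_mul, abs_of_nonneg (C.χ₁_mem m hz.1).1]
    _ = m.e * (∫ z in timeSpace C.Ω, |C.smeared m (fun w => C.X w i j) z|) +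
        (∫ t in Set.Icc (0 : ℝ) 1, C.χ₀ m t) * (∫ y in C.Ω, |C.base m C.X₀ y i j|) +
        (∫ t in Set.Icc (0 : ℝ) 1, C.χ₁ m t) * (∫ y in C.Ω, |C.base m C.X₁ y i j|) +
        1 * ∫ y in C.Ω, |C.lift m y| := by
        refine Eq.trans (integral_add (((hint hS).add (hint h0)).add (hint h1)) (hint hl)) ?_
        refine congrArg₂ _ (Eq.trans (integral_add₃ (hint hS) (hint h0) (hint h1)) ?_) ?_
        · rw [integral_const_mul]
          exact congrArg₂ _ (congrArg _ (integral_timeSpace_mul (C.χ₀ m)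
            fun y => |C.base m C.X₀ y i j|)) (integral_timeSpace_mul (C.χ₁ m)
            fun y => |C.base m C.X₁ y i j|)
        · refine (integral_timeSpace_mul (fun _ => 1) fun y => |C.lift m y|).trans ?_
          simp
    _ ≤ _ := by
        rw [one_mul]
        refine add_le_add (add_le_add (add_le_add ?_ ?_) ?_) (C.integral_abs_lift_le m)
        · exact mul_le_mul_of_nonneg_left (C.integral_abs_smeared_le m (C.integrable_X i j)) he.le
        · exact mul_le_mul (C.setIntegral_χ₀_le m) (C.integral_abs_base_le m C.integrable_X₀ i j)
            (integral_nonneg fun _ => abs_nonneg _) he.le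
        · exact mul_le_mul (C.setIntegral_χ₁_le m) (C.integral_abs_base_le m C.integrable_X₁ i j)
            (integral_nonneg fun _ => abs_nonneg _) he.le

theorem integral_abs_densq_sub_le (i : Fin n) (j : Fin k) :
    ∫ z in timeSpace C.Ω, |C.densq m z i j - C.smeared m (fun w => C.Y w i j) z| ≤
      m.e * ∫ w, |C.Y w i j| ∂C.ν := by
  refine le_trans (le_of_eq ?_) (mul_le_mul_of_nonneg_left
    (C.integral_abs_smeared_le m (C.integrable_Y i j)) m.e_pos.le)
  rw [← integral_const_mul]
  refine integral_congr_ae (ae_of_all _ fun z => ?_)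
  have : C.densq m z i j - C.smeared m (fun w => C.Y w i j) z =
      -(m.e * C.smeared m (fun w => C.Y w i j) z) := by
    simp only [densq, smearedMatrix, smearMatrix, smeared, Matrix.of_apply]
    ring
  simp only [this, abs_neg, abs_mul, abs_of_pos m.e_pos]

theorem integral_abs_densR_sub_le (i j : Fin n) :
    ∫ z in timeSpace C.Ω, |C.densR m z i j - C.smeared m (fun w => C.Z w i j) z| ≤
      m.e * ∫ w, |frobAdjoint C.D.zeroth (C.Y w) i j| ∂C.ν := by
  have hT := integrable_frobAdjoint C.D.zeroth C.integrable_Y i j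
  refine le_trans (le_of_eq ?_) (mul_le_mul_of_nonneg_left
    (C.integral_abs_smeared_le m hT) m.e_pos.le)
  rw [← integral_const_mul]
  refine integral_congr_ae (ae_of_all _ fun z => ?_)
  have : C.densR m z i j = C.smeared m (fun w => C.Z w i j) z +
      m.e * C.smeared m (fun w => frobAdjoint C.D.zeroth (C.Y w) i j) z := by
    have h1 := smear_add (C.isMollifier_kernel m) (C.measurable_contract m) (C.integrable_Z i j)
      (hT.const_mul m.e) z
    rw [smear_const_mul] at h1
    exact h1
  simp only [this, add_sub_cancel_left, abs_mul, abs_of_pos m.e_pos]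

end CurveData

/-! ### Convergence of the curves, of their actions and of their endpoints -/

namespace CurveData

variable {d n k : ℕ} (C : CurveData d n k) (m : ℕ → Mollification d C.radius)

theorem tendsto_radius (hm : Tendsto (fun N => (m N).e) atTop (𝓝 0)) :
    Tendsto (fun N => (m N).e * C.radius) atTop (𝓝 0) := by
  simpa using hm.mul_const C.radius

theorem tendsto_sqrt (hm : Tendsto (fun N => (m N).e) atTop (𝓝 0)) :
    Tendsto (fun N => √(m N).e) atTop (𝓝 0) := by
  simpa using hm.sqrt

theorem tendsto_lift_bound (hm : Tendsto (fun N => (m N).e) atTop (𝓝 0)) (a b : ℝ) :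
    Tendsto (fun N => √(m N).e * a + (m N).e * b) atTop (𝓝 0) := by
  simpa using ((C.tendsto_sqrt m hm).mul_const a).add (hm.mul_const b)

/-- The regularized triplets converge weakly-star. -/
theorem tripletWeakStarTendsto (hm : Tendsto (fun N => (m N).e) atTop (𝓝 0))
    {μ : Triplet (ℝ × Space d) n k} (hG : μ.G.HasDensity C.ν C.X) (hq : μ.q.HasDensity C.ν C.Y)
    (hR : μ.R.HasDensity C.ν C.Z) :
    TripletWeakStarTendsto (timeSpace C.Ω) (fun N => C.triplet (m N)) μ := by
  have hQ := isCompact_timeSpace C.isCompact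
  have hη := fun N => C.isMollifier_kernel (m N)
  have hδ := C.tendsto_radius m hm
  have hstar := starConvex_timeSpace C.radius_le C.starConvex
  have he0 := fun N => (m N).e_pos
  have he1 : ∀ N, (m N).e ≤ 1 := fun N => by linarith [(m N).e_le]
  refine ⟨weakStarTendsto_of_smear hQ C.ae_mem hη hδ hstar he0 he1 hm (fun N => rfl) hG
      (fun N => (C.hasSmoothDensity_triplet (m N)).1.2) fun i j => ?_,
    weakStarTendsto_of_smear hQ C.ae_mem hη hδ hstar he0 he1 hm (fun N => rfl) hq
      (fun N => (C.hasSmoothDensity_triplet (m N)).2.1.2) fun i j => ?_,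
    weakStarTendsto_of_smear hQ C.ae_mem hη hδ hstar he0 he1 hm (fun N => rfl) hR
      (fun N => (C.hasSmoothDensity_triplet (m N)).2.2.2) fun i j => ?_⟩
  · refine squeeze_zero (fun N => integral_nonneg fun _ => abs_nonneg _)
      (fun N => C.integral_abs_densG_sub_le (m N) i j) ?_
    simpa using (((hm.mul_const _).add (hm.mul_const _)).add (hm.mul_const _)).add
      (C.tendsto_lift_bound m hm _ _)
  · refine squeeze_zero (fun N => integral_nonneg fun _ => abs_nonneg _)
      (fun N => C.integral_abs_densq_sub_le (m N) i j) ?_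
    simpa using hm.mul_const _
  · refine squeeze_zero (fun N => integral_nonneg fun _ => abs_nonneg _)
      (fun N => C.integral_abs_densR_sub_le (m N) i j) ?_
    simpa using hm.mul_const _

/-- The regularized boundary measures converge weakly-star. -/
theorem weakStarTendsto_bdryMeasure (hm : Tendsto (fun N => (m N).e) atTop (𝓝 0))
    {U : Space d → Matrix (Fin n) (Fin n) ℝ} {G : MatrixMeasure (Space d) n n}
    (hG : G.HasDensity C.ν' U) : WeakStarTendsto C.Ω (fun N => C.bdryMeasure (m N) U) G := by
  refine weakStarTendsto_of_smear C.isCompact C.ae_mem' (fun N => (m N).isMollifier_φ)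
    (C.tendsto_radius m hm) C.starConvex (fun N => (m N).e_pos)
    (fun N => by linarith [(m N).e_le]) hm (fun N => rfl) hG
    (fun N => (C.hasSmoothDensity_bdry (m N) fun i j => (hG i j).1).2) fun i j => ?_
  exact squeeze_zero (fun N => integral_nonneg fun _ => abs_nonneg _)
    (fun N => C.integral_abs_bdry_sub_le (m N) i j) (C.tendsto_lift_bound m hm _ _)

theorem action_eq {Λ₁ : Matrix (Fin k) (Fin k) ℝ} {Λ₂ : Matrix (Fin n) (Fin n) ℝ}
    {μ : Triplet (ℝ × Space d) n k} (hG : μ.G.HasDensity C.ν C.X) (hq : μ.q.HasDensity C.ν C.Y)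
    (hR : μ.R.HasDensity C.ν C.Z) :
    action Λ₁ Λ₂ (timeSpace C.Ω) μ = ∫⁻ w, costDensity Λ₁ Λ₂ (C.X w) (C.Y w) (C.Z w) ∂C.ν := by
  rw [action_eq_of_hasDensity Λ₁ Λ₂ (isCompact_timeSpace C.isCompact).measurableSet hG hq hR,
    Measure.restrict_eq_self_of_ae_mem C.ae_mem]

theorem action_triplet (Λ₁ : Matrix (Fin k) (Fin k) ℝ) (Λ₂ : Matrix (Fin n) (Fin n) ℝ)
    (m : Mollification d C.radius) :
    action Λ₁ Λ₂ (timeSpace C.Ω) (C.triplet m) =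
      ∫⁻ z in timeSpace C.Ω, costDensity Λ₁ Λ₂ (C.densG m z) (C.densq m z) (C.densR m z) := by
  obtain ⟨hG, hq, hR⟩ := C.hasSmoothDensity_triplet m
  have hQm := (isCompact_timeSpace C.isCompact).measurableSet
  rw [action_eq_of_hasDensity Λ₁ Λ₂ hQm hG.2 hq.2 hR.2, Measure.restrict_restrict hQm,
    Set.inter_self]

theorem pairing_eq_integral_frob {V : Type*} [TopologicalSpace V] [MeasurableSpace V]
    [OpensMeasurableSpace V] {ν : Measure V} {K : Set V} (hK : IsCompact K)
    (hνK : ∀ᵐ w ∂ν, w ∈ K) {p q : ℕ} {τ : MatrixMeasure V p q} {g A : V → Matrix (Fin p) (Fin q) ℝ}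
    (h : τ.HasDensity ν g) (hA : Continuous A) :
    Integrable (fun w => frob (g w) (A w)) ν ∧ τ.pairing A = ∫ w, frob (g w) (A w) ∂ν := by
  have hc : ∀ i j, Continuous fun w => A w i j := fun i j => hA.matrix_elem i j
  have hM := fun i j => hK.exists_bound_of_continuousOn (hc i j).continuousOn
  choose M hM using hM
  have hb : ∀ i j, Integrable (fun w => g w i j * A w i j) ν := fun i j =>
    ((h i j).1.bdd_mul (hc i j).measurable.aestronglyMeasurable
      (hνK.mono (hM i j))).congr (ae_of_all _ fun w => mul_comm _ _)
  obtain ⟨i1, e1⟩ := sum_integral_eq_integral_frob hb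
  refine ⟨i1, ?_⟩
  rw [← e1, h.pairing_eq (fun i j => (hc i j).measurable.aestronglyMeasurable)
    fun i j => ⟨M i j, hνK.mono (hM i j)⟩]
  simp only [mul_comm]

/-- The action is lower semicontinuous along the regularized triplets. -/
theorem eventually_lt_action_triplet {Λ₁ : Matrix (Fin k) (Fin k) ℝ}
    {Λ₂ : Matrix (Fin n) (Fin n) ℝ} (hm : Tendsto (fun N => (m N).e) atTop (𝓝 0))
    {μ : Triplet (ℝ × Space d) n k} (hG : μ.G.HasDensity C.ν C.X) (hq : μ.q.HasDensity C.ν C.Y)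
    (hR : μ.R.HasDensity C.ν C.Z) {c : ℝ≥0∞} (hc : c < action Λ₁ Λ₂ (timeSpace C.Ω) μ) :
    ∀ᶠ N in atTop, c < action Λ₁ Λ₂ (timeSpace C.Ω) (C.triplet (m N)) := by
  have hQ := isCompact_timeSpace C.isCompact
  rw [C.action_eq hG hq hR] at hc
  -- Continuous test functions that nearly attain the action of μ. By `hle` the same functions bound
  -- the cost of every other triplet from below, so weak-star convergence of the pairings suffices.
  obtain ⟨A, B, D, hA, hB, hD, hle, hlt⟩ := exists_continuous_lt_lintegral_costDensity
    C.integrable_X C.integrable_Y C.integrable_Z hc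
  obtain ⟨w1, w2, w3⟩ := C.tripletWeakStarTendsto m hm hG hq hR
  have hlim := ((w1 A hA.continuousOn).add (w2 B hB.continuousOn)).add (w3 D hD.continuousOn)
  obtain ⟨j1, f1⟩ := pairing_eq_integral_frob hQ C.ae_mem hG hA
  obtain ⟨j2, f2⟩ := pairing_eq_integral_frob hQ C.ae_mem hq hB
  obtain ⟨j3, f3⟩ := pairing_eq_integral_frob hQ C.ae_mem hR hD
  rw [f1, f2, f3, ← integral_add₃ j1 j2 j3] at hlim
  filter_upwards [(ENNReal.tendsto_ofReal hlim).eventually_const_lt hlt] with N hN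
  refine hN.trans_le ?_
  obtain ⟨hGN, hqN, hRN⟩ := C.hasSmoothDensity_triplet (m N)
  have hmem : ∀ᵐ z ∂volume.restrict (timeSpace C.Ω), z ∈ timeSpace C.Ω :=
    ae_restrict_mem hQ.measurableSet
  obtain ⟨k1, g1⟩ := pairing_eq_integral_frob hQ hmem hGN.2 hA
  obtain ⟨k2, g2⟩ := pairing_eq_integral_frob hQ hmem hqN.2 hB
  obtain ⟨k3, g3⟩ := pairing_eq_integral_frob hQ hmem hRN.2 hD
  rw [g1, g2, g3, ← integral_add₃ k1 k2 k3, action_triplet]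
  exact (ofReal_integral_le_lintegral_ofReal ((k1.add k2).add k3)).trans
    (lintegral_mono fun z => hle z _ _ _)

/-- The action of the regularized triplets converges. -/
theorem tendsto_action_triplet {Λ₁ : Matrix (Fin k) (Fin k) ℝ} (h₁ : Λ₁.IsSymm)
    {Λ₂ : Matrix (Fin n) (Fin n) ℝ} (h₂ : Λ₂.PosDef)
    (hm : Tendsto (fun N => (m N).e) atTop (𝓝 0))
    {μ : Triplet (ℝ × Space d) n k} (hG : μ.G.HasDensity C.ν C.X) (hq : μ.q.HasDensity C.ν C.Y)
    (hR : μ.R.HasDensity C.ν C.Z) (hfin : action Λ₁ Λ₂ (timeSpace C.Ω) μ < ⊤) :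
    (∀ N, action Λ₁ Λ₂ (timeSpace C.Ω) (C.triplet (m N)) < ⊤) ∧
    Tendsto (fun N => action Λ₁ Λ₂ (timeSpace C.Ω) (C.triplet (m N))) atTop
      (𝓝 (action Λ₁ Λ₂ (timeSpace C.Ω) μ)) := by
  have e0 := C.action_eq (Λ₁ := Λ₁) (Λ₂ := Λ₂) hG hq hR
  obtain ⟨K, hK, hle⟩ := C.exists_lintegral_costDensity_le Λ₁ h₁ Λ₂ h₂
    (ae_lt_top' (aemeasurable_costDensity Λ₁ Λ₂ C.integrable_X C.integrable_Y C.integrable_Z)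
      (e0 ▸ hfin.ne))
  rw [← e0] at hle
  simp only [← action_triplet] at hle
  refine ⟨fun N => (hle (m N)).trans_lt (ENNReal.mul_lt_top ENNReal.ofReal_lt_top hfin), ?_⟩
  -- Lower semicontinuity gives the lower bound; `hle`, whose factor tends to 1, gives the upper
  -- bound.
  refine tendsto_order.2 ⟨fun c hc => C.eventually_lt_action_triplet m hm hG hq hR hc,
    fun c hc => ?_⟩
  have t1 : Tendsto (fun N => (1 - (m N).e)⁻¹ + K * √(m N).e) atTop (𝓝 1) := by
    have := ((tendsto_const_nhds (x := (1 : ℝ))).sub hm).inv₀ (by norm_num)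
    simpa using this.add ((C.tendsto_sqrt m hm).const_mul K)
  have t2 := ENNReal.Tendsto.mul_const (b := action Λ₁ Λ₂ (timeSpace C.Ω) μ)
    (ENNReal.tendsto_ofReal t1) (Or.inr hfin.ne)
  rw [ENNReal.ofReal_one, one_mul] at t2
  filter_upwards [t2.eventually_lt_const hc] with N hN
  exact (hle (m N)).trans_lt hN

/-- Both sides integrate the same bounded function against the signed measure `G i j`, represented
by two different densities. -/
theorem smear_eq_of_hasDensity {ν : Measure (Space d)} {η : Space d → ℝ} {δ : ℝ}
    (hη : IsMollifier η δ) {F : Space d → Space d} (hF : Measurable F)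
    {U g : Space d → Matrix (Fin n) (Fin n) ℝ} {G : MatrixMeasure (Space d) n n} {Ω : Set (Space d)}
    (hΩ : MeasurableSet Ω) (hU : G.HasDensity ν U) (hg : G.HasDensity (volume.restrict Ω) g)
    (i j : Fin n) (y : Space d) :
    smear ν η F (fun x => U x i j) y =
      smear volume η F (Ω.indicator fun x => g x i j) y := by
  obtain ⟨M, hM⟩ := hη.exists_bound
  have hm := hη.measurable_sub hF y
  have h1 := integral_withDensityᵥ (hU i j).1 hm.aestronglyMeasurable
    (ae_of_all _ fun x => hM (y - F x))
  have h2 := integral_withDensityᵥ (hg i j).1 hm.aestronglyMeasurable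
    (ae_of_all _ fun x => hM (y - F x))
  rw [← (hU i j).2] at h1
  rw [← (hg i j).2, h1] at h2
  simp only [smear]
  rw [h2, ← integral_indicator hΩ]
  refine integral_congr_ae (ae_of_all _ fun x => ?_)
  by_cases hx : x ∈ Ω <;> simp [hx]

/-- A null set of the restricted Lebesgue measure meets Ω in a Lebesgue null set, and outside Ω
there is no mass. -/
theorem hasDensity_density_volume
    {G : MatrixMeasure (Space d) n n} {Ω : Set (Space d)} (hΩ : MeasurableSet Ω) (hG : G.IsOn Ω)
    (hac : G.AbsCont volume) :
    G.HasDensity (volume.restrict Ω) (G.density (volume.restrict Ω)) := by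
  refine MatrixMeasure.AbsCont.hasDensity fun i j s hs => ?_
  rw [Measure.restrict_apply' hΩ] at hs
  have h1 := hac i j hs
  have h2 := hG.totalVariation_compl hΩ i j
  refine measure_mono_null (t := (s ∩ Ω) ∪ Ωᶜ) (fun x hx => ?_) (measure_union_null h1 h2)
  by_cases h : x ∈ Ω
  · exact Or.inl ⟨hx, h⟩
  · exact Or.inr h

/-- Convergence of the boundary measures in the weighted Wasserstein-Bures distance. -/
theorem tendsto_wbDist_bdryMeasure {Λ₁ : Matrix (Fin k) (Fin k) ℝ} (h₁ : Λ₁.IsSymm)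
    {Λ₂ : Matrix (Fin n) (Fin n) ℝ} (h₂ : Λ₂.PosDef)
    (hm : Tendsto (fun N => (m N).e) atTop (𝓝 0))
    {U : Space d → Matrix (Fin n) (Fin n) ℝ} {G : MatrixMeasure (Space d) n n}
    (hGm : G ∈ psdMeasures C.Ω n) (hG : G.HasDensity C.ν' U)
    (hU : ∀ᵐ x ∂C.ν', (U x).PosSemidef) (hac : G.AbsCont volume) :
    Tendsto (fun N => wbDist Λ₁ Λ₂ C.D C.Ω G (C.bdryMeasure (m N) U)) atTop (𝓝 0) := by
  obtain ⟨K, hK, hle⟩ := exists_wbDist_le Λ₁ h₁ Λ₂ h₂ C.D C.isCompact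
  have hΩm := C.isCompact.measurableSet
  set g := G.density (volume.restrict C.Ω) with hgdef
  have hg : G.HasDensity (volume.restrict C.Ω) g :=
    hasDensity_density_volume hΩm hGm.1 hac
  have hU' : ∀ i j, Integrable (fun x => U x i j) C.ν' := fun i j => (hG i j).1
  have hlim : ∀ i j, Tendsto (fun N => ∫ y in C.Ω, |C.bdry (m N) U y i j - g y i j|) atTop
      (𝓝 0) := by
    intro i j
    have hgi : Integrable (C.Ω.indicator fun x => g x i j) volume :=
      (integrable_indicator_iff hΩm).2 (hg i j).1
    have t1 := tendsto_integral_abs_smear_sub (fun N => (m N).isMollifier_φ)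
      (C.tendsto_radius m hm) (fun N => by
        have := C.radius_le
        have := C.radius_pos
        have := (m N).e_le
        have := (m N).e_pos
        nlinarith) C.center hm (fun N => (m N).e_pos.le) (fun N => (m N).e_le) hgi
    have t2 := (C.tendsto_lift_bound m hm (∫ w, |(C.X w).trace| ∂C.ν)
      (volume.real C.Ω)).add t1
    rw [add_zero] at t2
    refine squeeze_zero (fun N => integral_nonneg fun _ => abs_nonneg _) (fun N => ?_) t2
    set s : Space d → ℝ := smear C.ν' (m N).φ (C.contractSpace (m N)) fun x => U x i j with hs
    have hse : ∀ y, s y = smear volume (m N).φ (shrink C.center (m N).e)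
        (C.Ω.indicator fun x => g x i j) y := fun y =>
      smear_eq_of_hasDensity (m N).isMollifier_φ (C.measurable_contractSpace (m N)) hΩm hG hg i j y
    have hsi : Integrable s (volume.restrict C.Ω) := C.integrable_base (m N) hU' i j
    have hbi := (C.hasSmoothDensity_bdry (m N) hU').2 i j
    have hsg : Integrable (fun y => smear volume (m N).φ (shrink C.center (m N).e)
        (C.Ω.indicator fun x => g x i j) y - C.Ω.indicator (fun x => g x i j) y) volume := by
      refine Integrable.sub ?_ hgi
      have := integrable_smear (m N).isMollifier_φ (C.measurable_contractSpace (m N)) Set.univ hgi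
      rwa [Measure.restrict_univ] at this
    -- The smeared endpoint s is intermediate: it differs from the regularized endpoint by the
    -- elliptic part, and from g by the L¹ approximation error.
    calc ∫ y in C.Ω, |C.bdry (m N) U y i j - g y i j|
        ≤ ∫ y in C.Ω, (|C.bdry (m N) U y i j - s y| + |s y - g y i j|) :=
          integral_mono (hbi.1.sub (hg i j).1).abs
            ((hbi.1.sub hsi).abs.add (hsi.sub (hg i j).1).abs) fun y => abs_sub_le _ _ _
      _ = (∫ y in C.Ω, |C.bdry (m N) U y i j - s y|) + ∫ y in C.Ω, |s y - g y i j| :=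
          integral_add (hbi.1.sub hsi).abs (hsi.sub (hg i j).1).abs
      _ ≤ _ := by
          refine add_le_add (C.integral_abs_bdry_sub_le (m N) i j) ?_
          refine le_trans (le_of_eq ?_) (setIntegral_le_integral hsg.abs
            (ae_of_all _ fun y => abs_nonneg _) (s := C.Ω))
          refine setIntegral_congr_fun hΩm fun y hy => ?_
          simp only [hse, Set.indicator_of_mem hy]
  have hsum : Tendsto (fun N => K * ∑ i, ∑ j, ∫ y in C.Ω, |C.bdry (m N) U y i j - g y i j|) atTop
      (𝓝 0) := by
    have := tendsto_finsetSum Finset.univ fun i (_ : i ∈ Finset.univ) =>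
      tendsto_finsetSum Finset.univ fun j (_ : j ∈ Finset.univ) => hlim i j
    simpa using this.const_mul K
  have hpow := (ENNReal.continuous_rpow_const (y := 1 / 2)).continuousAt.tendsto.comp
    (ENNReal.tendsto_ofReal hsum)
  rw [ENNReal.ofReal_zero, ENNReal.zero_rpow_of_pos (by norm_num)] at hpow
  exact tendsto_of_tendsto_of_tendsto_of_le_of_le tendsto_const_nhds hpow (fun N => zero_le)
    fun N => hle _ _ _ _ hg (C.hasSmoothDensity_bdry (m N) hU').2
      (hg.ae_posSemidef hGm.2) (ae_of_all _ fun y => C.posSemidef_bdry (m N) hU' hU y)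

end CurveData

/-! ### Densities of a finite-action curve and choice of the parameters -/

section Final

variable {d n k : ℕ}

theorem MatrixMeasure.HasDensity.pairing_eq_of_ae_mem {V : Type*} [TopologicalSpace V] [MeasurableSpace V]
    [OpensMeasurableSpace V] {ν : Measure V} {K : Set V} (hK : IsCompact K)
    (hνK : ∀ᵐ w ∂ν, w ∈ K) {p q : ℕ} {τ : MatrixMeasure V p q} {g A : V → Matrix (Fin p) (Fin q) ℝ}
    (h : τ.HasDensity ν g) (hA : ∀ i j, Continuous fun w => A w i j) :
    τ.pairing A = ∑ i, ∑ j, ∫ w, A w i j * g w i j ∂ν :=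
  h.pairing_eq (fun i j => (hA i j).measurable.aestronglyMeasurable) fun i j => by
    obtain ⟨M, hM⟩ := hK.exists_bound_of_continuousOn (hA i j).continuousOn
    exact ⟨M, hνK.mono hM⟩

theorem MatrixMeasure.isSymm_density {V : Type*} [MeasurableSpace V] {τ : MatrixMeasure V n n}
    (h : ∀ E, MeasurableSet E → (τ.value E).IsSymm) (ν : Measure V) (w : V) :
    (τ.density ν w).IsSymm := by
  ext i j
  have : τ j i = τ i j := VectorMeasure.ext fun E hE => (h E hE).apply i j
  simp only [MatrixMeasure.density, Matrix.transpose_apply, Matrix.of_apply, this]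

/-- Every curve of finite action is given by densities. -/
theorem exists_curveData {Ω : Set (Space d)} {Λ₁ : Matrix (Fin k) (Fin k) ℝ}
    {Λ₂ : Matrix (Fin n) (Fin n) ℝ} {D : DiffOp d n k} (hΩ : IsCompact Ω)
    (hstar : IsStarShapedWrtBall Ω) {G₀ G₁ : MatrixMeasure (Space d) n n}
    (hG₀ : G₀ ∈ psdMeasures Ω n) (hG₁ : G₁ ∈ psdMeasures Ω n) {μ : Triplet (ℝ × Space d) n k}
    (hμ : μ ∈ finiteEnergyCurves Λ₁ Λ₂ D Ω G₀ G₁) :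
    ∃ C : CurveData d n k, C.Ω = Ω ∧ C.D = D ∧ μ.G.HasDensity C.ν C.X ∧ μ.q.HasDensity C.ν C.Y ∧
      μ.R.HasDensity C.ν C.Z ∧ G₀.HasDensity C.ν' C.X₀ ∧ G₁.HasDensity C.ν' C.X₁ := by
  obtain ⟨⟨⟨hμG, hμq, hμR, hsymm⟩, hCE⟩, hfin⟩ := hμ
  have hQ := isCompact_timeSpace hΩ
  have hQm := hQ.measurableSet
  obtain ⟨x₀, hx₀⟩ := hstar
  obtain ⟨s, hs, hball⟩ := Metric.isOpen_iff.1 isOpen_interior x₀ hx₀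
  obtain ⟨hacG, hacq, hacR⟩ := μ.absCont_refMeasure
  have hac₀ : G₀.AbsCont (G₀.refMeasure + G₁.refMeasure) := fun i j =>
    (G₀.absCont_refMeasure i j).trans (Measure.AbsolutelyContinuous.rfl.add_right _)
  have hac₁ : G₁.AbsCont (G₀.refMeasure + G₁.refMeasure) := fun i j =>
    (G₁.absCont_refMeasure i j).trans
      (by rw [add_comm]; exact Measure.AbsolutelyContinuous.rfl.add_right _)
  have hmem : ∀ᵐ w ∂μ.refMeasure, w ∈ timeSpace Ω := by
    rw [ae_iff]
    have h1 := MatrixMeasure.refMeasure_compl hμG hQm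
    have h2 := MatrixMeasure.refMeasure_compl hμq hQm
    have h3 := MatrixMeasure.refMeasure_compl hμR hQm
    change μ.refMeasure (timeSpace Ω)ᶜ = 0
    simp only [Triplet.refMeasure, Measure.add_apply, h1, h2, h3, add_zero]
  have hmem' : ∀ᵐ x ∂(G₀.refMeasure + G₁.refMeasure), x ∈ Ω := by
    rw [ae_iff]
    have h1 := MatrixMeasure.refMeasure_compl hG₀.1 hΩ.measurableSet
    have h2 := MatrixMeasure.refMeasure_compl hG₁.1 hΩ.measurableSet
    change (G₀.refMeasure + G₁.refMeasure) Ωᶜ = 0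
    simp only [Measure.add_apply, h1, h2, add_zero]
  have dG := hacG.hasDensity
  have dq := hacq.hasDensity
  have dR := hacR.hasDensity
  have d₀ := hac₀.hasDensity
  have d₁ := hac₁.hasDensity
  have hJ : ∀ᵐ w ∂μ.refMeasure, costDensity Λ₁ Λ₂ (μ.G.density μ.refMeasure w)
      (μ.q.density μ.refMeasure w) (μ.R.density μ.refMeasure w) < ⊤ := by
    rw [action, Measure.restrict_eq_self_of_ae_mem hmem] at hfin
    exact ae_lt_top' (aemeasurable_costDensity Λ₁ Λ₂ (fun i j => (dG i j).1)
      (fun i j => (dq i j).1) fun i j => (dR i j).1) hfin.ne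
  refine ⟨{ Ω := Ω, isCompact := hΩ, D := D, ν := μ.refMeasure
            ν' := G₀.refMeasure + G₁.refMeasure
            X := μ.G.density μ.refMeasure
            Y := μ.q.density μ.refMeasure
            Z := μ.R.density μ.refMeasure
            X₀ := G₀.density (G₀.refMeasure + G₁.refMeasure)
            X₁ := G₁.density (G₀.refMeasure + G₁.refMeasure)
            integrable_X := fun i j => (dG i j).1
            integrable_Y := fun i j => (dq i j).1
            integrable_Z := fun i j => (dR i j).1
            integrable_X₀ := fun i j => (d₀ i j).1
            integrable_X₁ := fun i j => (d₁ i j).1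
            -- Positivity of G along the curve is not imposed; it follows from finiteness of the
            -- cost.
            posSemidef_X := hJ.mono fun w hw => posSemidef_of_costDensity_lt_top
              (MatrixMeasure.isSymm_density hsymm _ w) hw
            posSemidef_X₀ := d₀.ae_posSemidef hG₀.2
            posSemidef_X₁ := d₁.ae_posSemidef hG₁.2
            ae_mem := hmem
            ae_mem' := hmem'
            center := x₀
            -- The cap 1/2 keeps the time interval around 1/2 inside [0,1].
            radius := min s (1 / 2)
            radius_pos := lt_min hs (by norm_num)
            radius_le := min_le_right _ _
            starConvex := fun y hy => (interior_subset (hball (mem_ball_iff_norm.2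
              (hy.trans_le (min_le_left _ _))))).2
            weak_eq := fun Φ hΦ hs => ?_ }, rfl, rfl, dG, dq, dR, d₀, d₁⟩
  have h := hCE Φ hΦ hs
  rwa [MatrixMeasure.HasDensity.pairing_eq_of_ae_mem hQ hmem dG (A := timeDeriv Φ)
      fun i j => continuous_deriv_slice (hΦ i j),
    MatrixMeasure.HasDensity.pairing_eq_of_ae_mem hQ hmem dq (A := fun z => D.apply (fun y => Φ (z.1, y)) z.2)
      fun i j => continuous_apply_diffOp D hΦ i j,
    MatrixMeasure.HasDensity.pairing_eq_of_ae_mem hQ hmem dR (A := Φ) fun i j => (hΦ i j).continuous,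
    MatrixMeasure.HasDensity.pairing_eq_of_ae_mem hΩ hmem' d₁ (A := fun x => Φ (1, x))
      fun i j => (hΦ i j).continuous.comp (by fun_prop),
    MatrixMeasure.HasDensity.pairing_eq_of_ae_mem hΩ hmem' d₀ (A := fun x => Φ (0, x))
      fun i j => (hΦ i j).continuous.comp (by fun_prop)] at h

theorem exists_mollification {r : ℝ} (hr : 0 < r) {e : ℝ} (he : 0 < e) (he' : e ≤ 1 / 2) :
    ∃ m : Mollification d r, m.e = e := by
  obtain ⟨ψ, hψ, hψle⟩ := exists_isMollifier_real (mul_pos he hr)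
  obtain ⟨φ, hφ⟩ := exists_isMollifier (V := Space d) (mul_pos he hr)
  exact ⟨⟨e, he, he', ψ, φ, hψ, hφ, hψle⟩, rfl⟩

theorem exists_mollification_seq {r : ℝ} (hr : 0 < r) :
    ∃ m : ℕ → Mollification d r, Tendsto (fun N => (m N).e) atTop (𝓝 0) := by
  have h : ∀ N : ℕ, ∃ m : Mollification d r, m.e = 1 / ((N : ℝ) + 1) / 2 := fun N =>
    exists_mollification hr (by positivity) (by
      have : 1 / ((N : ℝ) + 1) ≤ 1 := by
        rw [div_le_one (by positivity)]
        linarith [(Nat.cast_nonneg N : (0 : ℝ) ≤ N)]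
      linarith)
  choose m hm using h
  refine ⟨m, ?_⟩
  simp only [hm]
  simpa using tendsto_one_div_add_atTop_nhds_zero_nat.div_const (2 : ℝ)

end Final

end

end MatrixOT

/-! ### The approximation theorem -/

theorem mainTheorem11 {d n k : ℕ} (Ω : Set (MatrixOT.Space d))
    (Λ₁ : Matrix (Fin k) (Fin k) ℝ) (hΛ₁ : Λ₁.PosSemidef)
    (Λ₂ : Matrix (Fin n) (Fin n) ℝ) (hΛ₂ : Λ₂.PosDef)
    (D : MatrixOT.DiffOp d n k)
    (hΩ : IsCompact Ω) (hstar : MatrixOT.IsStarShapedWrtBall Ω) (hD : D.Splits)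
    (G₀ G₁ : MatrixOT.MatrixMeasure (MatrixOT.Space d) n n)
    (hG₀ : G₀ ∈ MatrixOT.psdMeasures Ω n) (hG₁ : G₁ ∈ MatrixOT.psdMeasures Ω n)
    (μ : MatrixOT.Triplet (ℝ × MatrixOT.Space d) n k)
    (hμ : μ ∈ MatrixOT.finiteEnergyCurves Λ₁ Λ₂ D Ω G₀ G₁) :
    ∃ (μs : ℕ → MatrixOT.Triplet (ℝ × MatrixOT.Space d) n k)
      (G₀s G₁s : ℕ → MatrixOT.MatrixMeasure (MatrixOT.Space d) n n),
      (∀ N, G₀s N ∈ MatrixOT.psdMeasures Ω n ∧ G₁s N ∈ MatrixOT.psdMeasures Ω n ∧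
        μs N ∈ MatrixOT.finiteEnergyCurves Λ₁ Λ₂ D Ω (G₀s N) (G₁s N)) ∧
      (∀ N, (∃ g₀, MatrixOT.HasSmoothDensity (G₀s N) Ω g₀) ∧
        (∃ g₁, MatrixOT.HasSmoothDensity (G₁s N) Ω g₁) ∧
        (∃ q, MatrixOT.HasSmoothDensity (μs N).q (MatrixOT.timeSpace Ω) q) ∧
        (∃ R, MatrixOT.HasSmoothDensity (μs N).R (MatrixOT.timeSpace Ω) R) ∧
        ∃ G, MatrixOT.HasSmoothDensity (μs N).G (MatrixOT.timeSpace Ω) G ∧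
          MatrixOT.UniformlyElliptic (MatrixOT.timeSpace Ω) G) ∧
      MatrixOT.TripletWeakStarTendsto (MatrixOT.timeSpace Ω) μs μ ∧
      Tendsto (fun N => MatrixOT.action Λ₁ Λ₂ (MatrixOT.timeSpace Ω) (μs N)) atTop
        (𝓝 (MatrixOT.action Λ₁ Λ₂ (MatrixOT.timeSpace Ω) μ)) ∧
      MatrixOT.WeakStarTendsto Ω G₀s G₀ ∧ MatrixOT.WeakStarTendsto Ω G₁s G₁ ∧
      (G₀.AbsCont volume → G₁.AbsCont volume →
        Tendsto (fun N => MatrixOT.wbDist Λ₁ Λ₂ D Ω G₀ (G₀s N)) atTop (𝓝 0) ∧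
        Tendsto (fun N => MatrixOT.wbDist Λ₁ Λ₂ D Ω G₁ (G₁s N)) atTop (𝓝 0)) := by
  obtain ⟨C, rfl, rfl, hG, hq, hR, hX₀, hX₁⟩ :=
    MatrixOT.exists_curveData hΩ hstar hG₀ hG₁ hμ
  obtain ⟨m, hm⟩ := MatrixOT.exists_mollification_seq (d := d) C.radius_pos
  have h₁ := MatrixOT.PosSemidef.isSymm hΛ₁
  obtain ⟨hfin, hlim⟩ := C.tendsto_action_triplet m h₁ hΛ₂ hm hG hq hR hμ.2
  refine ⟨fun N => C.triplet (m N), fun N => C.bdryMeasure (m N) C.X₀,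
    fun N => C.bdryMeasure (m N) C.X₁, fun N =>
      ⟨C.bdryMeasure_mem (m N) C.integrable_X₀ C.posSemidef_X₀,
        C.bdryMeasure_mem (m N) C.integrable_X₁ C.posSemidef_X₁,
        C.triplet_mem_continuityEq (m N), hfin N⟩, fun N => ?_,
    C.tripletWeakStarTendsto m hm hG hq hR, hlim, C.weakStarTendsto_bdryMeasure m hm hX₀,
    C.weakStarTendsto_bdryMeasure m hm hX₁, fun hac₀ hac₁ =>
      ⟨C.tendsto_wbDist_bdryMeasure m h₁ hΛ₂ hm hG₀ hX₀ C.posSemidef_X₀ hac₀,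
        C.tendsto_wbDist_bdryMeasure m h₁ hΛ₂ hm hG₁ hX₁ C.posSemidef_X₁ hac₁⟩⟩
  obtain ⟨sG, sq, sR⟩ := C.hasSmoothDensity_triplet (m N)
  exact ⟨⟨_, C.hasSmoothDensity_bdry (m N) C.integrable_X₀⟩,
    ⟨_, C.hasSmoothDensity_bdry (m N) C.integrable_X₁⟩, ⟨_, sq⟩, ⟨_, sR⟩, _, sG,
    C.uniformlyElliptic_densG (m N)⟩
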